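/- \textbf{The model.} Let $D\ge 2$ and $\beta>0$. For $N\ge 1$ consider $D$ complex fermionic fields $\psi^1,\dots,\psi^D$, each with $N$ components $\psi^c_a(\tau)$, $\tau\in[-\beta/2,\beta/2]$, and a time-independent random coupling tensor $T=(T_{a^1\dots a^D})_{1\le a^c\le N}$, with action $$S=\int_{-\beta/2}^{\beta/2} d\tau\Big[\sum_{c,a}\bar\psi^c_{a}\partial_\tau\psi^c_{a}-J\sum_{a^1,\dots,a^D} T_{a^1\dots a^D}\psi^1_{a^1}\cdots\psi^D_{a^D}-\bar J\sum_{a^1,\dots,a^D}\bar\psi^D_{a^D}\cdots\bar\psi^1_{a^1}\bar T_{a^1\dots a^D}\Big].$$ The thermal partition function $Z^T=\int[d\bar\psi\, d\psi]\,e^{-S}$ is the formal power series in $J,\bar J$ obtained by expanding $e^{-S}$ in the couplings and integrating each term against the normalized Gaussian Grassmann integral with covariance $$\langle\psi^c_a(\tau)\bar\psi^{c'}_b(\tau')\rangle=\delta_{cc'}\delta_{ab}\,C(\tau,\tau'),\qquad C(\tau,\tau')=\tfrac12\operatorname{sgn}(\tau-\tau').$$ $\ln Z^T$ is the formal logarithm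 of this series. If $D$ is even, the components of $T$ are complex-valued (bosonic); if $D$ is odd, $T$ and $\bar T$ are generators of a Grassmann algebra (fermionic), anticommuting also with the fields. The bracket $\langle\cdot\rangle$ is the normalized Gaussian (for $D$ odd: Berezin) integral over $T,\bar T$ with weight $e^{-N^{D-1}\sum_{a}\bar T_{a}T_{a}}$, applied to each coefficient of a power series, so that $\langle 1\rangle=1$ and $\langle T_a\bar T_b\rangle=N^{-(D-1)}\delta_{ab}$. The quenched free energy is $\langle\ln Z^T\rangle$; the annealed free energy $\ln\langle Z^T\rangle$ is the formal logarithm of $\langle Z^T\rangle$. \textbf{Graphs.} A tuple $\sigma^{(0)}\sigma^{\mathcal D}=(\sigma^{(0)},\sigma^{(1)},\dots,\sigma^{(D)})$ of permutations of $\{1,\dots,k\}$ encodes the bipartite edge $(D+1)$-colored graph with $k$ labelled white and $k$ labelled black vertices in which, for each color $c$, the white vertex $i$ and the black vertex $\sigma^{(c)}(i)$ are joined by an edge of color $c$; $\sigma^{\mathcal D}=(\sigma^{(1)},\dots,\sigma^{(D)})$ is the $D$-colored graph obtained by deleting the edges of color $0$. Let $\mathcal C$ be the number of connected components of $\sigma^{(0)}\sigma^{\mathcal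 D}$ and $F$ its number of faces, i.e. the sum over the pairs of colors $c_1<c_2$ in $\{0,\dots,D\}$ of the number of cycles (fixed points included) of $\sigma^{(c_1)}[\sigma^{(c_2)}]^{-1}$. The degree $\omega(\sigma^{(0)}\sigma^{\mathcal D})$ is the number determined by $$F=\tfrac{D(D-1)}2\,k+D\,\mathcal C-\tfrac{2}{(D-1)!}\,\omega(\sigma^{(0)}\sigma^{\mathcal D}).$$ With $\epsilon$ the signature of a permutation, the partial amplitude of $\sigma^{\mathcal D}$ is $$A_{\sigma^{\mathcal D}}=(J\bar J)^k\Big(\prod_{c=1}^D\epsilon(\sigma^{(c)})\Big)\int_{[-\beta/2,\beta/2]^{2k}}\prod_{i=1}^k d\tau_i\,d\tau_i'\;\prod_{c=1}^D\prod_{i=1}^k C\big(\tau_i,\tau'_{\sigma^{(c)}(i)}\big).$$ \textbf{Theorem.} Order by order in $J$ and $\bar J$, that is, for the coefficient of each monomial $J^m\bar J^n$ with $D$ and $\beta$ fixed, both $\langle\ln Z^T\rangle$ and $\ln\langle Z^T\rangle$ scale at most like $N$ (they are $O(N)$ as $N\to\infty$), and the following limits exist and satisfy $$\lim_{N\to\infty}\frac{\langle\ln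 Z^T\rangle}{N}=\lim_{N\to\infty}\frac{\ln\langle Z^T\rangle}{N}=\sum_{k\ge1}\frac1{k!\,k!}\sum_{\substack{\sigma^{(0)}\sigma^{\mathcal D}\in\mathfrak S(k)^{D+1}\\ \sigma^{\mathcal D}\text{ connected},\ \omega(\sigma^{(0)}\sigma^{\mathcal D})=0}}A_{\sigma^{\mathcal D}}\,[\epsilon(\sigma^{(0)})]^D .$$ -/

import Mathlib

open Filter Topology MeasureTheory Asymptotics

noncomputable section

namespace ColoredSYK

/-! ### Edge coloured graphs encoded by tuples of permutations -/

/-- The bipartite graph of a tuple of permutations `s c` of `k` elements, one for each colour `c`: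
the white vertices are `Sum.inl i`, the black vertices are `Sum.inr j`, and the white vertex `i` is
joined to the black vertex `s c i` by an edge of colour `c`.
(Multiplicities and colours of edges play no role for connectedness.) -/
def coloredGraph {C : Type} {k : ℕ} (s : C → Equiv.Perm (Fin k)) :
    SimpleGraph (Fin k ⊕ Fin k) :=
  SimpleGraph.fromRel fun v w => ∃ (c : C) (i : Fin k), v = Sum.inl i ∧ w = Sum.inr (s c i)

/-- The number of connected components. -/
def numComponents {C : Type} {k : ℕ} (s : C → Equiv.Perm (Fin k)) : ℕ :=
  Nat.card (coloredGraph s).ConnectedComponent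

/-- The number of faces with colours `c₁ c₂`: the number of cycles, fixed points included, of the
permutation `s c₁ * (s c₂)⁻¹`. -/
def numFacesOfColors {C : Type} {k : ℕ} (s : C → Equiv.Perm (Fin k)) (c₁ c₂ : C) : ℕ :=
  Nat.card (Quotient (Equiv.Perm.SameCycle.setoid (s c₁ * (s c₂)⁻¹)))

/-- The total number of faces of a `(D+1)`-coloured graph: a sum over unordered pairs of colours. -/
def numFaces {D k : ℕ} (s : Fin (D + 1) → Equiv.Perm (Fin k)) : ℕ :=
  ∑ c₁ : Fin (D + 1), ∑ c₂ ∈ Finset.univ.filter (fun c₂ => c₁ < c₂), numFacesOfColors s c₁ c₂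

/-- The degree `ω` of a `(D+1)`-coloured graph with `k` white vertices: the number determined by
`F = D (D - 1) / 2 * k + D * C - 2 / (D - 1)! * ω`. -/
def degree {D k : ℕ} (s : Fin (D + 1) → Equiv.Perm (Fin k)) : ℚ :=
  ((D - 1).factorial : ℚ) / 2 *
    ((D : ℚ) * ((D : ℚ) - 1) / 2 * (k : ℚ) + (D : ℚ) * (numComponents s : ℚ) - (numFaces s : ℚ))

/-! ### The fermions -/

/-- The free propagator `C(τ, τ') = sgn(τ - τ') / 2`. -/
def propagator (τ τ' : ℝ) : ℝ := (SignType.sign (τ - τ') : ℝ) / 2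

/-- The factors of the monomials in the expansion of `exp (-S)`: the fields `ψ^c_a(τ)` and
`ψ̄^c_a(τ)`, and the components of the coupling tensor `T` or of its conjugate. -/
inductive Letter (D N : ℕ) : Type
  | coupling : Letter D N
  | psi : Fin D → Fin N → ℝ → Letter D N
  | psibar : Fin D → Fin N → ℝ → Letter D N

/-- The parity of a letter: the fields are odd (fermionic); the coupling is even (bosonic) for `D`
even and odd (fermionic) for `D` odd. -/
def Letter.parity {D N : ℕ} : Letter D N → ℕ
  | .coupling => D
  | .psi _ _ _ => 1
  | .psibar _ _ _ => 1

/-- The covariance of the free fields: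
`⟨ψ^c_a(τ) ψ̄^{c'}_b(τ')⟩ = δ_{cc'} δ_{ab} C(τ, τ') = - ⟨ψ̄^{c'}_b(τ') ψ^c_a(τ)⟩`. -/
def covariance {D N : ℕ} : Letter D N → Letter D N → ℂ
  | .psi c a τ, .psibar c' b τ' => if c = c' ∧ a = b then (propagator τ τ' : ℂ) else 0
  | .psibar c' b τ', .psi c a τ => if c = c' ∧ a = b then -(propagator τ τ' : ℂ) else 0
  | _, _ => 0

/-- The normalized Gaussian Grassmann integral over the fields of an ordered monomial, at fixed
coupling tensor. The integral is a scalar times the product of the coupling letters of the monomial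
in their order of appearance, and `fermionIntegral` is this scalar. A leading coupling letter
is taken out of the integral; a leading field is contracted with each of the later letters, with the
sign that arises from moving it next to its partner. -/
def fermionIntegral {D N : ℕ} : List (Letter D N) → ℂ
  | [] => 1
  | .coupling :: l => fermionIntegral l
  | x :: l => ∑ j : Fin l.length,
      (-1) ^ ((l.take j).map Letter.parity).sum * covariance x (l.get j) *
        fermionIntegral (l.eraseIdx j)
termination_by l => l.length
decreasing_by
  · simp
  · have := j.isLt
    simp only [List.length_eraseIdx, List.length_cons]
    split <;> omega

/-- The monomial
`∏ᵢ (T_{aᵢ} ψ^1_{aᵢ¹}(τᵢ) ⋯ ψ^D_{aᵢᴰ}(τᵢ)) ∏ⱼ (ψ̄^D_{bⱼᴰ}(τ'ⱼ) ⋯ ψ̄^1_{bⱼ¹}(τ'ⱼ) T̄_{bⱼ})`. -/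
def monomial {D N m n : ℕ} (a : Fin m → Fin D → Fin N) (b : Fin n → Fin D → Fin N)
    (τ : Fin m → ℝ) (τ' : Fin n → ℝ) : List (Letter D N) :=
  (List.ofFn fun i : Fin m =>
      Letter.coupling :: List.ofFn fun c : Fin D => Letter.psi c (a i c) (τ i)).flatten ++
    (List.ofFn fun j : Fin n =>
      (List.ofFn fun c : Fin D => Letter.psibar c (b j c) (τ' j)).reverse ++
        [Letter.coupling]).flatten

/-- The cube `[-β/2, β/2]^k` of the `k` time variables. -/
def timeCube (β : ℝ) (k : ℕ) : Set (Fin k → ℝ) := Set.univ.pi fun _ => Set.Icc (-β / 2) (β / 2)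

/-- The thermal partition function `Z^T` as a formal power series in `J` (variable `0`) and `J̄`
(variable `1`), for a coupling tensor `T`, `Tbar` with components in a `ℂ`-algebra `R` (complex
numbers if the coupling is bosonic, Grassmann generators if it is fermionic). The coefficient of
`J ^ m * J̄ ^ n` is `1 / (m! n!)` times the Gaussian Grassmann integral over the fields of
`(∑_a T_a ∫ ψ^1_{a¹} ⋯ ψ^D_{aᴰ})^m (∑_b ∫ ψ̄^D_{bᴰ} ⋯ ψ̄^1_{b¹} T̄_b)^n`. -/
def partitionFunction {R : Type} [Ring R] [Algebra ℂ R] (D N : ℕ) (β : ℝ)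
    (T Tbar : (Fin D → Fin N) → R) : MvPowerSeries (Fin 2) R := fun d =>
  (((d 0).factorial : ℂ) * ((d 1).factorial : ℂ))⁻¹ •
    ∑ a : Fin (d 0) → Fin D → Fin N, ∑ b : Fin (d 1) → Fin D → Fin N,
      (∫ τ in timeCube β (d 0), ∫ τ' in timeCube β (d 1), fermionIntegral (monomial a b τ τ')) •
        ((List.ofFn fun i => T (a i)).prod * (List.ofFn fun j => Tbar (b j)).prod)

/-- The formal logarithm `∑_{j ≥ 1} (-1)^(j+1) / j * (f - 1)^j` of a formal power series `f` with
constant coefficient `1`. Only the terms `j ≤ |d|` contribute to the coefficient of degree `d`. -/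
def formalLog {R : Type} [Ring R] [Algebra ℂ R] (f : MvPowerSeries (Fin 2) R) :
    MvPowerSeries (Fin 2) R := fun d =>
  ∑ j ∈ Finset.Icc 1 (d 0 + d 1),
    ((-1 : ℂ) ^ (j + 1) / (j : ℂ)) • MvPowerSeries.coeff d ((f - 1) ^ j)

/-! ### The disorder average -/

/-- The parameter `N ^ (D - 1)` of the Gaussian distribution of the coupling. -/
def gaussParam (D N : ℕ) : ℝ := (N : ℝ) ^ (D - 1)

/-- The distribution of a bosonic coupling: the components of `T` are independent centred complex
Gaussians with density `(N^(D-1) / π) exp (- N^(D-1) |T_a|²)` (note that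
`dT̄ dT / (2πi)` is `1 / π` times Lebesgue measure on the complex plane). -/
def bosonMeasure (D N : ℕ) : Measure ((Fin D → Fin N) → ℂ) :=
  Measure.pi fun _ => (volume : Measure ℂ).withDensity fun z =>
    ENNReal.ofReal (gaussParam D N / Real.pi * Real.exp (-(gaussParam D N * ‖z‖ ^ 2)))

/-- The Grassmann algebra generated by the components of `T` (`Sum.inl`) and `T̄` (`Sum.inr`). -/
abbrev TensorGrassmann (D N : ℕ) : Type :=
  ExteriorAlgebra ℂ (((Fin D → Fin N) ⊕ (Fin D → Fin N)) → ℂ)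

/-- The generator `T_a`. -/
def grassT {D N : ℕ} (a : Fin D → Fin N) : TensorGrassmann D N :=
  ExteriorAlgebra.ι ℂ (Pi.single (Sum.inl a) 1)

/-- The generator `T̄_a`. -/
def grassTbar {D N : ℕ} (a : Fin D → Fin N) : TensorGrassmann D N :=
  ExteriorAlgebra.ι ℂ (Pi.single (Sum.inr a) 1)

/-- The left Grassmann derivative with respect to the generator with index `x`. -/
def grassDeriv {D N : ℕ} (x : (Fin D → Fin N) ⊕ (Fin D → Fin N)) :
    TensorGrassmann D N →ₗ[ℂ] TensorGrassmann D N :=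
  CliffordAlgebra.contractLeft (LinearMap.proj x)

/-- The Berezin integral `∫ ∏_a dT̄_a dT_a f`. The order of the (even) factors `dT̄_a dT_a` is
irrelevant. -/
def berezin {D N : ℕ} (f : TensorGrassmann D N) : ℂ :=
  ExteriorAlgebra.algebraMapInv
    ((Finset.univ : Finset (Fin D → Fin N)).toList.foldr
      (fun a g => grassDeriv (Sum.inr a) (grassDeriv (Sum.inl a) g)) f)

/-- The Grassmann Gaussian weight `exp (- N^(D-1) ∑_a T̄_a T_a)`. The exponential series stops since
powers of the exponent higher than the number `N^D` of components vanish. -/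
def grassWeight (D N : ℕ) : TensorGrassmann D N :=
  ∑ n ∈ Finset.range (N ^ D + 1), ((n.factorial : ℂ)⁻¹) •
    (-((gaussParam D N : ℂ) • ∑ a : Fin D → Fin N, grassTbar a * grassT a)) ^ n

/-- The average over a fermionic coupling, normalized so that the average of `1` is `1`. -/
def fermionAverage {D N : ℕ} (f : TensorGrassmann D N) : ℂ :=
  berezin (grassWeight D N * f) / berezin (grassWeight D N)

/-- The quenched free energy `⟨ln Z^T⟩`, a formal power series in `J` and `J̄`. The coupling is
bosonic for `D` even and fermionic for `D` odd. -/
def quenchedFreeEnergy (D N : ℕ) (β : ℝ) : MvPowerSeries (Fin 2) ℂ := fun d =>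
  if Even D then
    ∫ T, MvPowerSeries.coeff d
      (formalLog (partitionFunction D N β T fun a => starRingEnd ℂ (T a))) ∂bosonMeasure D N
  else
    fermionAverage (MvPowerSeries.coeff d
      (formalLog (partitionFunction D N β (grassT (D := D) (N := N)) grassTbar)))

/-- The averaged partition function `⟨Z^T⟩`. -/
def averagedPartitionFunction (D N : ℕ) (β : ℝ) : MvPowerSeries (Fin 2) ℂ := fun d =>
  if Even D then
    ∫ T, MvPowerSeries.coeff d
      (partitionFunction D N β T fun a => starRingEnd ℂ (T a)) ∂bosonMeasure D N
  else
    fermionAverage (MvPowerSeries.coeff d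
      (partitionFunction D N β (grassT (D := D) (N := N)) grassTbar))

/-- The annealed free energy `ln ⟨Z^T⟩`. -/
def annealedFreeEnergy (D N : ℕ) (β : ℝ) : MvPowerSeries (Fin 2) ℂ :=
  formalLog (averagedPartitionFunction D N β)

/-! ### The leading order -/

/-- The partial amplitude of a `D`-coloured graph with `k` white vertices, without its factor
`(J J̄)^k`. -/
def amplitude {D k : ℕ} (β : ℝ) (s : Fin D → Equiv.Perm (Fin k)) : ℝ :=
  (∏ c, ((Equiv.Perm.sign (s c) : ℤ) : ℝ)) *
    ∫ τ in timeCube β k, ∫ τ' in timeCube β k, ∏ c, ∏ i, propagator (τ i) (τ' (s c i))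

open scoped Classical in
/-- The series
`∑_{k ≥ 1} 1 / (k! k!) ∑ A_{σ^D} ε(σ^(0))^D`, where the inner sum runs over the
`(D+1)`-coloured graphs `s = σ^(0) σ^D` of degree zero with `k` labelled white and `k` labelled
black vertices such that `σ^D` (the graph of `s` without the colour `0`) is connected; the
amplitude contains `(J J̄)^k`. The empty graph `k = 0` does not count as connected. -/
def leadingOrder (D : ℕ) (β : ℝ) : MvPowerSeries (Fin 2) ℂ := fun d =>
  if d 0 = d 1 then
    (((d 0).factorial : ℂ) * ((d 0).factorial : ℂ))⁻¹ *
      ∑ s ∈ (Finset.univ : Finset (Fin (D + 1) → Equiv.Perm (Fin (d 0)))).filter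
          (fun s => (coloredGraph fun c : Fin D => s c.succ).Connected ∧ degree s = 0),
        (amplitude β (fun c : Fin D => s c.succ) : ℂ) *
          ((Equiv.Perm.sign (s 0) : ℤ) : ℂ) ^ D
  else 0

end ColoredSYK

end

open Filter Topology MeasureTheory Asymptotics

noncomputable section
namespace ColoredSYK

open Module

/-! ### Fixed spaces of families of isometries -/

/-! Each coefficient is a finite sum over graphs, so the point is to find the power of N that a
graph carries. Wick's theorem for the fields (`fermionIntegral_monomial_eq_sum`) turns Z^T into a
sum over D-tuples of permutations, weighted by the amplitude and by products of pairs T_a T̄_b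
contracted along the edges. Such pairs are central, and permuting the T̄'s costs the D-th power of a
signature, which is what relabelling the vertices costs in the amplitude. The weights are therefore
invariant and multiplicative over disjoint unions, and the exponential formula
(`formalLog_diagonalSeries`) says that the logarithm keeps the connected graphs.

Averaging over T adds a permutation σ^(0) with sign ε(σ^(0))^D (`integral_prod_complexGaussian`,
`fermionAverage_couplingProd`). In the quenched case the logarithm comes first, so the graph must be
connected without its colour 0; in the annealed case it comes last, so only the whole graph must be
connected. Either way a graph carries N^(F_0 - (D-1)k), with F_0 the number of faces that contain
the colour 0 (`indexSum_eq_pow`).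

The combinatorial core is the inequality F_0 + (D-1) C(σ^D) ≤ (D-1) k + D C(σ)
(`numZeroFaces_add_le`), where C counts components. It is linear algebra: cycle and component counts
are dimensions of spaces of functions fixed, or moved alike, by the isometries induced by the
permutations σ^(0)[σ^(c)]⁻¹. For a connected graph it gives F_0 ≤ (D-1)k + 1, hence the bound O(N).
Equality forces σ^D to be connected, and summing triangle inequalities between face counts shows
that it also forces degree zero; the converse follows from the bound on all faces of σ^D
(`numZeroFaces_eq_iff`). The annealed graphs that the quenched sum lacks are thus strictly
subleading, and both limits agree. -/

lemma finrank_sup_add_le_sum_finrank {E ι : Type*} [AddCommGroup E] [Module ℝ E]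
    [FiniteDimensional ℝ E] (W : ι → Submodule ℝ E) (U : Submodule ℝ E) (hU : ∀ c, U ≤ W c)
    {s : Finset ι} (hs : s.Nonempty) :
    finrank ℝ ↥(s.sup W) + (s.card - 1) * finrank ℝ U ≤ ∑ c ∈ s, finrank ℝ (W c) := by
  induction hs using Finset.Nonempty.cons_induction with
  | singleton a => rw [Finset.sup_singleton]; simp
  | cons a s ha hs ih =>
    rw [Finset.sup_cons, Finset.sum_cons, Finset.card_cons]
    -- The new subspace meets the sum of the others at least in `U`, so each addition loses at least
    -- dim U.
    have h1 := Submodule.finrank_sup_add_finrank_inf_eq (W a) (s.sup W)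
    have h2 : finrank ℝ U ≤ finrank ℝ ↥(W a ⊓ s.sup W) := by
      obtain ⟨b, hb⟩ := hs
      exact Submodule.finrank_mono (le_inf (hU a) ((hU b).trans (Finset.le_sup (f := W) hb)))
    obtain ⟨n, hn⟩ : ∃ n, s.card = n + 1 := ⟨s.card - 1, by have := hs.card_pos; omega⟩
    rw [hn] at ih ⊢
    simp only [Nat.add_sub_cancel] at ih ⊢
    rw [add_mul, one_mul]
    omega

/-- The space of vectors fixed by an isometry. -/
def fixedSpace {E : Type*} [NormedAddCommGroup E] [InnerProductSpace ℝ E] (p : E ≃ₗᵢ[ℝ] E) :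
    Submodule ℝ E := LinearMap.eqLocus p.toLinearEquiv.toLinearMap LinearMap.id

lemma mem_fixedSpace {E : Type*} [NormedAddCommGroup E] [InnerProductSpace ℝ E]
    {p : E ≃ₗᵢ[ℝ] E} {v : E} : v ∈ fixedSpace p ↔ p v = v := by
  simp [fixedSpace, LinearMap.mem_eqLocus]

/-- The space of vectors with the same image under all members of a family of isometries. -/
def agreeSpace {E : Type*} [NormedAddCommGroup E] [InnerProductSpace ℝ E] {n : ℕ}
    (p : Fin (n + 1) → E ≃ₗᵢ[ℝ] E) : Submodule ℝ E :=
  ⨅ c, LinearMap.eqLocus (p c).toLinearEquiv.toLinearMap (p 0).toLinearEquiv.toLinearMap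

lemma mem_agreeSpace {E : Type*} [NormedAddCommGroup E] [InnerProductSpace ℝ E] {n : ℕ}
    {p : Fin (n + 1) → E ≃ₗᵢ[ℝ] E} {v : E} : v ∈ agreeSpace p ↔ ∀ c, p c v = p 0 v := by
  simp [agreeSpace, LinearMap.mem_eqLocus]

/-- For a fixed vector u, ⟨u, p v⟩ = ⟨p u, p v⟩ = ⟨u, v⟩. This is where isometries are needed rather
than mere linear bijections. -/
lemma sub_mem_orthogonal_fixedSpace {E : Type*} [NormedAddCommGroup E] [InnerProductSpace ℝ E]
    (p : E ≃ₗᵢ[ℝ] E) (v : E) : v - p v ∈ (fixedSpace p)ᗮ := by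
  rw [Submodule.mem_orthogonal]
  intro u hu
  rw [mem_fixedSpace] at hu
  rw [inner_sub_right, sub_eq_zero]
  conv_rhs => rw [← hu]
  exact (p.inner_map_map u v).symm

/-- On the agreement space the maps 1 - p_c all coincide, so their common image U lies in the
orthogonal complement of every fixed space. The n + 1 complements thus overlap in U, which limits
the dimension of their sum; that sum is the complement of the intersection of the fixed spaces. -/
theorem sum_finrank_fixedSpace_le {E : Type*} [NormedAddCommGroup E] [InnerProductSpace ℝ E]
    [FiniteDimensional ℝ E] {n : ℕ} (p : Fin (n + 1) → E ≃ₗᵢ[ℝ] E) :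
    ∑ c, finrank ℝ (fixedSpace (p c)) + n * finrank ℝ (agreeSpace p) ≤
      n * finrank ℝ E + (n + 1) * finrank ℝ ↥(⨅ c, fixedSpace (p c)) := by
  let f : E →ₗ[ℝ] E := LinearMap.id - (p 0).toLinearEquiv.toLinearMap
  have hf : ∀ v, f v = v - p 0 v := fun v => by simp [f]
  let U := (agreeSpace p).map f
  have hU : ∀ c, U ≤ (fixedSpace (p c))ᗮ := by
    rintro c _ ⟨v, hv, rfl⟩
    rw [hf, ← mem_agreeSpace.1 hv c]
    exact sub_mem_orthogonal_fixedSpace _ _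
  have h1 := finrank_sup_add_le_sum_finrank _ U hU (Finset.univ_nonempty (α := Fin (n + 1)))
  rw [Finset.sup_univ_eq_iSup, Finset.card_univ, Fintype.card_fin, Nat.add_sub_cancel] at h1
  have h2 : finrank ℝ ↥(⨅ c, fixedSpace (p c)) + finrank ℝ ↥(⨆ c, (fixedSpace (p c))ᗮ) =
      finrank ℝ E := by
    have := Submodule.finrank_add_finrank_orthogonal (⨆ c, (fixedSpace (p c))ᗮ)
    have e : (⨆ c, (fixedSpace (p c))ᗮ)ᗮ = ⨅ c, fixedSpace (p c) := by
      rw [← Submodule.iInf_orthogonal]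
      exact iInf_congr fun c => Submodule.orthogonal_orthogonal _
    rw [e] at this
    omega
  have h3 : ∑ c, finrank ℝ (fixedSpace (p c)) + ∑ c, finrank ℝ ↥(fixedSpace (p c))ᗮ =
      (n + 1) * finrank ℝ E := by
    rw [← Finset.sum_add_distrib]
    simp [Submodule.finrank_add_finrank_orthogonal]
  -- Rank-nullity for 1 - p_0 on the agreement space: a vector there that is fixed by p_0 is fixed
  -- by every p_c.
  have h4 : finrank ℝ (agreeSpace p) ≤ finrank ℝ U + finrank ℝ ↥(⨅ c, fixedSpace (p c)) := by
    have h := (f.domRestrict (agreeSpace p)).finrank_range_add_finrank_ker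
    rw [LinearMap.range_domRestrict] at h
    have h' : finrank ℝ (f.domRestrict (agreeSpace p)).ker ≤
        finrank ℝ ↥(⨅ c, fixedSpace (p c)) := by
      rw [← Submodule.finrank_map_subtype_eq]
      apply Submodule.finrank_mono
      rintro _ ⟨⟨v, hv⟩, hv0, rfl⟩
      have h0 : v - p 0 v = 0 := by
        rw [← hf]; exact hv0
      simp only [Submodule.subtype_apply, Submodule.mem_iInf, mem_fixedSpace]
      intro c
      rw [mem_agreeSpace.1 hv c, ← sub_eq_zero.1 h0]
    change finrank ℝ U + _ = _ at h
    omega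
  have h5 := Nat.mul_le_mul_left n h4
  rw [mul_add] at h5
  have e1 : (n + 1) * finrank ℝ E = n * finrank ℝ E + finrank ℝ E := by ring
  have e2 : (n + 1) * finrank ℝ ↥(⨅ c, fixedSpace (p c)) =
      n * finrank ℝ ↥(⨅ c, fixedSpace (p c)) + finrank ℝ ↥(⨅ c, fixedSpace (p c)) := by ring
  omega

lemma finrank_fixedSpace_add_le {E : Type*} [NormedAddCommGroup E] [InnerProductSpace ℝ E]
    [FiniteDimensional ℝ E] (p q r : E ≃ₗᵢ[ℝ] E) (h : ∀ v, p v = v → q v = v → r v = v) :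
    finrank ℝ (fixedSpace p) + finrank ℝ (fixedSpace q) ≤
      finrank ℝ E + finrank ℝ (fixedSpace r) := by
  have h1 := Submodule.finrank_sup_add_finrank_inf_eq (fixedSpace p) (fixedSpace q)
  have h2 : finrank ℝ ↥(fixedSpace p ⊓ fixedSpace q) ≤ finrank ℝ (fixedSpace r) :=
    Submodule.finrank_mono fun v hv => mem_fixedSpace.2
      (h v (mem_fixedSpace.1 hv.1) (mem_fixedSpace.1 hv.2))
  have h3 := Submodule.finrank_le (fixedSpace p ⊔ fixedSpace q)
  omega

/-! ### Functions that are constant on classes -/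

/-- Pullback along `q` identifies the functions on `Y` with `S`. This is the dictionary between
dimensions and numbers of cycles or components. -/
lemma finrank_eq_card_of_mem_iff {X Y : Type} [Fintype X] (q : X → Y)
    (hq : Function.Surjective q) (S : Submodule ℝ (EuclideanSpace ℝ X))
    (hS : ∀ f, f ∈ S ↔ ∀ x y, q x = q y → f x = f y) : finrank ℝ S = Nat.card Y := by
  have : Finite Y := Finite.of_surjective q hq
  have := Fintype.ofFinite Y
  let F : (Y → ℝ) →ₗ[ℝ] EuclideanSpace ℝ X :=
    (WithLp.linearEquiv 2 ℝ (X → ℝ)).symm.toLinearMap ∘ₗ LinearMap.funLeft ℝ ℝ q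
  have hF : ∀ g x, F g x = g (q x) := fun g x => rfl
  have hinj : Function.Injective F := by
    intro g g' h
    ext y
    obtain ⟨x, rfl⟩ := hq y
    rw [← hF g, h, hF]
  have hr : F.range = S := by
    ext f
    rw [hS]
    constructor
    · rintro ⟨g, rfl⟩ x y h
      rw [hF, hF, h]
    · intro h
      refine ⟨fun y => f (Function.surjInv hq y), ?_⟩
      ext x
      rw [hF]
      exact h _ _ (Function.surjInv_eq hq _)
  rw [← hr, LinearMap.finrank_range_of_inj hinj, Module.finrank_fintype_fun_eq_card,
    Nat.card_eq_fintype_card]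

/-- The action of a permutation on functions by precomposition. -/
def permIsometry {k : ℕ} (σ : Equiv.Perm (Fin k)) :
    EuclideanSpace ℝ (Fin k) ≃ₗᵢ[ℝ] EuclideanSpace ℝ (Fin k) :=
  LinearIsometryEquiv.piLpCongrLeft 2 ℝ ℝ σ.symm

@[simp] lemma permIsometry_apply {k : ℕ} (σ : Equiv.Perm (Fin k)) (f : EuclideanSpace ℝ (Fin k))
    (i : Fin k) : permIsometry σ f i = f (σ i) := by
  simp [permIsometry, LinearIsometryEquiv.piLpCongrLeft_apply, Equiv.piCongrLeft']

lemma permIsometry_eq_iff {k : ℕ} (σ τ : Equiv.Perm (Fin k)) (f : EuclideanSpace ℝ (Fin k)) :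
    permIsometry σ f = permIsometry τ f ↔ ∀ i, f (σ i) = f (τ i) := by
  constructor
  · intro h i
    simpa using congrArg (fun g : EuclideanSpace ℝ (Fin k) => g i) h
  · intro h
    ext i
    simpa using h i

lemma permIsometry_eq_self_iff {k : ℕ} (σ : Equiv.Perm (Fin k)) (f : EuclideanSpace ℝ (Fin k)) :
    permIsometry σ f = f ↔ ∀ i, f (σ i) = f i := by
  constructor
  · intro h i
    simpa using congrArg (fun g : EuclideanSpace ℝ (Fin k) => g i) h
  · intro h
    ext i
    simpa using h i

lemma perm_apply_inv {X : Type*} (σ : Equiv.Perm X) (x : X) : σ (σ⁻¹ x) = x :=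
  σ.apply_symm_apply x

lemma apply_eq_of_sameCycle {X Y : Type*} {σ : Equiv.Perm X} {f : X → Y}
    (h : ∀ i, f (σ i) = f i) {i j : X} (hij : σ.SameCycle i j) : f i = f j := by
  obtain ⟨n, rfl⟩ := hij
  induction n using Int.induction_on generalizing i with
  | zero => simp
  | succ n ih => rw [zpow_add_one, Equiv.Perm.mul_apply, ← ih, h]
  | pred n ih =>
    rw [zpow_sub_one, Equiv.Perm.mul_apply, ← ih]
    exact (congrArg f (perm_apply_inv σ i)).symm.trans (h _)

lemma finrank_fixedSpace_permIsometry {k : ℕ} (σ : Equiv.Perm (Fin k)) :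
    finrank ℝ (fixedSpace (permIsometry σ)) =
      Nat.card (Quotient (Equiv.Perm.SameCycle.setoid σ)) := by
  refine finrank_eq_card_of_mem_iff (Quotient.mk (Equiv.Perm.SameCycle.setoid σ))
    Quotient.mk_surjective _ fun f => ?_
  rw [mem_fixedSpace, permIsometry_eq_self_iff]
  constructor
  · intro h x y hxy
    exact apply_eq_of_sameCycle h (Quotient.exact hxy)
  · intro h i
    exact h _ _ (Quotient.sound ((Equiv.Perm.sameCycle_apply_left).2
      (Equiv.Perm.SameCycle.refl _ _)))

/-! ### Components of coloured graphs -/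

section

variable {C : Type} {k : ℕ} {s : C → Equiv.Perm (Fin k)}

lemma coloredGraph_adj (c : C) (i : Fin k) :
    (coloredGraph s).Adj (Sum.inl i) (Sum.inr (s c i)) := by
  simp only [coloredGraph, SimpleGraph.fromRel_adj]
  exact ⟨by simp, Or.inl ⟨c, i, rfl, rfl⟩⟩

lemma eq_of_reachable {Y : Type*} (f g : Fin k → Y) (h : ∀ c i, f i = g (s c i))
    {v w : Fin k ⊕ Fin k} (hvw : (coloredGraph s).Reachable v w) :
    Sum.elim f g v = Sum.elim f g w := by
  obtain ⟨p⟩ := hvw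
  induction p with
  | nil => rfl
  | cons hadj _ ih =>
    rw [← ih]
    simp only [coloredGraph, SimpleGraph.fromRel_adj] at hadj
    obtain ⟨-, ⟨c, i, rfl, rfl⟩ | ⟨c, i, rfl, rfl⟩⟩ := hadj
    · exact h c i
    · exact (h c i).symm

end

/-- A function f on the black vertices extends to the white ones by f ∘ s 0, which makes it constant
along the edges of colour 0. Invariance under s 0 (s c)⁻¹ says that it is also constant along the
edges of colour c. -/
lemma finrank_iInf_fixedSpace {n k : ℕ} (s : Fin (n + 2) → Equiv.Perm (Fin k)) :
    finrank ℝ ↥(⨅ c : Fin (n + 1), fixedSpace (permIsometry (s 0 * (s c.succ)⁻¹))) =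
      numComponents s := by
  refine finrank_eq_card_of_mem_iff
    (fun j => (coloredGraph s).connectedComponentMk (Sum.inr j)) ?_ _ fun f => ?_
  · intro K
    induction K using SimpleGraph.ConnectedComponent.ind with
    | h v =>
      rcases v with i | j
      · exact ⟨s 0 i, SimpleGraph.ConnectedComponent.eq.2 (coloredGraph_adj 0 i).reachable.symm⟩
      · exact ⟨j, rfl⟩
  · simp only [Submodule.mem_iInf, mem_fixedSpace, permIsometry_eq_self_iff]
    constructor
    · intro h x y hxy
      refine eq_of_reachable (fun i => f (s 0 i)) f (fun c i => ?_)
        (SimpleGraph.ConnectedComponent.exact hxy)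
      refine Fin.cases rfl (fun c => ?_) c
      simpa using h c (s c.succ i)
    · intro h c i
      refine h _ _ (SimpleGraph.ConnectedComponent.eq.2 ?_)
      have h1 := coloredGraph_adj (s := s) 0 ((s c.succ)⁻¹ i)
      have h2 := coloredGraph_adj (s := s) c.succ ((s c.succ)⁻¹ i)
      rw [perm_apply_inv] at h2
      exact h1.reachable.symm.trans h2.reachable

/-- Here `s 0` only transports f to the white vertices. That the functions f ∘ s 0 ∘ (s c)⁻¹ agree
for all c ≥ 1 means that the transported function reaches the black vertices independently of the
colour used, so it is constant on the components of the graph without colour 0. -/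
lemma finrank_agreeSpace {n k : ℕ} (s : Fin (n + 2) → Equiv.Perm (Fin k)) :
    finrank ℝ (agreeSpace fun c : Fin (n + 1) => permIsometry (s 0 * (s c.succ)⁻¹)) =
      numComponents (fun c : Fin (n + 1) => s c.succ) := by
  refine finrank_eq_card_of_mem_iff (fun j => (coloredGraph fun c : Fin (n + 1) =>
    s c.succ).connectedComponentMk (Sum.inl ((s 0)⁻¹ j))) ?_ _ fun f => ?_
  · intro K
    induction K using SimpleGraph.ConnectedComponent.ind with
    | h v =>
      rcases v with i | j
      · exact ⟨s 0 i, by simp⟩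
      · refine ⟨s 0 ((s (Fin.succ 0))⁻¹ j), SimpleGraph.ConnectedComponent.eq.2 ?_⟩
        have h2 := coloredGraph_adj (s := fun c : Fin (n + 1) => s c.succ) 0
          ((s (Fin.succ 0))⁻¹ j)
        rw [perm_apply_inv] at h2
        simpa using h2.reachable
  · simp only [mem_agreeSpace, permIsometry_eq_iff]
    constructor
    · intro h x y hxy
      have := eq_of_reachable (s := fun c : Fin (n + 1) => s c.succ) (fun i => f (s 0 i))
        (fun j => f (s 0 ((s (Fin.succ 0))⁻¹ j))) (fun c i => ?_)
        (SimpleGraph.ConnectedComponent.exact hxy)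
      · simpa using this
      · simpa using h c (s c.succ i)
    · intro h c i
      refine h _ _ (SimpleGraph.ConnectedComponent.eq.2 ?_)
      have h1 := coloredGraph_adj (s := fun c : Fin (n + 1) => s c.succ) c ((s c.succ)⁻¹ i)
      have h2 := coloredGraph_adj (s := fun c : Fin (n + 1) => s c.succ) 0
        ((s (Fin.succ 0))⁻¹ i)
      rw [perm_apply_inv] at h1 h2
      simpa using h1.reachable.trans h2.reachable.symm

/-! ### Bounds on the number of faces -/

/-- The number of faces with a colour `0`. -/
def numZeroFaces {D k : ℕ} (s : Fin (D + 1) → Equiv.Perm (Fin k)) : ℕ :=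
  ∑ c : Fin D, numFacesOfColors s 0 c.succ

/-- The dimension inequality for the isometries of s 0 (s c)⁻¹, whose cycles are the faces of
colours 0 and c. Each further component that appears when the colour 0 is deleted lowers the bound
on the faces by n. -/
theorem numZeroFaces_add_le {n k : ℕ} (s : Fin (n + 2) → Equiv.Perm (Fin k)) :
    numZeroFaces s + n * numComponents (fun c : Fin (n + 1) => s c.succ) ≤
      n * k + (n + 1) * numComponents s := by
  have h := sum_finrank_fixedSpace_le
    (fun c : Fin (n + 1) => permIsometry (s 0 * (s c.succ)⁻¹))
  rw [finrank_iInf_fixedSpace, finrank_agreeSpace, finrank_euclideanSpace_fin] at h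
  simp only [finrank_fixedSpace_permIsometry] at h
  exact h

/-- A function invariant under σ_a σ_b⁻¹ and σ_a σ_c⁻¹ is invariant under σ_b σ_c⁻¹; the rest is the
dimension formula for two subspaces. -/
lemma numFacesOfColors_triangle {C : Type} {k : ℕ} (s : C → Equiv.Perm (Fin k)) (a b c : C) :
    numFacesOfColors s a b + numFacesOfColors s a c ≤ k + numFacesOfColors s b c := by
  have h := finrank_fixedSpace_add_le (permIsometry (s a * (s b)⁻¹))
    (permIsometry (s a * (s c)⁻¹)) (permIsometry (s b * (s c)⁻¹)) (fun f h1 h2 => by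
      rw [permIsometry_eq_self_iff] at *
      intro i
      rw [← h2 i]
      simpa using (h1 (s b ((s c)⁻¹ i))).symm)
  simp only [finrank_fixedSpace_permIsometry, finrank_euclideanSpace_fin] at h
  exact h

lemma sum_filter_lt_succ {M : Type*} [AddCommMonoid M] {n : ℕ}
    (g : Fin (n + 1) → Fin (n + 1) → M) :
    ∑ a, ∑ b ∈ Finset.univ.filter (fun b => a < b), g a b =
      ∑ c : Fin n, g 0 c.succ +
        ∑ a : Fin n, ∑ b ∈ Finset.univ.filter (fun b => a < b), g a.succ b.succ := by
  simp only [Finset.sum_filter]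
  rw [Fin.sum_univ_succ]
  simp [Fin.sum_univ_succ, Fin.succ_pos]

lemma numFaces_eq {D k : ℕ} (s : Fin (D + 2) → Equiv.Perm (Fin k)) :
    numFaces s = numZeroFaces s + numFaces (D := D) (fun c => s c.succ) :=
  sum_filter_lt_succ (numFacesOfColors s)

/-- Nonnegativity of the degree. Peeling off the colour 0, the component count of the remaining
graph enters the two bounds with opposite signs and cancels. -/
theorem two_mul_numFaces_le {n k : ℕ} (s : Fin (n + 1) → Equiv.Perm (Fin k)) :
    2 * numFaces s ≤ n * (n - 1) * k + 2 * n * numComponents s := by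
  induction n with
  | zero => simp [numFaces]
  | succ n ih =>
    rw [numFaces_eq]
    have h1 := numZeroFaces_add_le s
    have h2 := ih (fun c => s c.succ)
    rw [Nat.add_sub_cancel]
    have h3 : (n + 1) * n * k = n * (n - 1) * k + 2 * (n * k) := by
      cases n with
      | zero => simp
      | succ m => rw [Nat.add_sub_cancel]; ring
    rw [h3]
    nlinarith

/-- Each index lies in n - 1 pairs; the extra sum on the left avoids a subtraction of natural
numbers. -/
lemma sum_filter_lt_add {n : ℕ} (x : Fin n → ℕ) :
    ∑ a, ∑ b ∈ Finset.univ.filter (fun b => a < b), (x a + x b) + ∑ a, x a = n * ∑ a, x a := by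
  induction n with
  | zero => simp
  | succ n ih =>
    rw [sum_filter_lt_succ, Finset.sum_add_distrib, Fin.sum_univ_succ]
    have := ih (fun a => x a.succ)
    simp only [Finset.sum_const, Finset.card_univ, Fintype.card_fin, smul_eq_mul]
    rw [add_mul, mul_add, one_mul, ← this]
    ring

lemma sum_filter_lt_const {n : ℕ} (m : ℕ) :
    2 * ∑ a : Fin n, ∑ _b ∈ Finset.univ.filter (fun b => a < b), m = n * (n - 1) * m := by
  have h := sum_filter_lt_add (fun _ : Fin n => m)
  simp only [← two_mul, ← Finset.mul_sum] at h
  rw [Finset.sum_const, Finset.card_univ, Fintype.card_fin, smul_eq_mul] at h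
  cases n with
  | zero => simp
  | succ n =>
    rw [Nat.add_sub_cancel]
    nlinarith

/-- The triangle inequality between the colours 0, a, b, summed over all pairs a < b of the n + 1
nonzero colours. Each face count with colour 0 occurs n times. -/
theorem le_two_mul_numFaces {n k : ℕ} (s : Fin (n + 2) → Equiv.Perm (Fin k)) :
    2 * n * numZeroFaces s ≤
      2 * numFaces (D := n) (fun c => s c.succ) + (n + 1) * n * k := by
  have h1 := sum_filter_lt_add (fun c : Fin (n + 1) => numFacesOfColors s 0 c.succ)
  have h2 := sum_filter_lt_const (n := n + 1) k
  rw [Nat.add_sub_cancel] at h2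
  have h3 : ∑ a : Fin (n + 1), ∑ b ∈ Finset.univ.filter (fun b => a < b),
      (numFacesOfColors s 0 a.succ + numFacesOfColors s 0 b.succ) ≤
      ∑ a : Fin (n + 1), ∑ b ∈ Finset.univ.filter (fun b => a < b), k +
        numFaces (D := n) (fun c => s c.succ) := by
    rw [numFaces, ← Finset.sum_add_distrib]
    refine Finset.sum_le_sum fun a _ => ?_
    rw [← Finset.sum_add_distrib]
    exact Finset.sum_le_sum fun b _ => numFacesOfColors_triangle s _ _ _
  change _ + numZeroFaces s = _ * numZeroFaces s at h1
  nlinarith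

/-! ### Extremal graphs and degree zero -/

lemma connected_iff_numComponents {C : Type} {k : ℕ} (s : C → Equiv.Perm (Fin k)) :
    (coloredGraph s).Connected ↔ numComponents s = 1 := by
  rw [numComponents, Nat.card_eq_one_iff_unique, SimpleGraph.connected_iff]
  constructor
  · rintro ⟨h1, h2⟩
    exact ⟨h1.subsingleton_connectedComponent, h2.map (coloredGraph s).connectedComponentMk⟩
  · rintro ⟨h1, ⟨K⟩⟩
    refine ⟨fun v w => SimpleGraph.ConnectedComponent.exact (Subsingleton.elim _ _), ?_⟩
    induction K using SimpleGraph.ConnectedComponent.ind with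
    | h v => exact ⟨v⟩

lemma degree_eq_zero_iff {n k : ℕ} (s : Fin (n + 2) → Equiv.Perm (Fin k)) :
    degree (D := n + 1) s = 0 ↔
      2 * numFaces s = (n + 1) * n * k + 2 * (n + 1) * numComponents s := by
  have h : ((n.factorial : ℕ) : ℚ) / 2 ≠ 0 :=
    div_ne_zero (Nat.cast_ne_zero.2 n.factorial_ne_zero) two_ne_zero
  rw [degree, Nat.add_sub_cancel, mul_eq_zero, or_iff_right h, ← Nat.cast_inj (R := ℚ)]
  push_cast
  constructor <;> intro h <;> linarith

/-- Deleting edges of a nonempty graph leaves at least one component, and this single component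
already absorbs n of the n + 1 in `numZeroFaces_add_le`. -/
lemma numZeroFaces_le {n k : ℕ} (s : Fin (n + 2) → Equiv.Perm (Fin k))
    (hs : (coloredGraph s).Connected) : numZeroFaces s ≤ n * k + 1 := by
  rw [connected_iff_numComponents] at hs
  have h := numZeroFaces_add_le s
  rw [hs] at h
  have h2 : 0 < numComponents (fun c : Fin (n + 1) => s c.succ) := by
    rw [numComponents, Nat.card_pos_iff]
    rw [numComponents, Nat.card_eq_one_iff_unique] at hs
    obtain ⟨-, ⟨K⟩⟩ := hs
    induction K using SimpleGraph.ConnectedComponent.ind with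
    | h v => exact ⟨⟨SimpleGraph.connectedComponentMk _ v⟩, inferInstance⟩
  nlinarith

lemma connected_of_connected_succ {n k : ℕ} {s : Fin (n + 1) → Equiv.Perm (Fin k)}
    (hs : (coloredGraph fun c : Fin n => s c.succ).Connected) : (coloredGraph s).Connected := by
  refine hs.mono fun v w h => ?_
  simp only [coloredGraph, SimpleGraph.fromRel_adj] at h ⊢
  obtain ⟨h0, ⟨c, i, h1, h2⟩ | ⟨c, i, h1, h2⟩⟩ := h
  · exact ⟨h0, Or.inl ⟨c.succ, i, h1, h2⟩⟩
  · exact ⟨h0, Or.inr ⟨c.succ, i, h1, h2⟩⟩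

/-- The graphs that maximize the number of faces with a colour `0` are those of degree zero that
stay connected when the edges of colour `0` are deleted. -/
theorem numZeroFaces_eq_iff {n k : ℕ} (hn : 1 ≤ n) (s : Fin (n + 2) → Equiv.Perm (Fin k))
    (hs : (coloredGraph s).Connected) :
    numZeroFaces s = n * k + 1 ↔
      (coloredGraph fun c : Fin (n + 1) => s c.succ).Connected ∧ degree (D := n + 1) s = 0 := by
  rw [degree_eq_zero_iff, connected_iff_numComponents]
  rw [connected_iff_numComponents] at hs
  have h1 := numZeroFaces_add_le s
  have h2 := two_mul_numFaces_le s
  have h3 := le_two_mul_numFaces s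
  have h4 := two_mul_numFaces_le (fun c : Fin (n + 1) => s c.succ)
  have h5 := numFaces_eq s
  rw [Nat.add_sub_cancel] at h2
  have h6 : (n + 1) * n * k = n * (n - 1) * k + 2 * (n * k) := by
    cases n with
    | zero => simp
    | succ m => rw [Nat.add_sub_cancel]; ring
  rw [hs] at h1 h2 ⊢
  constructor
  · intro h
    -- At the maximum `h1` reduces to n C ≤ n for the number C of components without colour 0. This
    -- is the step that needs D ≥ 2.
    have h7 : numComponents (fun c : Fin (n + 1) => s c.succ) ≤ 1 := by
      rw [h] at h1
      by_contra! h8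
      nlinarith
    have h8 : 0 < numComponents (fun c : Fin (n + 1) => s c.succ) := by
      by_contra! h0
      have h0 : numComponents (fun c : Fin (n + 1) => s c.succ) = 0 := by omega
      rw [h0] at h4
      rw [h] at h3
      rcases Nat.eq_zero_or_pos k with rfl | hk
      · simp at h4 h3
        rw [h4] at h3
        omega
      · nlinarith
    -- With F_0 = n k + 1, the triangle bound `h3` gives 2 F' ≥ n (n - 1) k + 2 n for the faces F'
    -- without colour 0; adding 2 F_0 reaches the maximum allowed by `h2`.
    refine ⟨by omega, le_antisymm h2 ?_⟩
    rw [h] at h3 h5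
    nlinarith
  -- Here the total is maximal while `h4` bounds the faces without colour 0, so the faces with
  -- colour 0 must make up the difference.
  · rintro ⟨h7, h8⟩
    rw [h7] at h1 h4
    nlinarith

end ColoredSYK
namespace ColoredSYK

/-! ### Components as minimal closed sets -/

/-- The white vertices `A` and the black vertices `B` span a union of connected components. -/
def IsClosedPair {C ι : Type} (s : C → Equiv.Perm ι) (A B : Set ι) : Prop :=
  ∀ c i, i ∈ A ↔ s c i ∈ B

/-- The white vertices `A` and the black vertices `B` span a connected component. -/
def IsComponent {C ι : Type} (s : C → Equiv.Perm ι) (A B : Set ι) : Prop :=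
  A.Nonempty ∧ IsClosedPair s A B ∧
    ∀ A' B' : Set ι, IsClosedPair s A' B' → A' ⊆ A → A'.Nonempty → A' = A

section

variable {C ι κ : Type} {s : C → Equiv.Perm ι} {A A' B B' : Set ι}

lemma IsClosedPair.inter (h : IsClosedPair s A B) (h' : IsClosedPair s A' B') :
    IsClosedPair s (A ∩ A') (B ∩ B') := fun c i => and_congr (h c i) (h' c i)

lemma IsClosedPair.compl (h : IsClosedPair s A B) : IsClosedPair s Aᶜ Bᶜ :=
  fun c i => not_congr (h c i)

lemma IsClosedPair.right_eq (c : C) (h : IsClosedPair s A B) : B = s c '' A := by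
  ext j
  obtain ⟨i, rfl⟩ := (s c).surjective j
  rw [(s c).injective.mem_set_image]
  exact (h c i).symm

lemma IsComponent.eq [Nonempty C] (h : IsComponent s A B) (h' : IsComponent s A' B') {i : ι}
    (hi : i ∈ A) (hi' : i ∈ A') : A = A' ∧ B = B' := by
  have e1 := h.2.2 _ _ (h.2.1.inter h'.2.1) Set.inter_subset_left ⟨i, hi, hi'⟩
  have e2 := h'.2.2 _ _ (h.2.1.inter h'.2.1) Set.inter_subset_right ⟨i, hi, hi'⟩
  have e : A = A' := e1.symm.trans e2
  refine ⟨e, ?_⟩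
  rw [h.2.1.right_eq (Classical.arbitrary C), h'.2.1.right_eq (Classical.arbitrary C), e]

/-- The intersection of all closed pairs that contain `i` is minimal because complements of closed
pairs are closed: a closed subset that misses `i` has a complement containing the whole
intersection, so it is empty. -/
lemma exists_isComponent (s : C → Equiv.Perm ι) (i : ι) : ∃ A B, IsComponent s A B ∧ i ∈ A := by
  let A : Set ι := {a | ∀ A' B', IsClosedPair s A' B' → i ∈ A' → a ∈ A'}
  let B : Set ι := {b | ∀ A' B', IsClosedPair s A' B' → i ∈ A' → b ∈ B'}
  have hi : i ∈ A := fun A' B' _ h => h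
  have hA : ∀ A' B', IsClosedPair s A' B' → i ∈ A' → A ⊆ A' := fun A' B' h h' a ha => ha A' B' h h'
  refine ⟨A, B, ⟨⟨i, hi⟩, fun c a => ?_, fun A' B' h hle hne => ?_⟩, hi⟩
  · exact forall₂_congr fun A' B' => forall₂_congr fun h _ => h c a
  · by_cases hiA : i ∈ A'
    · exact hle.antisymm (hA A' B' h hiA)
    · obtain ⟨a, ha⟩ := hne
      exact absurd ha (hA _ _ h.compl hiA (hle ha))

lemma isClosedPair_reindex (e f : ι ≃ κ) (s : C → Equiv.Perm ι) (A B : Set κ) :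
    IsClosedPair (fun c => (e.symm.trans (s c)).trans f) A B ↔
      IsClosedPair s (e ⁻¹' A) (f ⁻¹' B) := by
  refine forall_congr' fun c => ?_
  rw [← e.forall_congr_right]
  simp

lemma isComponent_reindex (e f : ι ≃ κ) (s : C → Equiv.Perm ι) (A B : Set κ) :
    IsComponent (fun c => (e.symm.trans (s c)).trans f) A B ↔
      IsComponent s (e ⁻¹' A) (f ⁻¹' B) := by
  unfold IsComponent
  refine and_congr ?_ (and_congr (isClosedPair_reindex e f s A B) ?_)
  · exact e.surjective.nonempty_preimage.symm
  · rw [e.injective.preimage_surjective.forall]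
    refine forall_congr' fun A' => ?_
    rw [f.injective.preimage_surjective.forall]
    refine forall_congr' fun B' => ?_
    rw [isClosedPair_reindex, e.surjective.preimage_subset_preimage_iff,
      e.surjective.preimage_injective.eq_iff, e.surjective.nonempty_preimage]

end

/-- Minimality is tested on the set reachable from one white vertex; conversely, membership in a
closed pair is constant along edges. -/
lemma isComponent_univ_iff {C : Type} [Nonempty C] {k : ℕ} (s : C → Equiv.Perm (Fin k)) :
    IsComponent s Set.univ Set.univ ↔ (coloredGraph s).Connected := by
  constructor
  · rintro ⟨⟨i0, -⟩, -, h⟩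
    let v0 : Fin k ⊕ Fin k := Sum.inl i0
    have hadj := coloredGraph_adj (s := s)
    have hA := h {i | (coloredGraph s).Reachable v0 (Sum.inl i)}
      {j | (coloredGraph s).Reachable v0 (Sum.inr j)}
      (fun c i => ⟨fun h => h.trans (hadj c i).reachable,
        fun h => h.trans (hadj c i).reachable.symm⟩)
      (Set.subset_univ _) ⟨i0, SimpleGraph.Reachable.refl _⟩
    have hv : ∀ v, (coloredGraph s).Reachable v0 v := by
      rintro (i | j)
      · exact (Set.ext_iff.1 hA i).2 trivial
      · let c := Classical.arbitrary C
        obtain ⟨i, rfl⟩ := (s c).surjective j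
        exact SimpleGraph.Reachable.trans ((Set.ext_iff.1 hA i).2 trivial) (hadj c i).reachable
    rw [SimpleGraph.connected_iff]
    exact ⟨fun v w => (hv v).symm.trans (hv w), ⟨v0⟩⟩
  · intro h
    obtain ⟨v⟩ := h.nonempty
    have i0 : Fin k := by rcases v with i | i <;> exact i
    refine ⟨⟨i0, trivial⟩, fun c i => by simp, fun A' B' hc _ hne => ?_⟩
    obtain ⟨a, ha⟩ := hne
    ext i
    have := eq_of_reachable (s := s) (fun i => i ∈ A') (fun j => j ∈ B')
      (fun c i => propext (hc c i)) (h.preconnected (Sum.inl a) (Sum.inl i))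
    simp only [Sum.elim_inl, eq_iff_iff] at this
    simp [← this, ha]

-- Every white vertex lies in exactly one component. This weighted count marks a white vertex
-- together with its component, the combinatorial form of x d/dx.
open scoped Classical in
lemma sum_card_components {C ι : Type} [Nonempty C] [Fintype ι] (s : C → Equiv.Perm ι) :
    ∑ A : Finset ι, ∑ B : Finset ι, (if IsComponent s (A : Set ι) (B : Set ι) then A.card else 0) =
      Fintype.card ι := by
  have h1 : ∀ A B : Finset ι, (if IsComponent s (A : Set ι) (B : Set ι) then A.card else 0) =
      ∑ i : ι, if IsComponent s (A : Set ι) (B : Set ι) ∧ i ∈ A then 1 else 0 := by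
    intro A B
    split_ifs with h <;> simp [h]
  simp only [h1]
  rw [← Fintype.sum_prod_type', Finset.sum_comm, ← Finset.card_univ, Finset.card_eq_sum_ones]
  refine Finset.sum_congr rfl fun i _ => ?_
  obtain ⟨A, B, h, hi⟩ := exists_isComponent s i
  rw [Finset.sum_eq_single (A.toFinset, B.toFinset)]
  · simp [h, hi]
  · rintro ⟨A', B'⟩ - hne
    rw [if_neg]
    rintro ⟨h', hi'⟩
    apply hne
    obtain ⟨rfl, rfl⟩ := h.eq h' hi hi'
    simp
  · simp

/-! ### Multiplicative weights -/

/-- A weight of coloured graphs that is invariant under relabellings of the white and of the black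
vertices and multiplicative under disjoint unions. -/
structure IsMultiplicative {C A : Type} [CommRing A]
    (w : ∀ (ι : Type) [Fintype ι] [DecidableEq ι], (C → Equiv.Perm ι) → A) : Prop where
  reindex : ∀ {ι κ : Type} [Fintype ι] [DecidableEq ι] [Fintype κ] [DecidableEq κ]
    (e f : ι ≃ κ) (s : C → Equiv.Perm ι),
    w κ (fun c => (e.symm.trans (s c)).trans f) = w ι s
  disjointUnion : ∀ {ι κ : Type} [Fintype ι] [DecidableEq ι] [Fintype κ] [DecidableEq κ]
    (s : C → Equiv.Perm ι) (t : C → Equiv.Perm κ),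
    w (ι ⊕ κ) (fun c => Equiv.sumCongr (s c) (t c)) = w ι s * w κ t
  empty : ∀ s : C → Equiv.Perm (Fin 0), w (Fin 0) s = 1

section

variable {C A : Type} [Fintype C] [DecidableEq C] [CommRing A]
  (w : ∀ (ι : Type) [Fintype ι] [DecidableEq ι], (C → Equiv.Perm ι) → A)

/-- The sum of the weights of all labelled graphs. -/
def totalWeight (k : ℕ) : A := ∑ s : C → Equiv.Perm (Fin k), w (Fin k) s

open scoped Classical in
/-- The sum of the weights of all connected labelled graphs. -/
def connectedWeight (k : ℕ) : A :=
  ∑ s : C → Equiv.Perm (Fin k), if (coloredGraph s).Connected then w (Fin k) s else 0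

variable {w}

-- Tuples that have the left summand as a component are pairs of a connected tuple on the left and
-- an arbitrary one on the right, and the weight factorises.
open scoped Classical in
lemma sum_isComponent_inl [Nonempty C] (hw : IsMultiplicative w) (j l : ℕ) :
    ∑ s : C → Equiv.Perm (Fin j ⊕ Fin l),
      (if IsComponent s (Set.range Sum.inl) (Set.range Sum.inl) then w _ s else 0) =
    connectedWeight w j * totalWeight w l := by
  rw [connectedWeight, totalWeight, Finset.sum_mul_sum, ← Fintype.sum_prod_type']
  symm
  have hcl : ∀ (s : C → Equiv.Perm (Fin j)) (t : C → Equiv.Perm (Fin l)) (A B : Set (Fin j)),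
      IsClosedPair (fun c => Equiv.sumCongr (s c) (t c)) (Sum.inl '' A) (Sum.inl '' B) ↔
        IsClosedPair s A B := by
    intro s t A B
    refine forall_congr' fun c => ?_
    rw [Sum.forall]
    simp
  refine Fintype.sum_of_injective
    (fun p : (C → Equiv.Perm (Fin j)) × (C → Equiv.Perm (Fin l)) =>
      fun c => Equiv.sumCongr (p.1 c) (p.2 c)) ?_ _ _ ?_ ?_
  · rintro ⟨s, t⟩ ⟨s', t'⟩ h
    have h1 : ∀ c, s c = s' c ∧ t c = t' c := by
      intro c
      have hc : Equiv.Perm.sumCongrHom (Fin j) (Fin l) (s c, t c) =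
        Equiv.Perm.sumCongrHom (Fin j) (Fin l) (s' c, t' c) := congrFun h c
      exact Prod.mk.inj (Equiv.Perm.sumCongrHom_injective hc)
    exact Prod.ext (funext fun c => (h1 c).1) (funext fun c => (h1 c).2)
  -- If the left summand is closed, every permutation maps it to itself and is therefore of block
  -- form.
  · intro σ hσ
    rw [if_neg]
    intro h
    apply hσ
    have hc : ∀ c, ∃ p, Equiv.Perm.sumCongrHom (Fin j) (Fin l) p = σ c := fun c =>
      Equiv.Perm.mem_sumCongrHom_range_of_perm_mapsTo_inl fun x hx => (h.2.1 c x).1 hx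
    choose p hp using hc
    exact ⟨(fun c => (p c).1, fun c => (p c).2), funext hp⟩
  · rintro ⟨s, t⟩
    dsimp only
    rw [hw.disjointUnion, ite_mul, zero_mul]
    refine if_congr ?_ rfl rfl
    rw [← isComponent_univ_iff, ← Set.image_univ]
    unfold IsComponent
    rw [hcl, Set.image_nonempty]
    refine and_congr_right fun _ => and_congr_right fun _ => ⟨fun h A' B' hc hle hne => ?_,
      fun h A' B' hc _ hne => ?_⟩
    · obtain ⟨A', rfl⟩ := Set.subset_range_iff_exists_image_eq.1 (hle.trans (Set.image_subset_range _ _))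
      have hB : B' ⊆ Set.range Sum.inl := by
        rw [hc.right_eq (Classical.arbitrary C)]
        rintro _ ⟨_, ⟨i, -, rfl⟩, rfl⟩
        exact ⟨_, rfl⟩
      obtain ⟨B', rfl⟩ := Set.subset_range_iff_exists_image_eq.1 hB
      rw [h A' B' ((hcl s t A' B').1 hc) (Set.subset_univ _) (Set.image_nonempty.1 hne)]
    · exact Sum.inl_injective.image_injective (h _ _ ((hcl s t A' B').2 hc)
        (Set.image_mono (Set.subset_univ _)) (hne.image _))

lemma exists_equiv_preimage {j l : ℕ} (A : Finset (Fin (j + l))) (hA : A.card = j) :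
    ∃ e : Fin j ⊕ Fin l ≃ Fin (j + l), e ⁻¹' (A : Set (Fin (j + l))) = Set.range Sum.inl := by
  have h1 : Fintype.card {i // i ∈ A} = j := by simpa using hA
  have h2 : Fintype.card {i // i ∉ A} = l := by
    have := Fintype.card_subtype_compl (fun i => i ∈ A)
    rw [this, h1]
    simp
  refine ⟨(Equiv.sumCongr (Fintype.equivFinOfCardEq h1).symm
    (Fintype.equivFinOfCardEq h2).symm).trans (Equiv.sumCompl (fun i => i ∈ A)), ?_⟩
  ext (i | i)
  · simp
  · simpa using ((Fintype.equivFinOfCardEq h2).symm i).2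

lemma sum_reindex {ι κ : Type} [Fintype ι] [DecidableEq ι] [Fintype κ] [DecidableEq κ]
    {M : Type*} [AddCommMonoid M] (e f : ι ≃ κ) (φ : (C → Equiv.Perm κ) → M) :
    ∑ s : C → Equiv.Perm κ, φ s =
      ∑ s : C → Equiv.Perm ι, φ (fun c => (e.symm.trans (s c)).trans f) :=
  (Equiv.sum_comp (Equiv.piCongrRight fun _ : C => Equiv.equivCongr e f) φ).symm

-- Only the cardinalities matter: white and black vertices can be relabelled independently so that
-- `A` and `B` become the left summand. Unequal cardinalities are impossible, since every `s c` maps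
-- `A` onto `B`.
open scoped Classical in
lemma sum_isComponent [Nonempty C] (hw : IsMultiplicative w) {k : ℕ} (A B : Finset (Fin k)) :
    ∑ s : C → Equiv.Perm (Fin k), (if IsComponent s (A : Set (Fin k)) B then w _ s else 0) =
      if A.card = B.card then connectedWeight w A.card * totalWeight w (k - A.card) else 0 := by
  split_ifs with h
  · obtain ⟨j, hj⟩ : ∃ j, A.card = j := ⟨_, rfl⟩
    have hk : j ≤ k := by
      rw [← hj]
      simpa using A.card_le_univ
    obtain ⟨l, rfl⟩ := Nat.exists_eq_add_of_le hk
    obtain ⟨e, he⟩ := exists_equiv_preimage A hj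
    obtain ⟨f, hf⟩ := exists_equiv_preimage B (h.symm.trans hj)
    rw [hj, Nat.add_sub_cancel_left, ← sum_isComponent_inl hw, sum_reindex e f]
    refine Finset.sum_congr rfl fun s _ => ?_
    rw [hw.reindex]
    refine if_congr ?_ rfl rfl
    rw [isComponent_reindex, he, hf]
  · refine Finset.sum_eq_zero fun s _ => if_neg fun hs => h ?_
    have := hs.2.1.right_eq (Classical.arbitrary C)
    rw [← Set.ncard_coe_finset A, ← Set.ncard_coe_finset B, this,
      Set.ncard_image_of_injective _ (Equiv.injective _)]

/-- Mark a white vertex and sum over the component that contains it. This is x Z' = (x c') Z at the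
level of coefficients; the binomial coefficient is squared because white and black labels are chosen
independently. -/
theorem mul_totalWeight [Nonempty C] (hw : IsMultiplicative w) (k : ℕ) :
    (k : A) * totalWeight w k = ∑ j ∈ Finset.range (k + 1),
      ((k.choose j : A) * (k.choose j : A)) *
        ((j : A) * (connectedWeight w j * totalWeight w (k - j))) := by
  classical
  have h1 : (k : A) * totalWeight w k = ∑ X : Finset (Fin k), ∑ Y : Finset (Fin k),
      (X.card : A) * if X.card = Y.card then
        connectedWeight w X.card * totalWeight w (k - X.card) else 0 := by
    rw [totalWeight, Finset.mul_sum]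
    have h2 : ∀ s : C → Equiv.Perm (Fin k), (k : A) * w (Fin k) s =
        ∑ X : Finset (Fin k), ∑ Y : Finset (Fin k),
          (X.card : A) * (if IsComponent s (X : Set (Fin k)) Y then w _ s else 0) := by
      intro s
      have h0 := congrArg (Nat.cast (R := A)) (sum_card_components s)
      rw [Fintype.card_fin] at h0
      rw [← h0]
      push_cast
      simp only [Finset.sum_mul]
      refine Finset.sum_congr rfl fun X _ => Finset.sum_congr rfl fun Y _ => ?_
      simp only [mul_ite, ite_mul, mul_zero, zero_mul]
    simp only [h2]
    rw [Finset.sum_comm]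
    refine Finset.sum_congr rfl fun X _ => ?_
    rw [Finset.sum_comm]
    refine Finset.sum_congr rfl fun Y _ => ?_
    rw [← Finset.mul_sum, sum_isComponent hw]
  rw [h1]
  have h3 : ∀ X : Finset (Fin k), ∑ Y : Finset (Fin k),
      (X.card : A) * (if X.card = Y.card then
        connectedWeight w X.card * totalWeight w (k - X.card) else 0) =
      (k.choose X.card : A) * ((X.card : A) *
        (connectedWeight w X.card * totalWeight w (k - X.card))) := by
    intro X
    simp only [mul_ite, mul_zero]
    rw [← Finset.sum_filter, Finset.sum_const, nsmul_eq_mul]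
    congr 2
    have := Finset.card_powersetCard X.card (Finset.univ : Finset (Fin k))
    rw [Finset.card_univ, Fintype.card_fin] at this
    rw [← this]
    congr 1
    ext Y
    simp [Finset.mem_powersetCard, eq_comm]
  simp only [h3]
  rw [← Finset.powerset_univ, Finset.sum_powerset_apply_card (fun j => (k.choose j : A) *
    ((j : A) * (connectedWeight w j * totalWeight w (k - j)))), Finset.card_univ, Fintype.card_fin]
  refine Finset.sum_congr rfl fun j _ => ?_
  rw [nsmul_eq_mul]
  ring

end

/-! ### The formal logarithm -/

section

variable {A : Type} [CommRing A] [Algebra ℂ A]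

/-- The derivation of power series that multiplies the monomial of degree `d` by `l d`. -/
def eulerDeriv (l : (Fin 2 →₀ ℕ) →+ ℂ) :
    Derivation ℂ (MvPowerSeries (Fin 2) A) (MvPowerSeries (Fin 2) A) :=
  Derivation.mk'
    { toFun := fun f d => l d • MvPowerSeries.coeff d f
      map_add' := fun f g => by
        ext d
        change l d • MvPowerSeries.coeff d (f + g) =
          l d • MvPowerSeries.coeff d f + l d • MvPowerSeries.coeff d g
        rw [map_add, smul_add]
      map_smul' := fun r f => by
        ext d
        change l d • MvPowerSeries.coeff d (r • f) = r • l d • MvPowerSeries.coeff d f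
        rw [smul_comm r]
        rfl }
    (fun f g => by
      ext d
      change l d • MvPowerSeries.coeff d (f * g) = MvPowerSeries.coeff d (f * _ + g * _)
      rw [mul_comm g, map_add, MvPowerSeries.coeff_mul, MvPowerSeries.coeff_mul,
        MvPowerSeries.coeff_mul, ← Finset.sum_add_distrib, Finset.smul_sum]
      refine Finset.sum_congr rfl fun p hp => ?_
      change _ = MvPowerSeries.coeff p.1 f * (l p.2 • MvPowerSeries.coeff p.2 g) +
        (l p.1 • MvPowerSeries.coeff p.1 f) * MvPowerSeries.coeff p.2 g
      rw [← Finset.HasAntidiagonal.mem_antidiagonal.1 hp, map_add, add_smul, mul_smul_comm, smul_mul_assoc,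
        add_comm])

@[simp] lemma coeff_eulerDeriv (l : (Fin 2 →₀ ℕ) →+ ℂ) (f : MvPowerSeries (Fin 2) A)
    (d : Fin 2 →₀ ℕ) :
    MvPowerSeries.coeff d (eulerDeriv l f) = l d • MvPowerSeries.coeff d f := rfl

/-- With g = f - 1, differentiating the truncated logarithm produces a geometric sum times E g = (E
c)(1 + g). It telescopes to E c minus a remainder (-g)^M E c, so no chain rule for the logarithm is
needed. -/
theorem coeff_formalLog_of_eulerDeriv (l : (Fin 2 →₀ ℕ) →+ ℂ) (f c : MvPowerSeries (Fin 2) A)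
    (hf : MvPowerSeries.constantCoeff f = 1) (h : eulerDeriv l f = eulerDeriv l c * f)
    (d : Fin 2 →₀ ℕ) (hd : l d ≠ 0) :
    MvPowerSeries.coeff d (formalLog f) = MvPowerSeries.coeff d c := by
  set g := f - 1 with hg
  set M := d 0 + d 1 with hM
  let P : MvPowerSeries (Fin 2) A :=
    ∑ j ∈ Finset.Icc 1 M, ((-1 : ℂ) ^ (j + 1) / (j : ℂ)) • g ^ j
  have h1 : MvPowerSeries.coeff d (formalLog f) = MvPowerSeries.coeff d P := by
    simp only [P, map_sum]
    rfl
  have h2 : eulerDeriv l P = eulerDeriv l c - (-g) ^ M * eulerDeriv l c := by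
    have h3 : eulerDeriv l P = (∑ i ∈ Finset.range M, (-g) ^ i) * eulerDeriv l g := by
      simp only [P, map_sum, Derivation.map_smul, Derivation.leibniz_pow]
      rw [Finset.range_eq_Ico, Finset.sum_mul, Finset.sum_Ico_eq_sum_range, ← Finset.Ico_add_one_right_eq_Icc,
        Finset.sum_Ico_eq_sum_range]
      refine Finset.sum_congr rfl fun i _ => ?_
      have h4 : ((1 + i : ℕ) : ℂ) ≠ 0 := by
        rw [Nat.cast_ne_zero]; omega
      rw [← Nat.cast_smul_eq_nsmul ℂ, smul_smul, div_mul_cancel₀ _ h4, Nat.add_sub_cancel_left,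
        smul_eq_mul, zero_add, neg_pow g i, add_right_comm, pow_add]
      norm_num
      rw [← smul_mul_assoc, Algebra.smul_def, map_pow, map_neg, map_one]
    have h4 : eulerDeriv l g = eulerDeriv l c * (1 - -g) := by
      rw [hg, map_sub, Derivation.map_one_eq_zero, sub_zero, h]
      ring
    rw [h3, h4, mul_left_comm, geom_sum_mul_neg]
    ring
  -- Both g and E c have zero constant term, so the remainder has order at least M + 1, above the
  -- total degree M of `d`.
  have h3 : MvPowerSeries.coeff d ((-g) ^ M * eulerDeriv l c) = 0 := by
    apply MvPowerSeries.coeff_of_lt_order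
    have hc : (1 : ℕ∞) ≤ (eulerDeriv l c).order := by
      rw [MvPowerSeries.one_le_order_iff_constCoeff_eq_zero,
        ← MvPowerSeries.coeff_zero_eq_constantCoeff_apply, coeff_eulerDeriv, map_zero, zero_smul]
    have hg0 : (M : ℕ∞) ≤ ((-g) ^ M).order := by
      apply MvPowerSeries.le_order_pow_of_constantCoeff_eq_zero
      rw [map_neg, hg, map_sub, hf, map_one, sub_self, neg_zero]
    have hdeg : d.degree = M := by
      rw [Finsupp.degree_eq_sum, Fin.sum_univ_two]
    rw [hdeg]
    refine lt_of_lt_of_le ?_ MvPowerSeries.le_order_mul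
    refine lt_of_lt_of_le ?_ (add_le_add hg0 hc)
    exact_mod_cast Nat.lt_succ_self M
  have h5 := congrArg (MvPowerSeries.coeff d) h2
  rw [map_sub, h3, sub_zero, coeff_eulerDeriv, coeff_eulerDeriv] at h5
  rw [h1]
  have := congrArg (fun x => (l d)⁻¹ • x) h5
  simpa [smul_smul, hd] using this

/-- The degree in the variable `i`. -/
def varDegree (i : Fin 2) : (Fin 2 →₀ ℕ) →+ ℂ :=
  (Nat.castAddMonoidHom ℂ).comp (Finsupp.applyAddHom i)

lemma varDegree_apply (i : Fin 2) (d : Fin 2 →₀ ℕ) : varDegree i d = (d i : ℂ) := rfl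

end

/-- The exponential generating function in both kinds of labels of a sequence of weights. -/
def diagonalSeries {A : Type} [CommRing A] [Algebra ℂ A] (z : ℕ → A) : MvPowerSeries (Fin 2) A :=
  fun d => if d 0 = d 1 then
    (((d 0).factorial : ℂ) * ((d 0).factorial : ℂ))⁻¹ • z (d 0) else 0

lemma coeff_diagonalSeries {A : Type} [CommRing A] [Algebra ℂ A] (z : ℕ → A) (d : Fin 2 →₀ ℕ) :
    MvPowerSeries.coeff d (diagonalSeries z) = if d 0 = d 1 then
      (((d 0).factorial : ℂ) * ((d 0).factorial : ℂ))⁻¹ • z (d 0) else 0 := rfl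

/-- Exponential formula: the formal logarithm of the generating function of a multiplicative
weight is the generating function of connected graphs. -/
theorem formalLog_diagonalSeries {C A : Type} [Fintype C] [DecidableEq C] [Nonempty C]
    [CommRing A] [Algebra ℂ A]
    {w : ∀ (ι : Type) [Fintype ι] [DecidableEq ι], (C → Equiv.Perm ι) → A}
    (hw : IsMultiplicative w) :
    formalLog (diagonalSeries (totalWeight w)) = diagonalSeries (connectedWeight w) := by
  classical
  have hc0 : connectedWeight w 0 = 0 := by
    refine Finset.sum_eq_zero fun s _ => if_neg fun h => ?_
    obtain ⟨v⟩ := h.nonempty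
    rcases v with i | i <;> exact i.elim0
  have hz0 : totalWeight w 0 = 1 := by
    simp only [totalWeight, hw.empty]
    simp
  have hf : MvPowerSeries.constantCoeff (diagonalSeries (totalWeight w)) = 1 := by
    rw [← MvPowerSeries.coeff_zero_eq_constantCoeff_apply, coeff_diagonalSeries]
    simp [hz0]
  -- The recursion `mul_totalWeight`, read as a differential equation in the first variable.
  have hE0 : eulerDeriv (varDegree 0) (diagonalSeries (totalWeight w)) =
      eulerDeriv (varDegree 0) (diagonalSeries (connectedWeight w)) *
        diagonalSeries (totalWeight w) := by
    ext d
    rw [coeff_eulerDeriv, coeff_diagonalSeries, varDegree_apply, MvPowerSeries.coeff_mul]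
    simp only [coeff_eulerDeriv, coeff_diagonalSeries, varDegree_apply]
    split_ifs with hd
    · rw [smul_smul]
      have hfac : ∀ n : ℕ, (n.factorial : ℂ) ≠ 0 := fun n =>
        Nat.cast_ne_zero.2 n.factorial_ne_zero
      have hcast : ∀ (n : ℕ) (x : A), (n : A) * x = (n : ℂ) • x := fun n x => by
        rw [← nsmul_eq_mul, Nat.cast_smul_eq_nsmul]
      have hrec := mul_totalWeight hw (d 0)
      set k := d 0 with hk
      have h1 : ((k : ℂ) * ((k.factorial : ℂ) * (k.factorial : ℂ))⁻¹) • totalWeight w k =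
          ((k.factorial : ℂ) * (k.factorial : ℂ))⁻¹ • ((k : A) * totalWeight w k) := by
        rw [mul_comm, mul_smul, hcast]
      rw [h1, hrec, Finset.smul_sum]
      -- Only diagonal exponents contribute to the product, so the antidiagonal of (k, k) collapses
      -- to the pairs (j, j), (k - j, k - j).
      let δ : ℕ → (Fin 2 →₀ ℕ) := fun j => Finsupp.equivFunOnFinite.symm fun _ => j
      have hδ : ∀ j i, δ j i = j := fun j i => rfl
      refine Finset.sum_of_injOn (fun j => (δ j, δ (k - j))) ?_ ?_ ?_ ?_
      · intro j _ j' _ h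
        have h2 := congrArg (fun p : (Fin 2 →₀ ℕ) × (Fin 2 →₀ ℕ) => p.1 0) h
        exact h2
      · intro j hj
        have hj' : j < k + 1 := by simpa using hj
        rw [Finset.mem_coe, Finset.HasAntidiagonal.mem_antidiagonal]
        ext i
        rw [Finsupp.add_apply, hδ, hδ]
        fin_cases i
        · change j + (k - j) = k
          omega
        · change j + (k - j) = d 1
          omega
      · rintro ⟨p, q⟩ hp hnot
        rw [Finset.HasAntidiagonal.mem_antidiagonal] at hp
        dsimp only at hp ⊢
        have e0 := DFunLike.congr_fun hp 0
        have e1 := DFunLike.congr_fun hp 1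
        rw [Finsupp.add_apply] at e0 e1
        split_ifs with hp1 hq1
        · exfalso
          apply hnot
          refine ⟨p 0, ?_, ?_⟩
          · simp only [Finset.coe_range, Set.mem_Iio]
            omega
          · refine Prod.ext ?_ ?_ <;> ext i <;> fin_cases i
            · rfl
            · exact hp1
            · change k - p 0 = q 0
              omega
            · change k - p 0 = q 1
              omega
        · simp
        · simp
        · simp
      · intro j hj
        have hj' : j ≤ k := by
          rw [Finset.mem_range] at hj
          omega
        dsimp only
        simp only [hδ, if_true]
        rw [smul_smul, smul_mul_smul_comm, ← Nat.cast_mul (α := A), hcast, hcast, smul_smul,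
          smul_smul]
        congr 1
        rw [Nat.cast_mul, Nat.cast_choose ℂ hj']
        have f1 := hfac k
        have f2 := hfac j
        have f3 := hfac (k - j)
        field_simp
    · rw [smul_zero]
      symm
      refine Finset.sum_eq_zero fun p hp => ?_
      rw [Finset.HasAntidiagonal.mem_antidiagonal] at hp
      have e0 := DFunLike.congr_fun hp 0
      have e1 := DFunLike.congr_fun hp 1
      rw [Finsupp.add_apply] at e0 e1
      split_ifs with hp1 hq1
      · omega
      · simp
      · simp
      · simp
  -- The first Euler derivation says nothing about exponents with d 0 = 0. The difference of the two
  -- degrees kills diagonal series and detects the exponents of that kind with d 1 ≠ 0.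
  have hE1 : eulerDeriv (varDegree 0 - varDegree 1) (diagonalSeries (totalWeight w)) =
      eulerDeriv (varDegree 0 - varDegree 1) (diagonalSeries (connectedWeight w)) *
        diagonalSeries (totalWeight w) := by
    have : ∀ z : ℕ → A, eulerDeriv (varDegree 0 - varDegree 1) (diagonalSeries z) = 0 := by
      intro z
      ext d
      rw [coeff_eulerDeriv, coeff_diagonalSeries, AddMonoidHom.sub_apply, varDegree_apply,
        varDegree_apply]
      split_ifs with h <;> simp [h]
    rw [this, this, zero_mul]
  ext d
  by_cases h0 : d 0 = 0
  · by_cases h1 : d 1 = 0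
    · rw [coeff_diagonalSeries, h0, hc0, smul_zero, ite_self]
      change ∑ j ∈ Finset.Icc 1 (d 0 + d 1), _ = _
      rw [h0, h1]
      simp
    · refine coeff_formalLog_of_eulerDeriv _ _ _ hf hE1 d ?_
      rw [AddMonoidHom.sub_apply, varDegree_apply, varDegree_apply, h0]
      simpa using h1
  · refine coeff_formalLog_of_eulerDeriv _ _ _ hf hE0 d ?_
    rw [varDegree_apply]
    exact_mod_cast h0

end ColoredSYK
namespace ColoredSYK

/-! ### The Wick theorem for the fermionic fields -/

section

variable {D N : ℕ}

/-- The sum of the contractions of the field `x` with the letters of a list, where `f` is applied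
to the list of the remaining letters. -/
def contract (x : Letter D N) : (List (Letter D N) → ℂ) → List (Letter D N) → ℂ
  | _, [] => 0
  | f, y :: l => covariance x y * f l +
      (-1) ^ y.parity * contract x (fun l' => f (y :: l')) l

/-- A letter is a field. -/
def Letter.isField : Letter D N → Bool
  | .coupling => false
  | _ => true

/-- A letter is one of the fields `ψ`. -/
def Letter.isPsi : Letter D N → Bool
  | .psi _ _ _ => true
  | _ => false

/-- A letter is one of the fields `ψ̄`. -/
def Letter.isPsibar : Letter D N → Bool
  | .psibar _ _ _ => true
  | _ => false

lemma sum_eq_contract (x : Letter D N) (f : List (Letter D N) → ℂ) (l : List (Letter D N)) :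
    ∑ j : Fin l.length, (-1) ^ ((l.take j).map Letter.parity).sum * covariance x (l.get j) *
        f (l.eraseIdx j) = contract x f l := by
  induction l generalizing f with
  | nil => rfl
  | cons y l ih =>
    change ∑ j : Fin (l.length + 1), _ = _
    rw [Fin.sum_univ_succ, contract, ← ih, Finset.mul_sum]
    congr 1
    · simp
    · refine Finset.sum_congr rfl fun j _ => ?_
      simp [pow_add, mul_assoc]

@[simp] lemma fermionIntegral_nil : fermionIntegral ([] : List (Letter D N)) = 1 := by
  rw [fermionIntegral]

@[simp] lemma fermionIntegral_coupling (l : List (Letter D N)) :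
    fermionIntegral (Letter.coupling :: l) = fermionIntegral l := by
  rw [fermionIntegral]

lemma fermionIntegral_cons (x : Letter D N) (hx : x.isField) (l : List (Letter D N)) :
    fermionIntegral (x :: l) = contract x fermionIntegral l := by
  rw [← sum_eq_contract]
  cases x with
  | coupling => simp [Letter.isField] at hx
  | psi c a t => rw [fermionIntegral]; simp
  | psibar c a t => rw [fermionIntegral]; simp

lemma contract_eq_zero (x : Letter D N) (f : List (Letter D N) → ℂ) (l : List (Letter D N))
    (h : ∀ y ∈ l, covariance x y = 0) : contract x f l = 0 := by
  induction l generalizing f with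
  | nil => rfl
  | cons y l ih =>
    rw [contract, h y (by simp), ih _ fun z hz => h z (by simp [hz])]
    simp

lemma contract_append (x : Letter D N) (f : List (Letter D N) → ℂ) (l l' : List (Letter D N))
    (h : ∀ y ∈ l, covariance x y = 0) :
    contract x f (l ++ l') =
      (-1) ^ (l.map Letter.parity).sum * contract x (fun l'' => f (l ++ l'')) l' := by
  induction l generalizing f with
  | nil => simp
  | cons y l ih =>
    rw [List.cons_append, contract, h y (by simp), ih _ fun z hz => h z (by simp [hz])]
    simp [pow_add, mul_assoc]

lemma covariance_of_isPsi {x y : Letter D N} (hx : x.isPsi) (hy : y.isPsibar = false) :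
    covariance x y = 0 := by
  cases x <;> cases y <;> simp_all [Letter.isPsi, Letter.isPsibar, covariance]

lemma covariance_of_isPsibar {x y : Letter D N} (hx : x.isPsibar) (hy : y.isPsi = false) :
    covariance x y = 0 := by
  cases x <;> cases y <;> simp_all [Letter.isPsi, Letter.isPsibar, covariance]

/-- The list of the fields in a list of letters. -/
def fields (l : List (Letter D N)) : List (Letter D N) := l.filter Letter.isField

@[simp] lemma fields_nil : fields ([] : List (Letter D N)) = [] := rfl

@[simp] lemma fields_coupling (l : List (Letter D N)) :
    fields (Letter.coupling :: l) = fields l := rfl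

lemma fields_cons {x : Letter D N} (hx : x.isField) (l : List (Letter D N)) :
    fields (x :: l) = x :: fields l := List.filter_cons_of_pos hx

lemma fields_append (l l' : List (Letter D N)) : fields (l ++ l') = fields l ++ fields l' :=
  List.filter_append _ _

/-- A nonzero contraction removes exactly one field and adds no letter, as the covariance with a
coupling vanishes. Hence only such remaining lists matter. -/
lemma contract_congr (x : Letter D N) (f g : List (Letter D N) → ℂ) (l : List (Letter D N))
    (h : ∀ l', (fields l').length + 1 = (fields l).length → (∀ y ∈ l', y ∈ l) → f l' = g l') :
    contract x f l = contract x g l := by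
  induction l generalizing f g with
  | nil => rfl
  | cons y l ih =>
    rw [contract, contract]
    congr 1
    · cases hy : y.isField with
      | false =>
        have : covariance x y = 0 := by
          cases x <;> cases y <;> simp_all [Letter.isField, covariance]
        rw [this, zero_mul, zero_mul]
      | true => rw [h l (by simp [fields_cons hy]) (fun z hz => by simp [hz])]
    · congr 1
      refine ih _ _ fun l' h1 h2 => h _ ?_ ?_
      · cases hy : y.isField with
        | false =>
          have hy' : y = Letter.coupling := by cases y <;> simp_all [Letter.isField]
          simpa [hy'] using h1
        | true => simpa [fields_cons hy] using h1
      · intro z hz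
        rcases List.mem_cons.1 hz with rfl | hz
        · simp
        · simp [h2 z hz]

/-- The sign from moving the couplings to the left through the fields. -/
def leftSign : List (Letter D N) → ℂ
  | [] => 1
  | .coupling :: l => leftSign l
  | _ :: l => (-1) ^ (D * (l.length - (fields l).length)) * leftSign l

/-- The sign from moving the couplings to the right through the fields. -/
def rightSign : List (Letter D N) → ℂ
  | [] => 1
  | .coupling :: l => (-1) ^ (D * (fields l).length) * rightSign l
  | _ :: l => rightSign l

lemma leftSign_psi (c : Fin D) (a : Fin N) (t : ℝ) (l : List (Letter D N)) :
    leftSign (Letter.psi c a t :: l) =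
      (-1) ^ (D * (l.length - (fields l).length)) * leftSign l := by
  rw [leftSign]
  simp

lemma rightSign_psibar (c : Fin D) (a : Fin N) (t : ℝ) (l : List (Letter D N)) :
    rightSign (Letter.psibar c a t :: l) = rightSign l := by
  rw [rightSign]
  simp

lemma contract_const_mul (r : ℂ) (x : Letter D N) (g : List (Letter D N) → ℂ)
    (l : List (Letter D N)) : contract x (fun l' => r * g l') l = r * contract x g l := by
  induction l generalizing g with
  | nil => simp [contract]
  | cons z l ih => rw [contract, contract, ih]; ring

/-- Removing a field to the right of a coupling drops one factor (-1)^D from the sign of that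
coupling; the contracted ψ supplies the same factor when it moves past the coupling. -/
lemma contract_rightSign (x : Letter D N) (hx : x.isPsi) (g : List (Letter D N) → ℂ)
    (l : List (Letter D N)) (hl : ∀ y ∈ l, y.isPsi = false) :
    contract x (fun l' => rightSign l' * g (fields l')) l =
      rightSign l * contract x g (fields l) := by
  induction l generalizing g with
  | nil => simp [contract]
  | cons y l ih =>
    have hl' : ∀ y ∈ l, y.isPsi = false := fun z hz => hl z (by simp [hz])
    cases y with
    | coupling =>
      rw [contract, covariance_of_isPsi hx rfl, zero_mul, zero_add, fields_coupling, rightSign]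
      rcases Nat.eq_zero_or_pos (fields l).length with h0 | h0
      · have h1 : ∀ y ∈ l, covariance x y = 0 := by
          intro y hy
          rw [List.length_eq_zero_iff, fields, List.filter_eq_nil_iff] at h0
          have := h0 y hy
          cases y with
          | coupling => exact covariance_of_isPsi hx rfl
          | psi => simp [Letter.isField] at this
          | psibar => simp [Letter.isField] at this
        rw [contract_eq_zero _ _ _ h1, List.length_eq_zero_iff.1 h0]
        simp [contract]
      · have h1 : contract x (fun l' => rightSign (Letter.coupling :: l') *
            g (fields (Letter.coupling :: l'))) l =
            contract x (fun l' => rightSign l' *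
              ((-1) ^ (D * ((fields l).length - 1)) * g (fields l'))) l := by
          refine contract_congr _ _ _ _ fun l' h2 _ => ?_
          rw [rightSign, fields_coupling, ← h2, Nat.add_sub_cancel]
          ring
        rw [h1, ih (fun l' => (-1) ^ (D * ((fields l).length - 1)) * g l') hl']
        rw [contract_const_mul]
        obtain ⟨n, hn⟩ : ∃ n, (fields l).length = n + 1 := ⟨(fields l).length - 1, by omega⟩
        rw [hn, Nat.add_sub_cancel, mul_add, mul_one, pow_add]
        simp only [Letter.parity]
        ring
    | psi => simp [Letter.isPsi] at hl
    | psibar c a t =>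
      rw [contract, fields_cons rfl, contract, rightSign_psibar]
      have := ih (fun l' => g (Letter.psibar c a t :: l')) hl'
      simp only [rightSign_psibar, fields_cons (show (Letter.psibar c a t : Letter D N).isField from rfl)]
      rw [this]
      ring

lemma fermionIntegral_eq_zero (l : List (Letter D N)) (hl : ∀ y ∈ l, y.isPsi = false)
    (h : fields l ≠ []) : fermionIntegral l = 0 := by
  induction l with
  | nil => simp at h
  | cons y l ih =>
    cases y with
    | coupling =>
      rw [fermionIntegral_coupling]
      exact ih (fun z hz => hl z (by simp [hz])) h
    | psi => simp [Letter.isPsi] at hl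
    | psibar c a t =>
      rw [fermionIntegral_cons _ rfl]
      exact contract_eq_zero _ _ _ fun z hz => covariance_of_isPsibar rfl (hl z (by simp [hz]))

lemma sum_map_parity (l : List (Letter D N)) :
    (l.map Letter.parity).sum = D * (l.length - (fields l).length) + (fields l).length := by
  induction l with
  | nil => simp
  | cons y l ih =>
    have hle : (fields l).length ≤ l.length := List.length_filter_le _ _
    rw [List.map_cons, List.sum_cons, ih]
    cases y with
    | coupling =>
      rw [fields_coupling, List.length_cons, Nat.sub_add_comm hle, mul_add, Letter.parity]
      ring
    | psi =>
      rw [fields_cons rfl, List.length_cons, List.length_cons, Nat.add_sub_add_right,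
        Letter.parity]
      ring
    | psibar =>
      rw [fields_cons rfl, List.length_cons, List.length_cons, Nat.add_sub_add_right,
        Letter.parity]
      ring

lemma fields_fields (l : List (Letter D N)) : fields (fields l) = fields l := by
  simp [fields]

/-- Each leading ψ can only be contracted within `l'`, so it first passes all of `l`. The couplings
in `l` contribute the factor of `leftSign`, the fields contribute the same sign as without
couplings, and `contract_rightSign` treats `l'`. -/
theorem fermionIntegral_append (l l' : List (Letter D N)) (hl : ∀ y ∈ l, y.isPsibar = false)
    (hl' : ∀ y ∈ l', y.isPsi = false) :
    fermionIntegral (l ++ l') =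
      leftSign l * rightSign l' * fermionIntegral (fields l ++ fields l') := by
  induction l generalizing l' with
  | nil =>
    simp only [List.nil_append, leftSign, fields_nil, one_mul]
    by_cases h : fields l' = []
    · have h1 : ∀ y ∈ l', y = Letter.coupling := by
        intro y hy
        rw [fields, List.filter_eq_nil_iff] at h
        have := h y hy
        cases y <;> simp_all [Letter.isField]
      rw [h]
      clear h hl hl'
      induction l' with
      | nil => simp [rightSign]
      | cons y l' ih =>
        obtain rfl := h1 y (by simp)
        have h3 := ih fun z hz => h1 z (by simp [hz])
        have h4 : fields l' = [] := by
          rw [fields, List.filter_eq_nil_iff]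
          intro z hz
          rw [h1 z (by simp [hz])]
          simp [Letter.isField]
        rw [fermionIntegral_coupling, rightSign, h3, h4]
        simp
    · rw [fermionIntegral_eq_zero l' hl' h, fermionIntegral_eq_zero (fields l'), mul_zero]
      · exact fun y hy => hl' y (List.mem_of_mem_filter hy)
      · rwa [fields_fields]
  | cons x l ih =>
    have hl1 : ∀ y ∈ l, y.isPsibar = false := fun z hz => hl z (by simp [hz])
    cases x with
    | coupling =>
      rw [List.cons_append, fermionIntegral_coupling, fields_coupling, leftSign]
      exact ih l' hl1 hl'
    | psibar => simp [Letter.isPsibar] at hl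
    | psi c a t =>
      rw [List.cons_append, fermionIntegral_cons _ rfl, fields_cons rfl, List.cons_append,
        fermionIntegral_cons _ rfl, contract_append, contract_append,
        contract_congr _ _ (fun l'' => rightSign l'' *
          (leftSign l * fermionIntegral (fields l ++ fields l''))),
        contract_rightSign _ rfl (fun l'' => leftSign l * fermionIntegral (fields l ++ l'')) _ hl']
      · rw [contract_const_mul, leftSign_psi, sum_map_parity, sum_map_parity, fields_fields, Nat.sub_self, mul_zero,
          zero_add, pow_add]
        ring
      · intro l'' _ h
        rw [ih l'' hl1 fun y hy => hl' y (h y hy)]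
        ring
      · exact fun y hy => covariance_of_isPsi rfl (hl1 y (List.mem_of_mem_filter hy))
      · exact fun y hy => covariance_of_isPsi rfl (hl1 y hy)


/-! ### Determinant formula for the pure field integral -/

lemma contract_ofFn {q : ℕ} (x : Letter D N) (f : List (Letter D N) → ℂ)
    (y : Fin (q + 1) → Letter D N) (hy : ∀ j, (y j).isField) :
    contract x f (List.ofFn y) =
      ∑ j : Fin (q + 1), (-1) ^ (j : ℕ) * covariance x (y j) *
        f (List.ofFn fun i => y (j.succAbove i)) := by
  induction q generalizing f with
  | zero => simp [contract]
  | succ q ih =>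
    have hp : (y 0).parity = 1 := by
      have := hy 0
      generalize y 0 = z at this
      cases z <;> simp_all [Letter.isField, Letter.parity]
    rw [List.ofFn_succ, contract, ih _ _ fun j => hy j.succ, Fin.sum_univ_succ (n := q + 1), hp,
      Finset.mul_sum]
    congr 1
    · simp
    · refine Finset.sum_congr rfl fun j _ => ?_
      rw [List.ofFn_succ (f := fun i => y (j.succ.succAbove i))]
      simp [pow_succ]

lemma fields_ofFn {q : ℕ} (y : Fin q → Letter D N) (hy : ∀ j, (y j).isField) :
    fields (List.ofFn y) = List.ofFn y := by
  rw [fields, List.filter_eq_self]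
  intro a ha
  obtain ⟨i, rfl⟩ := (List.mem_ofFn' _ _).1 ha
  exact hy i

lemma isField_of_isPsi {x : Letter D N} (hx : x.isPsi) : x.isField := by
  cases x <;> simp_all [Letter.isPsi, Letter.isField]

lemma isField_of_isPsibar {x : Letter D N} (hx : x.isPsibar) : x.isField := by
  cases x <;> simp_all [Letter.isPsibar, Letter.isField]

lemma isPsibar_of_isPsi {x : Letter D N} (hx : x.isPsi) : x.isPsibar = false := by
  cases x <;> simp_all [Letter.isPsi, Letter.isPsibar]

lemma isPsi_of_isPsibar {x : Letter D N} (hx : x.isPsibar) : x.isPsi = false := by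
  cases x <;> simp_all [Letter.isPsi, Letter.isPsibar]

lemma fermionIntegral_ofFn_succ {p : ℕ} (x : Fin (p + 1) → Letter D N) (hx : ∀ i, (x i).isPsi)
    (l : List (Letter D N)) :
    fermionIntegral (List.ofFn x ++ l) = (-1) ^ p * contract (x 0)
      (fun l' => fermionIntegral (List.ofFn (fun i : Fin p => x i.succ) ++ l')) l := by
  rw [List.ofFn_succ, List.cons_append, fermionIntegral_cons _ (isField_of_isPsi (hx 0)),
    contract_append, sum_map_parity, fields_ofFn _ fun i => isField_of_isPsi (hx i.succ)]
  · simp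
  · intro y hy
    obtain ⟨i, rfl⟩ := (List.mem_ofFn' _ _).1 hy
    exact covariance_of_isPsi (hx 0) (isPsibar_of_isPsi (hx _))

/-- Every contraction uses up one ψ and one ψ̄, and a surplus of either kind integrates to zero. -/
theorem fermionIntegral_ofFn_of_ne {p q : ℕ} (hpq : p ≠ q) (x : Fin p → Letter D N)
    (hx : ∀ i, (x i).isPsi) (y : Fin q → Letter D N) (hy : ∀ j, (y j).isPsibar) :
    fermionIntegral (List.ofFn x ++ List.ofFn y) = 0 := by
  induction p generalizing q with
  | zero =>
    rw [List.ofFn_zero, List.nil_append]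
    apply fermionIntegral_eq_zero
    · intro z hz
      obtain ⟨i, rfl⟩ := (List.mem_ofFn' _ _).1 hz
      exact isPsi_of_isPsibar (hy i)
    · rw [fields_ofFn _ fun j => isField_of_isPsibar (hy j)]
      intro h
      have := congrArg List.length h
      simp at this
      omega
  | succ p ih =>
    rw [fermionIntegral_ofFn_succ x hx]
    cases q with
    | zero => simp [contract]
    | succ q =>
      rw [contract_ofFn _ _ _ fun j => isField_of_isPsibar (hy j), Finset.sum_eq_zero, mul_zero]
      intro j _
      rw [ih (by omega) _ (fun i => hx i.succ) _ fun i => hy _, mul_zero]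

/-- Laplace expansion along the first row: the first ψ passes p other ψ's and the ψ̄'s before its
partner, with total sign (-1)^p (-1)^(rev j) = (-1)^j. Columns are reversed because the nested
pairing ψ_1 … ψ_p ψ̄_p … ψ̄_1 is the one with sign +. -/
theorem fermionIntegral_ofFn {p : ℕ} (x : Fin p → Letter D N)
    (hx : ∀ i, (x i).isPsi) (y : Fin p → Letter D N) (hy : ∀ j, (y j).isPsibar) :
    fermionIntegral (List.ofFn x ++ List.ofFn y) =
      (Matrix.of fun i j => covariance (x i) (y j.rev)).det := by
  induction p with
  | zero => simp
  | succ p ih =>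
    rw [fermionIntegral_ofFn_succ x hx, contract_ofFn _ _ _ fun j => isField_of_isPsibar (hy j),
      Matrix.det_succ_row_zero, Finset.mul_sum, ← Equiv.sum_comp Fin.revPerm]
    refine Finset.sum_congr rfl fun j _ => ?_
    rw [ih _ (fun i => hx i.succ) _ fun i => hy _, Fin.revPerm_apply, Matrix.of_apply]
    have h1 : (-1 : ℂ) ^ p * ((-1) ^ (j.rev : ℕ)) = (-1) ^ (j : ℕ) := by
      have hj : p = (j.rev : ℕ) + j := by
        rw [Fin.val_rev]
        omega
      have h3 : (-1 : ℂ) ^ p = (-1) ^ (j.rev : ℕ) * (-1) ^ (j : ℕ) := by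
        rw [← pow_add, ← hj]
      rw [h3, mul_right_comm, ← mul_pow]
      simp
    rw [← h1]
    have h2 : (Matrix.of fun i j_1 : Fin p => covariance (x i.succ) (y (j.rev.succAbove j_1.rev))) =
        (Matrix.of fun i j => covariance (x i) (y j.rev)).submatrix Fin.succ j.succAbove := by
      ext i l
      simp [Fin.rev_succAbove]
    rw [h2]
    ring

/-! ### The Wick theorem for the monomials of the interaction -/

lemma fields_reverse (l : List (Letter D N)) : fields l.reverse = (fields l).reverse :=
  List.filter_reverse

lemma rightSign_append {l l' : List (Letter D N)} (hl : ∀ y ∈ l, y.isPsibar) :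
    rightSign (l ++ l') = rightSign l' := by
  induction l with
  | nil => rfl
  | cons y l ih =>
    cases y with
    | psibar =>
      rw [List.cons_append, rightSign_psibar]
      exact ih fun z hz => hl z (by simp [hz])
    | coupling => simp [Letter.isPsibar] at hl
    | psi => simp [Letter.isPsibar] at hl

lemma leftSign_append {l l' : List (Letter D N)} (hl : ∀ y ∈ l, y.isPsi) :
    leftSign (l ++ l') =
      (-1) ^ (l.length * (D * (l'.length - (fields l').length))) * leftSign l' := by
  induction l with
  | nil => simp
  | cons y l ih =>
    have hl' : ∀ y ∈ l, y.isPsi := fun z hz => hl z (by simp [hz])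
    cases y with
    | psi =>
      have h1 : fields l = l := List.filter_eq_self.2 fun z hz => isField_of_isPsi (hl' z hz)
      rw [List.cons_append, leftSign_psi, ih hl', fields_append, h1, List.length_append,
        List.length_append, Nat.add_sub_add_left, List.length_cons, add_mul, one_mul, pow_add]
      ring
    | coupling => simp [Letter.isPsi] at hl
    | psibar => simp [Letter.isPsi] at hl

variable {m n : ℕ}

/-- The part of a monomial with the fields `ψ`. -/
def psiPart (a : Fin m → Fin D → Fin N) (τ : Fin m → ℝ) : List (Letter D N) :=
  (List.ofFn fun i : Fin m =>
    Letter.coupling :: List.ofFn fun c : Fin D => Letter.psi c (a i c) (τ i)).flatten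

/-- The part of a monomial with the fields `ψ̄`. -/
def psibarPart (b : Fin n → Fin D → Fin N) (τ' : Fin n → ℝ) : List (Letter D N) :=
  (List.ofFn fun j : Fin n =>
    (List.ofFn fun c : Fin D => Letter.psibar c (b j c) (τ' j)).reverse ++
      [Letter.coupling]).flatten

lemma psiPart_succ (a : Fin (m + 1) → Fin D → Fin N) (τ : Fin (m + 1) → ℝ) :
    psiPart a τ = Letter.coupling :: ((List.ofFn fun c : Fin D => Letter.psi c (a 0 c) (τ 0)) ++
      psiPart (fun i => a i.succ) (fun i => τ i.succ)) := by
  simp [psiPart, List.ofFn_succ]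

lemma psibarPart_succ (b : Fin (n + 1) → Fin D → Fin N) (τ' : Fin (n + 1) → ℝ) :
    psibarPart b τ' = (List.ofFn fun c : Fin D => Letter.psibar c (b 0 c) (τ' 0)).reverse ++
      Letter.coupling :: psibarPart (fun i => b i.succ) (fun i => τ' i.succ) := by
  simp [psibarPart, List.ofFn_succ]

lemma divNat_mk (i : Fin m) (c : Fin n) (h : (i : ℕ) * n + c < m * n) :
    Fin.divNat (⟨i * n + c, h⟩ : Fin (m * n)) = i := by
  ext
  have hn : 0 < n := c.pos
  simp [Fin.coe_divNat, Nat.add_div_of_dvd_right, Nat.mul_div_cancel _ hn]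

lemma modNat_mk (i : Fin m) (c : Fin n) (h : (i : ℕ) * n + c < m * n) :
    Fin.modNat (⟨i * n + c, h⟩ : Fin (m * n)) = c := by
  ext
  simp [Fin.coe_modNat, Nat.mod_eq_of_lt c.isLt]

lemma fields_psiPart (a : Fin m → Fin D → Fin N) (τ : Fin m → ℝ) :
    fields (psiPart a τ) = List.ofFn fun p : Fin (m * D) =>
      Letter.psi p.modNat (a p.divNat p.modNat) (τ p.divNat) := by
  rw [List.ofFn_mul, psiPart, fields, List.filter_flatten, List.map_ofFn]
  congr 2
  ext1 i
  refine (fields_ofFn _ fun _ => rfl).trans ?_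
  congr 1
  ext1 c
  rw [divNat_mk, modNat_mk]

lemma reverse_ofFn {X : Type*} {q : ℕ} (f : Fin q → X) :
    (List.ofFn f).reverse = List.ofFn fun i => f i.rev := by
  apply List.ext_getElem
  · simp
  · intro i h1 h2
    simp only [List.getElem_reverse, List.getElem_ofFn]
    congr 1
    ext
    simp [Fin.val_rev]
    omega

/-- Within a block the colours run backwards while the blocks run forwards. Reading the whole list
from its end puts the colours in order and reverses the blocks, which explains the two reversals. -/
lemma fields_psibarPart (b : Fin n → Fin D → Fin N) (τ' : Fin n → ℝ) :
    fields (psibarPart b τ') = List.ofFn fun p : Fin (n * D) =>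
      Letter.psibar p.rev.modNat (b p.rev.divNat.rev p.rev.modNat) (τ' p.rev.divNat.rev) := by
  rw [← reverse_ofFn (fun p : Fin (n * D) =>
    Letter.psibar p.modNat (b p.divNat.rev p.modNat) (τ' p.divNat.rev)), List.ofFn_mul]
  simp only [divNat_mk, modNat_mk]
  rw [← reverse_ofFn (fun j => List.ofFn fun c : Fin D => Letter.psibar c (b j c) (τ' j)),
    ← List.reverse_reverse (fields _), List.flatten_reverse, List.reverse_reverse,
    List.reverse_reverse, psibarPart, fields, List.filter_flatten, List.map_ofFn, List.map_ofFn]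
  congr 2
  ext1 j
  refine (fields_append _ _).trans ?_
  rw [fields_reverse, fields_ofFn _ fun _ => rfl]
  simp

/-- The sign from moving the couplings out of one half of a monomial. -/
def blockSign (D : ℕ) : ℕ → ℂ
  | 0 => 1
  | n + 1 => (-1) ^ (D * (D * n)) * blockSign D n

lemma blockSign_mul_self (D n : ℕ) : blockSign D n * blockSign D n = 1 := by
  induction n with
  | zero => simp [blockSign]
  | succ n ih => rw [blockSign, mul_mul_mul_comm, ih, ← mul_pow]; simp

lemma length_psiPart (a : Fin m → Fin D → Fin N) (τ : Fin m → ℝ) :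
    (psiPart a τ).length = m + m * D := by
  simp [psiPart, List.length_flatten, List.sum_ofFn, mul_add, add_comm]

/-- In m + 1 blocks, the D fields of the first one stand to the left of m further couplings of
parity D, which gives the exponent D (D m). -/
lemma leftSign_psiPart (a : Fin m → Fin D → Fin N) (τ : Fin m → ℝ) :
    leftSign (psiPart a τ) = blockSign D m := by
  induction m with
  | zero => simp [psiPart, leftSign, blockSign]
  | succ m ih =>
    rw [psiPart_succ, leftSign, leftSign_append, ih, length_psiPart, fields_psiPart,
      List.length_ofFn, List.length_ofFn, Nat.add_sub_cancel, blockSign]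
    intro y hy
    obtain ⟨c, rfl⟩ := (List.mem_ofFn' _ _).1 hy
    rfl

lemma rightSign_psibarPart (b : Fin n → Fin D → Fin N) (τ' : Fin n → ℝ) :
    rightSign (psibarPart b τ') = blockSign D n := by
  induction n with
  | zero => simp [psibarPart, rightSign, blockSign]
  | succ n ih =>
    rw [psibarPart_succ, rightSign_append, rightSign, ih, fields_psibarPart, List.length_ofFn,
      blockSign, mul_comm n D]
    intro y hy
    rw [List.mem_reverse] at hy
    obtain ⟨c, rfl⟩ := (List.mem_ofFn' _ _).1 hy
    rfl

/-- Both halves produce the same function of their length, so the sign disappears when m = n, the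
only case with a nonzero integral if D > 0. -/
lemma fermionIntegral_monomial (a : Fin m → Fin D → Fin N) (b : Fin n → Fin D → Fin N)
    (τ : Fin m → ℝ) (τ' : Fin n → ℝ) :
    fermionIntegral (monomial a b τ τ') = blockSign D m * blockSign D n *
      fermionIntegral (fields (psiPart a τ) ++ fields (psibarPart b τ')) := by
  rw [← leftSign_psiPart a τ, ← rightSign_psibarPart b τ', ← fermionIntegral_append]
  · rfl
  · intro y hy
    simp only [psiPart, List.mem_flatten, (List.mem_ofFn' _ _)] at hy
    obtain ⟨_, ⟨i, rfl⟩, hy⟩ := hy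
    rcases List.mem_cons.1 hy with rfl | hy
    · rfl
    · obtain ⟨c, rfl⟩ := (List.mem_ofFn' _ _).1 hy
      rfl
  · intro y hy
    simp only [psibarPart, List.mem_flatten, (List.mem_ofFn' _ _)] at hy
    obtain ⟨_, ⟨i, rfl⟩, hy⟩ := hy
    rcases List.mem_append.1 hy with hy | hy
    · rw [List.mem_reverse] at hy
      obtain ⟨c, rfl⟩ := (List.mem_ofFn' _ _).1 hy
      rfl
    · rw [List.mem_singleton.1 hy]
      rfl

theorem fermionIntegral_monomial_of_ne (hD : 0 < D) (hmn : m ≠ n) (a : Fin m → Fin D → Fin N)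
    (b : Fin n → Fin D → Fin N) (τ : Fin m → ℝ) (τ' : Fin n → ℝ) :
    fermionIntegral (monomial a b τ τ') = 0 := by
  rw [fermionIntegral_monomial, fields_psiPart, fields_psibarPart, fermionIntegral_ofFn_of_ne,
    mul_zero]
  · intro h
    exact hmn (Nat.eq_of_mul_eq_mul_right hD h)
  · exact fun _ => rfl
  · exact fun _ => rfl

/-- The covariance is diagonal in the colour, so the matrix is block diagonal with one block per
colour. The order of the ψ̄ blocks reverses the columns of each, whence one signature of the
reversal per colour. -/
theorem fermionIntegral_monomial_eq_det (a : Fin m → Fin D → Fin N) (b : Fin m → Fin D → Fin N)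
    (τ : Fin m → ℝ) (τ' : Fin m → ℝ) :
    fermionIntegral (monomial a b τ τ') = ((Equiv.Perm.sign (Fin.revPerm (n := m)) : ℤ) : ℂ) ^ D *
      ∏ c, (Matrix.of fun i j : Fin m =>
        if a i c = b j c then (propagator (τ i) (τ' j) : ℂ) else 0).det := by
  rw [fermionIntegral_monomial, blockSign_mul_self, one_mul, fields_psiPart, fields_psibarPart,
    fermionIntegral_ofFn _ (fun _ => rfl) _ (fun _ => rfl)]
  have h1 : ∀ c : Fin D, ((Equiv.Perm.sign (Fin.revPerm (n := m)) : ℤ) : ℂ) *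
      (Matrix.of fun i j : Fin m =>
        if a i c = b j c then (propagator (τ i) (τ' j) : ℂ) else 0).det =
      (Matrix.of fun i j : Fin m =>
        if a i c = b j.rev c then (propagator (τ i) (τ' j.rev) : ℂ) else 0).det :=
    fun c => (Matrix.det_permute' Fin.revPerm _).symm
  have h2 : ((Equiv.Perm.sign (Fin.revPerm (n := m)) : ℤ) : ℂ) ^ D =
      ∏ _c : Fin D, ((Equiv.Perm.sign (Fin.revPerm (n := m)) : ℤ) : ℂ) := by simp
  rw [h2, ← Finset.prod_mul_distrib]
  simp only [h1]
  rw [← Matrix.det_blockDiagonal, ← Matrix.det_submatrix_equiv_self finProdFinEquiv.symm]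
  congr 1
  ext p q
  simp only [Matrix.of_apply, Matrix.submatrix_apply, finProdFinEquiv_symm_apply,
    Matrix.blockDiagonal_apply, covariance, Fin.rev_rev]
  by_cases h : p.modNat = q.modNat
  · simp [h]
  · simp [h]

theorem fermionIntegral_monomial_eq_sum (a : Fin m → Fin D → Fin N) (b : Fin m → Fin D → Fin N)
    (τ : Fin m → ℝ) (τ' : Fin m → ℝ) :
    fermionIntegral (monomial a b τ τ') = ((Equiv.Perm.sign (Fin.revPerm (n := m)) : ℤ) : ℂ) ^ D *
      ∑ s : Fin D → Equiv.Perm (Fin m), if ∀ c i, a i c = b (s c i) c then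
        (((∏ c, ((Equiv.Perm.sign (s c) : ℤ) : ℝ)) *
          ∏ c, ∏ i, propagator (τ i) (τ' (s c i)) : ℝ) : ℂ) else 0 := by
  rw [fermionIntegral_monomial_eq_det]
  congr 1
  -- Transposing makes the permutations act on the black vertices, in accordance with edges from i
  -- to s c i.
  simp_rw [← Matrix.det_transpose (Matrix.of _), Matrix.det_apply']
  rw [Finset.prod_univ_sum, Fintype.piFinset_univ]
  refine Finset.sum_congr rfl fun s _ => ?_
  rw [Finset.prod_mul_distrib]
  split_ifs with h
  · push_cast
    congr 1
    refine Finset.prod_congr rfl fun c _ => Finset.prod_congr rfl fun i _ => ?_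
    simp [h c i]
  · push Not at h
    obtain ⟨c, i, hci⟩ := h
    refine mul_eq_zero_of_right _ (Finset.prod_eq_zero (Finset.mem_univ c)
      (Finset.prod_eq_zero (Finset.mem_univ i) ?_))
    simp [hci]

end

end ColoredSYK
namespace ColoredSYK

/-! ### Integrals over the time variables -/

/-- Lebesgue measure on the product of copies of `[-β/2, β/2]`. -/
def cubeMeasure (β : ℝ) (ι : Type) [Fintype ι] : Measure (ι → ℝ) :=
  Measure.pi fun _ => volume.restrict (Set.Icc (-β / 2) (β / 2))

instance (β : ℝ) (ι : Type) [Fintype ι] : IsFiniteMeasure (cubeMeasure β ι) := by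
  unfold cubeMeasure
  infer_instance

lemma restrict_timeCube (β : ℝ) (k : ℕ) :
    (volume : Measure (Fin k → ℝ)).restrict (timeCube β k) = cubeMeasure β (Fin k) := by
  rw [volume_pi, timeCube, Measure.restrict_pi_pi]
  rfl

section

variable {ι κ : Type} [Fintype ι] [Fintype κ] {E : Type*} [NormedAddCommGroup E]
  [NormedSpace ℝ E]

lemma integral_cubeMeasure_comp (β : ℝ) (e : ι ≃ κ) (H : (ι → ℝ) → E) :
    ∫ τ, H (fun i => τ (e i)) ∂cubeMeasure β κ = ∫ τ, H τ ∂cubeMeasure β ι := by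
  have h := (measurePreserving_piCongrLeft (α := fun _ : κ => ℝ)
    (fun _ : κ => (volume : Measure ℝ).restrict (Set.Icc (-β / 2) (β / 2))) e).integral_comp'
    (fun τ => H (fun i => τ (e i)))
  refine h.symm.trans ?_
  congr 1
  ext τ
  congr 1
  ext i
  exact Equiv.piCongrLeft_apply_apply (P := fun _ : κ => ℝ) e τ i

lemma integral_cubeMeasure_sum (β : ℝ) (F : (ι → ℝ) → ℝ) (G : (κ → ℝ) → ℝ) :
    ∫ τ, F (fun i => τ (Sum.inl i)) * G (fun i => τ (Sum.inr i)) ∂cubeMeasure β (ι ⊕ κ) =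
      (∫ τ, F τ ∂cubeMeasure β ι) * ∫ τ, G τ ∂cubeMeasure β κ := by
  have h := (measurePreserving_sumPiEquivProdPi (X := fun _ : ι ⊕ κ => ℝ)
    (fun _ : ι ⊕ κ => (volume : Measure ℝ).restrict (Set.Icc (-β / 2) (β / 2)))).integral_comp'
    (fun p => F p.1 * G p.2)
  exact h.trans (integral_prod_mul F G)

end

/-- The product of the propagators of a coloured graph. -/
def propagatorProd {D : ℕ} {ι : Type} [Fintype ι] (s : Fin D → Equiv.Perm ι) (τ τ' : ι → ℝ) : ℝ :=
  ∏ c, ∏ i, propagator (τ i) (τ' (s c i))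

/-- The partial amplitude of a graph with vertices labelled by an arbitrary finite type. -/
def amplitudeOn (β : ℝ) {D : ℕ} (ι : Type) [Fintype ι] [DecidableEq ι]
    (s : Fin D → Equiv.Perm ι) : ℝ :=
  (∏ c, ((Equiv.Perm.sign (s c) : ℤ) : ℝ)) *
    ∫ τ, ∫ τ', propagatorProd s τ τ' ∂cubeMeasure β ι ∂cubeMeasure β ι

lemma amplitudeOn_fin (β : ℝ) {D k : ℕ} (s : Fin D → Equiv.Perm (Fin k)) :
    amplitudeOn β (Fin k) s = amplitude β s := by
  rw [amplitudeOn, amplitude, restrict_timeCube]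
  rfl

lemma measurable_propagator : Measurable fun p : ℝ × ℝ => propagator p.1 p.2 := by
  have h : (fun p : ℝ × ℝ => propagator p.1 p.2) = fun p =>
      (if 0 < p.1 - p.2 then 1 else if p.1 - p.2 < 0 then -1 else 0) / 2 := by
    ext p
    rw [propagator, sign_apply]
    split_ifs <;> simp
  rw [h]
  refine Measurable.div_const (Measurable.ite ?_ measurable_const
    (Measurable.ite ?_ measurable_const measurable_const)) _
  · exact measurableSet_lt measurable_const (measurable_fst.sub measurable_snd)
  · exact measurableSet_lt (measurable_fst.sub measurable_snd) measurable_const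

lemma abs_propagator_le (τ τ' : ℝ) : |propagator τ τ'| ≤ 1 := by
  rw [propagator, sign_apply]
  split_ifs <;> norm_num [abs_le]

lemma abs_propagatorProd_le {D : ℕ} {ι : Type} [Fintype ι] (s : Fin D → Equiv.Perm ι)
    (τ τ' : ι → ℝ) : |propagatorProd s τ τ'| ≤ 1 := by
  rw [propagatorProd, Finset.abs_prod]
  refine Finset.prod_le_one (fun _ _ => abs_nonneg _) fun c _ => ?_
  rw [Finset.abs_prod]
  exact Finset.prod_le_one (fun _ _ => abs_nonneg _) fun i _ => abs_propagator_le _ _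

lemma measurable_propagatorProd {D : ℕ} {ι : Type} [Fintype ι] (s : Fin D → Equiv.Perm ι) :
    Measurable fun p : (ι → ℝ) × (ι → ℝ) => propagatorProd s p.1 p.2 := by
  refine Finset.measurable_prod _ fun c _ => Finset.measurable_prod _ fun i _ => ?_
  have h : Measurable fun p : (ι → ℝ) × (ι → ℝ) => (p.1 i, p.2 (s c i)) := by fun_prop
  exact measurable_propagator.comp h

lemma integrable_propagatorProd (β : ℝ) {D : ℕ} {ι : Type} [Fintype ι]
    (s : Fin D → Equiv.Perm ι) (τ : ι → ℝ) :
    Integrable (fun τ' => propagatorProd s τ τ') (cubeMeasure β ι) := by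
  refine Integrable.of_bound (C := 1) ?_ ?_
  · exact ((measurable_propagatorProd s).comp measurable_prodMk_left).aestronglyMeasurable
  · exact Filter.Eventually.of_forall fun τ' => abs_propagatorProd_le s τ τ'

lemma integrable_integral_propagatorProd (β : ℝ) {D : ℕ} {ι : Type} [Fintype ι]
    (s : Fin D → Equiv.Perm ι) :
    Integrable (fun τ => ∫ τ', propagatorProd s τ τ' ∂cubeMeasure β ι) (cubeMeasure β ι) := by
  have h : Integrable (fun p : (ι → ℝ) × (ι → ℝ) => propagatorProd s p.1 p.2)
      ((cubeMeasure β ι).prod (cubeMeasure β ι)) :=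
    Integrable.of_bound (C := 1) (measurable_propagatorProd s).aestronglyMeasurable
      (Filter.Eventually.of_forall fun p => abs_propagatorProd_le s p.1 p.2)
  exact h.integral_prod_left

section

variable {ι κ : Type} [Fintype ι] [DecidableEq ι] [Fintype κ] [DecidableEq κ] {D : ℕ}

lemma sign_reindex (e f : ι ≃ κ) (σ : Equiv.Perm ι) :
    Equiv.Perm.sign ((e.symm.trans σ).trans f) =
      Equiv.Perm.sign σ * Equiv.Perm.sign (e.symm.trans f) := by
  have h : (e.symm.trans σ).trans f = ((e.symm.trans σ).trans e).trans (e.symm.trans f) := by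
    ext
    simp
  rw [h, Equiv.Perm.sign_trans, Equiv.Perm.sign_symm_trans_trans, mul_comm]

/-- The time integral is invariant under renaming its variables. Each of the D signatures picks up
the sign of the mismatch between `e` and `f`, hence the power D. -/
lemma amplitudeOn_reindex (β : ℝ) (e f : ι ≃ κ) (s : Fin D → Equiv.Perm ι) :
    amplitudeOn β κ (fun c => (e.symm.trans (s c)).trans f) =
      ((Equiv.Perm.sign (e.symm.trans f) : ℤ) : ℝ) ^ D * amplitudeOn β ι s := by
  have h1 : ∀ τ τ' : κ → ℝ, propagatorProd (fun c => (e.symm.trans (s c)).trans f) τ τ' =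
      propagatorProd s (fun i => τ (e i)) (fun i => τ' (f i)) := by
    intro τ τ'
    refine Finset.prod_congr rfl fun c _ => ?_
    rw [← e.prod_comp]
    simp
  unfold amplitudeOn
  simp only [h1, sign_reindex]
  rw [integral_cubeMeasure_comp β e (fun τ => ∫ τ', propagatorProd s τ (fun i => τ' (f i))
    ∂cubeMeasure β κ)]
  have h2 : ∀ τ, ∫ τ', propagatorProd s τ (fun i => τ' (f i)) ∂cubeMeasure β κ =
      ∫ τ', propagatorProd s τ τ' ∂cubeMeasure β ι := fun τ =>
    integral_cubeMeasure_comp β f _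
  simp only [h2]
  simp only [Units.val_mul, Int.cast_mul, Finset.prod_mul_distrib, Finset.prod_const,
    Finset.card_univ, Fintype.card_fin]
  ring

lemma amplitudeOn_sum (β : ℝ) (s : Fin D → Equiv.Perm ι) (t : Fin D → Equiv.Perm κ) :
    amplitudeOn β (ι ⊕ κ) (fun c => Equiv.sumCongr (s c) (t c)) =
      amplitudeOn β ι s * amplitudeOn β κ t := by
  have h1 : ∀ τ τ' : ι ⊕ κ → ℝ, propagatorProd (fun c => Equiv.sumCongr (s c) (t c)) τ τ' =
      propagatorProd s (fun i => τ (Sum.inl i)) (fun i => τ' (Sum.inl i)) *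
        propagatorProd t (fun i => τ (Sum.inr i)) (fun i => τ' (Sum.inr i)) := by
    intro τ τ'
    simp [propagatorProd, Finset.prod_mul_distrib]
  have h2 : ∀ c, Equiv.Perm.sign (Equiv.sumCongr (s c) (t c)) =
      Equiv.Perm.sign (s c) * Equiv.Perm.sign (t c) := fun c => Equiv.Perm.sign_sumCongr _ _
  unfold amplitudeOn
  simp only [h1, h2]
  have h3 : ∀ τ : ι ⊕ κ → ℝ, ∫ τ', propagatorProd s (fun i => τ (Sum.inl i))
        (fun i => τ' (Sum.inl i)) *
        propagatorProd t (fun i => τ (Sum.inr i)) (fun i => τ' (Sum.inr i)) ∂cubeMeasure β (ι ⊕ κ) =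
      (fun τ => ∫ τ', propagatorProd s τ τ' ∂cubeMeasure β ι) (fun i => τ (Sum.inl i)) *
      (fun τ => ∫ τ', propagatorProd t τ τ' ∂cubeMeasure β κ) (fun i => τ (Sum.inr i)) :=
    fun τ => integral_cubeMeasure_sum β (fun τ' => propagatorProd s (fun i => τ (Sum.inl i)) τ')
      (fun τ' => propagatorProd t (fun i => τ (Sum.inr i)) τ')
  simp only [h3]
  rw [integral_cubeMeasure_sum β (fun τ => ∫ τ', propagatorProd s τ τ' ∂cubeMeasure β ι)
    (fun τ => ∫ τ', propagatorProd t τ τ' ∂cubeMeasure β κ)]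
  simp only [Units.val_mul, Int.cast_mul, Finset.prod_mul_distrib]
  ring

lemma amplitudeOn_empty (β : ℝ) (s : Fin D → Equiv.Perm (Fin 0)) :
    amplitudeOn β (Fin 0) s = 1 := by
  have h : (cubeMeasure β (Fin 0)).real Set.univ = 1 := by
    rw [Measure.real, cubeMeasure, Measure.pi_empty_univ, ENNReal.toReal_one]
  have h2 : ∀ c, s c = 1 := fun c => Subsingleton.elim _ _
  simp [amplitudeOn, propagatorProd, h, h2]

end

/-! ### Sums over the colour indices -/

section

variable {ι κ : Type} [Fintype ι] [DecidableEq ι] [Fintype κ] [DecidableEq κ] {D N : ℕ}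
  {S : Type} [CommRing S]

/-- The sum over the indices of the tensors of a coloured graph, where the edges of colour `c`
identify the `c`-th indices. -/
def indexSum (s : Fin D → Equiv.Perm ι)
    (φ : (ι → Fin D → Fin N) → (ι → Fin D → Fin N) → S) : S :=
  ∑ a, ∑ b, if ∀ c i, a i c = b (s c i) c then φ a b else 0

lemma indexSum_reindex (e f : ι ≃ κ) (s : Fin D → Equiv.Perm ι)
    (φ : (κ → Fin D → Fin N) → (κ → Fin D → Fin N) → S) :
    indexSum (fun c => (e.symm.trans (s c)).trans f) φ =
      indexSum s fun a b => φ (fun i => a (e.symm i)) (fun i => b (f.symm i)) := by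
  rw [indexSum, ← Equiv.sum_comp (e.arrowCongr (Equiv.refl (Fin D → Fin N)))]
  refine Finset.sum_congr rfl fun a _ => ?_
  rw [← Equiv.sum_comp (f.arrowCongr (Equiv.refl (Fin D → Fin N)))]
  refine Finset.sum_congr rfl fun b _ => ?_
  refine if_congr (forall_congr' fun c => ?_) rfl rfl
  rw [← e.forall_congr_right]
  simp

lemma indexSum_sum (s : Fin D → Equiv.Perm ι) (t : Fin D → Equiv.Perm κ)
    (φ : (ι ⊕ κ → Fin D → Fin N) → (ι ⊕ κ → Fin D → Fin N) → S)
    (φ₁ : (ι → Fin D → Fin N) → (ι → Fin D → Fin N) → S)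
    (φ₂ : (κ → Fin D → Fin N) → (κ → Fin D → Fin N) → S)
    (h : ∀ a b, φ a b = φ₁ (fun i => a (Sum.inl i)) (fun i => b (Sum.inl i)) *
      φ₂ (fun i => a (Sum.inr i)) (fun i => b (Sum.inr i))) :
    indexSum (fun c => Equiv.sumCongr (s c) (t c)) φ = indexSum s φ₁ * indexSum t φ₂ := by
  unfold indexSum
  let ε := (Equiv.sumArrowEquivProdArrow ι κ (Fin D → Fin N)).symm
  rw [Finset.sum_mul_sum, ← Equiv.sum_comp ε, Fintype.sum_prod_type]
  refine Finset.sum_congr rfl fun a _ => Finset.sum_congr rfl fun a' _ => ?_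
  rw [Finset.sum_mul_sum, ← Equiv.sum_comp ε, Fintype.sum_prod_type]
  refine Finset.sum_congr rfl fun b _ => Finset.sum_congr rfl fun b' _ => ?_
  rw [h, ite_zero_mul_ite_zero]
  refine if_congr ?_ rfl rfl
  rw [← forall_and]
  refine forall_congr' fun c => ?_
  rw [Sum.forall]
  rfl

lemma prod_apply_swap (r : S) (x : (Fin D → Fin N) → (Fin D → Fin N) → S)
    (hx : ∀ a b a' b', x a b * x a' b' = r * (x a b' * x a' b)) (a b : ι → Fin D → Fin N)
    {p q : ι} (hpq : p ≠ q) :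
    ∏ i, x (a i) (b (Equiv.swap p q i)) = r * ∏ i, x (a i) (b i) := by
  rw [← Finset.mul_prod_erase _ _ (Finset.mem_univ p),
    ← Finset.mul_prod_erase _ _ (Finset.mem_erase.2 ⟨hpq.symm, Finset.mem_univ q⟩),
    ← Finset.mul_prod_erase _ _ (Finset.mem_univ p),
    ← Finset.mul_prod_erase _ _ (Finset.mem_erase.2 ⟨hpq.symm, Finset.mem_univ q⟩)]
  rw [Equiv.swap_apply_left, Equiv.swap_apply_right, ← mul_assoc, hx, mul_assoc, ← mul_assoc _ _ (∏ i ∈ _, x (a i) (b i))]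
  congr 2
  refine Finset.prod_congr rfl fun i hi => ?_
  rw [Finset.mem_erase, Finset.mem_erase] at hi
  rw [Equiv.swap_apply_of_ne_of_ne hi.2.1 hi.1]

/-- The hypothesis is the exchange rule for a transposition of the b's; a permutation is a product
of transpositions. -/
lemma prod_apply_perm (x : (Fin D → Fin N) → (Fin D → Fin N) → S)
    (hx : ∀ a b a' b', x a b * x a' b' = (-1) ^ D * (x a b' * x a' b))
    (a b : ι → Fin D → Fin N) (π : Equiv.Perm ι) :
    ∏ i, x (a i) (b (π i)) = ((Equiv.Perm.sign π : ℤ) : S) ^ D * ∏ i, x (a i) (b i) := by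
  induction π using Equiv.Perm.swap_induction_on generalizing b with
  | one => simp
  | swap_mul f p q hpq ih =>
    have := ih (fun i => b (Equiv.swap p q i))
    simp only [Equiv.Perm.mul_apply]
    rw [this, prod_apply_swap _ x hx a b hpq, Equiv.Perm.sign_mul, Equiv.Perm.sign_swap hpq]
    push_cast
    rw [mul_pow]
    ring

lemma sign_pow_mul_self {R : Type*} [CommRing R] (π : Equiv.Perm ι) (n : ℕ) :
    ((Equiv.Perm.sign π : ℤ) : R) ^ n * ((Equiv.Perm.sign π : ℤ) : R) ^ n = 1 := by
  rw [← mul_pow, ← Int.cast_mul, ← Units.val_mul, Int.units_mul_self]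
  simp

lemma sign_trans_symm (e f : ι ≃ κ) :
    Equiv.Perm.sign (e.trans f.symm) = Equiv.Perm.sign (e.symm.trans f) := by
  rw [← Equiv.Perm.sign_symm_trans_trans (e.trans f.symm) e, ← Equiv.Perm.sign_symm]
  congr 1
  ext
  simp

lemma prod_reindex (x : (Fin D → Fin N) → (Fin D → Fin N) → S)
    (hx : ∀ a b a' b', x a b * x a' b' = (-1) ^ D * (x a b' * x a' b))
    (a b : ι → Fin D → Fin N) (e f : ι ≃ κ) :
    ∏ i, x (a (e.symm i)) (b (f.symm i)) =
      ((Equiv.Perm.sign (e.symm.trans f) : ℤ) : S) ^ D * ∏ i, x (a i) (b i) := by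
  rw [← sign_trans_symm, ← prod_apply_perm x hx, ← e.prod_comp]
  simp

variable [Algebra ℂ S]

lemma intCast_pow_mul_eq_smul (n : ℤ) (m : ℕ) (p : S) : (n : S) ^ m * p = ((n : ℂ) ^ m) • p := by
  rw [Algebra.smul_def, map_pow, map_intCast]

/-- The weight of a `D`-coloured graph at fixed coupling tensors; `x a b` stands for the product of
the components `T_a` and `T̄_b`. -/
def quenchedWeight (β : ℝ) (x : (Fin D → Fin N) → (Fin D → Fin N) → S) (ι : Type) [Fintype ι]
    [DecidableEq ι] (s : Fin D → Equiv.Perm ι) : S :=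
  (amplitudeOn β ι s : ℂ) • indexSum s fun a b => ∏ i, x (a i) (b i)

/-- Relabelling multiplies both the amplitude and the coupling product by the D-th power of the same
signature, and the two cancel. This balance is why odd D calls for fermionic couplings. -/
theorem isMultiplicative_quenchedWeight (β : ℝ) (x : (Fin D → Fin N) → (Fin D → Fin N) → S)
    (hx : ∀ a b a' b', x a b * x a' b' = (-1) ^ D * (x a b' * x a' b)) :
    IsMultiplicative (quenchedWeight β x) where
  reindex {ι κ} _ _ _ _ e f s := by
    rw [quenchedWeight, quenchedWeight, amplitudeOn_reindex, indexSum_reindex]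
    simp only [prod_reindex x hx]
    have h : ∀ (r : S) (φ : (ι → Fin D → Fin N) → (ι → Fin D → Fin N) → S),
        (indexSum s fun a b => r * φ a b) = r * indexSum s φ := by
      intro r φ
      simp only [indexSum, Finset.mul_sum, mul_ite, mul_zero]
    rw [h _ fun a b => ∏ i, x (a i) (b i)]
    rw [intCast_pow_mul_eq_smul (S := S), smul_smul]
    congr 1
    push_cast
    rw [mul_right_comm, sign_pow_mul_self, one_mul]
  disjointUnion s t := by
    rw [quenchedWeight, quenchedWeight, quenchedWeight, amplitudeOn_sum, smul_mul_smul_comm,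
      indexSum_sum s t _ (fun a b => ∏ i, x (a i) (b i)) (fun a b => ∏ i, x (a i) (b i))]
    · push_cast
      rfl
    · intro a b
      rw [Fintype.prod_sum_type]
  empty s := by
    simp [quenchedWeight, amplitudeOn_empty, indexSum]

/-- The weight of a `(D+1)`-coloured graph after the average over the couplings, where `g` is the
covariance of the couplings. -/
def annealedWeight (β : ℝ) (D N : ℕ) (g : ℂ) (ι : Type) [Fintype ι] [DecidableEq ι]
    (s : Fin (D + 1) → Equiv.Perm ι) : ℂ :=
  (amplitudeOn β ι (fun c : Fin D => s c.succ) : ℂ) * ((Equiv.Perm.sign (s 0) : ℤ) : ℂ) ^ D *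
    g ^ Fintype.card ι * indexSum (fun c : Fin D => s c.succ)
      fun (a b : ι → Fin D → Fin N) => ∏ i, if a i = b (s 0 i) then 1 else 0

/-- The signature of `s 0` now plays the part of the coupling product: under relabelling its D-th
power compensates that of the amplitude. -/
theorem isMultiplicative_annealedWeight (β : ℝ) (D N : ℕ) (g : ℂ) :
    IsMultiplicative (annealedWeight β D N g) where
  reindex {ι κ} _ _ _ _ e f s := by
    rw [annealedWeight, annealedWeight, amplitudeOn_reindex β e f fun c => s c.succ,
      indexSum_reindex e f fun c => s c.succ, sign_reindex, ← Fintype.card_congr e]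
    have h : ∀ a b : ι → Fin D → Fin N, (∏ i : κ, if a (e.symm i) =
        b (f.symm (((e.symm.trans (s 0)).trans f) i)) then (1 : ℂ) else 0) =
        ∏ i, if a i = b (s 0 i) then 1 else 0 := by
      intro a b
      rw [← e.prod_comp]
      simp
    simp only [h]
    have h2 := sign_pow_mul_self (R := ℂ) (e.symm.trans f) D
    push_cast
    rw [mul_pow]
    generalize indexSum (S := ℂ) (N := N) (fun c : Fin D => s c.succ) _ = I
    linear_combination (amplitudeOn β ι (fun c : Fin D => s c.succ) : ℂ) *
      ((Equiv.Perm.sign (s 0) : ℤ) : ℂ) ^ D * g ^ Fintype.card ι * I * h2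
  disjointUnion {ι κ} _ _ _ _ s t := by
    have h : Equiv.Perm.sign (Equiv.sumCongr (s 0) (t 0)) =
      Equiv.Perm.sign (s 0) * Equiv.Perm.sign (t 0) := Equiv.Perm.sign_sumCongr _ _
    rw [annealedWeight, annealedWeight, annealedWeight, h,
      amplitudeOn_sum β (fun c => s c.succ) (fun c => t c.succ),
      indexSum_sum (fun c => s c.succ) (fun c => t c.succ) _
        (fun (a b : ι → Fin D → Fin N) => ∏ i, if a i = b (s 0 i) then 1 else 0)
        (fun (a b : κ → Fin D → Fin N) => ∏ i, if a i = b (t 0 i) then 1 else 0),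
      Fintype.card_sum, pow_add]
    · push_cast
      rw [mul_pow]
      ring
    · intro a b
      rw [Fintype.prod_sum_type]
      rfl
  empty s := by
    have h2 : ∀ c, s c = 1 := fun c => Subsingleton.elim _ _
    simp [annealedWeight, amplitudeOn_empty, indexSum, h2]

end

end ColoredSYK
namespace ColoredSYK

/-! ### The partition function at fixed couplings -/

section

variable {D N k : ℕ}

lemma integral_fermionIntegral (β : ℝ) (a b : Fin k → Fin D → Fin N) :
    ∫ τ in timeCube β k, ∫ τ' in timeCube β k, fermionIntegral (monomial a b τ τ') =
      ((Equiv.Perm.sign (Fin.revPerm (n := k)) : ℤ) : ℂ) ^ D *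
      ∑ s : Fin D → Equiv.Perm (Fin k), if ∀ c i, a i c = b (s c i) c then
        (amplitudeOn β (Fin k) s : ℂ) else 0 := by
  simp only [restrict_timeCube]
  let κ : (Fin D → Equiv.Perm (Fin k)) → ℂ := fun s => if ∀ c i, a i c = b (s c i) c then
    ((∏ c, ((Equiv.Perm.sign (s c) : ℤ) : ℝ) : ℝ) : ℂ) else 0
  have h1 : ∀ τ τ', fermionIntegral (monomial a b τ τ') =
      ((Equiv.Perm.sign (Fin.revPerm (n := k)) : ℤ) : ℂ) ^ D *
        ∑ s : Fin D → Equiv.Perm (Fin k), κ s * (propagatorProd s τ τ' : ℂ) := by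
    intro τ τ'
    rw [fermionIntegral_monomial_eq_sum]
    congr 1
    refine Finset.sum_congr rfl fun s _ => ?_
    simp only [κ, ite_mul, zero_mul, ← Complex.ofReal_mul]
    rfl
  have h2 : ∀ τ, ∫ τ', fermionIntegral (monomial a b τ τ') ∂cubeMeasure β (Fin k) =
      ((Equiv.Perm.sign (Fin.revPerm (n := k)) : ℤ) : ℂ) ^ D *
        ∑ s : Fin D → Equiv.Perm (Fin k), κ s *
          ((∫ τ', propagatorProd s τ τ' ∂cubeMeasure β (Fin k) : ℝ) : ℂ) := by
    intro τ
    simp only [h1]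
    rw [integral_const_mul, integral_finsetSum]
    · simp only [integral_const_mul, integral_complex_ofReal]
    · exact fun s _ => (integrable_propagatorProd β s τ).ofReal.const_mul _
  simp only [h2]
  rw [integral_const_mul, integral_finsetSum]
  · simp only [integral_const_mul, integral_complex_ofReal]
    congr 1
    refine Finset.sum_congr rfl fun s _ => ?_
    simp only [κ, ite_mul, zero_mul, amplitudeOn, Complex.ofReal_mul]
  · exact fun s _ => (integrable_integral_propagatorProd β s).ofReal.const_mul _

end

/-! ### Coupling products as central elements -/

section

variable {D N : ℕ} {R : Type} [Ring R] [Algebra ℂ R]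

/-- The product of the components of the coupling tensors in a monomial, with the sign that
arises from pairing them. -/
def couplingProd {k : ℕ} (T Tbar : (Fin D → Fin N) → R) (a b : Fin k → Fin D → Fin N) : R :=
  (((Equiv.Perm.sign (Fin.revPerm (n := k)) : ℤ) : ℂ) ^ D) •
    ((List.ofFn fun i => T (a i)).prod * (List.ofFn fun j => Tbar (b j)).prod)

/-- The contribution of a `D`-coloured graph to the partition function. -/
def couplingSum {k : ℕ} (β : ℝ) (T Tbar : (Fin D → Fin N) → R) (s : Fin D → Equiv.Perm (Fin k)) :
    R :=
  ∑ a, ∑ b, if ∀ c i, a i c = b (s c i) c then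
    (amplitudeOn β (Fin k) s : ℂ) • couplingProd T Tbar a b else 0

lemma coeff_partitionFunction (hD : 0 < D) (β : ℝ) (T Tbar : (Fin D → Fin N) → R)
    (d : Fin 2 →₀ ℕ) :
    MvPowerSeries.coeff d (partitionFunction D N β T Tbar) = if d 0 = d 1 then
      (((d 0).factorial : ℂ) * ((d 0).factorial : ℂ))⁻¹ •
        ∑ s : Fin D → Equiv.Perm (Fin (d 0)), couplingSum β T Tbar s else 0 := by
  change (((d 0).factorial : ℂ) * ((d 1).factorial : ℂ))⁻¹ •
    ∑ a : Fin (d 0) → Fin D → Fin N, ∑ b : Fin (d 1) → Fin D → Fin N,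
      (∫ τ in timeCube β (d 0), ∫ τ' in timeCube β (d 1), fermionIntegral (monomial a b τ τ')) •
        ((List.ofFn fun i => T (a i)).prod * (List.ofFn fun j => Tbar (b j)).prod) = _
  generalize d 0 = m
  generalize d 1 = n
  split_ifs with h
  · subst h
    congr 1
    unfold couplingSum
    symm
    rw [Finset.sum_comm]
    refine Finset.sum_congr rfl fun a _ => ?_
    rw [Finset.sum_comm]
    refine Finset.sum_congr rfl fun b _ => ?_
    symm
    rw [integral_fermionIntegral, mul_comm, mul_smul, Finset.sum_smul]
    refine Finset.sum_congr rfl fun s _ => ?_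
    rw [ite_smul, zero_smul]
    rfl
  · have h1 : ∀ (a : Fin m → Fin D → Fin N) (b : Fin n → Fin D → Fin N) τ τ',
        fermionIntegral (monomial a b τ τ') = 0 := fermionIntegral_monomial_of_ne hD h
    simp [h1]

/-- The couplings are bosonic for `D` even and fermionic for `D` odd. -/
structure IsCoupling (T Tbar : (Fin D → Fin N) → R) : Prop where
  anticomm : ∀ a b, T a * Tbar b = (-1) ^ D * (Tbar b * T a)
  central : ∀ a b, T a * Tbar b ∈ Subalgebra.center ℂ R

variable {T Tbar : (Fin D → Fin N) → R}

/-- The product of a component of each of the two coupling tensors, as a central element. -/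
def centralProd (h : IsCoupling T Tbar) (a b : Fin D → Fin N) : Subalgebra.center ℂ R :=
  ⟨T a * Tbar b, h.central a b⟩

/-- Move the central pair T_a' T̄_b' to the left of T̄_b, then exchange T_a' and T̄_b'. The only
commutation relation used is the one between T and T̄. -/
lemma centralProd_mul (h : IsCoupling T Tbar) (a b a' b' : Fin D → Fin N) :
    centralProd h a b * centralProd h a' b' =
      (-1) ^ D * (centralProd h a b' * centralProd h a' b) := by
  apply Subtype.ext
  change T a * Tbar b * (T a' * Tbar b') = (-1) ^ D * (T a * Tbar b' * (T a' * Tbar b))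
  have h1 := Subalgebra.mem_center_iff.1 (h.central a' b') (Tbar b)
  have h2 : T a' * Tbar b' * Tbar b = (-1) ^ D * (Tbar b' * T a') * Tbar b := by
    rw [h.anticomm a' b']
  have h3 : Commute (T a) ((-1) ^ D : R) := (Commute.neg_one_right _).pow_right D
  rw [mul_assoc, h1, h2, mul_assoc, ← mul_assoc (T a), h3.eq]
  simp only [mul_assoc]

/-- The nested product T_1 ⋯ T_k T̄_k ⋯ T̄_1 collapses from the inside, since the inner product is
central. -/
lemma ofFn_prod_mul_ofFn_prod_rev (h : IsCoupling T Tbar) {k : ℕ}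
    (a b : Fin k → Fin D → Fin N) :
    (List.ofFn fun i => T (a i)).prod * (List.ofFn fun j => Tbar (b j.rev)).prod =
      ((∏ i, centralProd h (a i) (b i) : Subalgebra.center ℂ R) : R) := by
  induction k with
  | zero => simp
  | succ k ih =>
    rw [List.ofFn_succ, List.prod_cons, List.ofFn_succ', List.concat_eq_append, List.prod_append,
      List.prod_singleton, Fin.prod_univ_succ, Fin.rev_last, mul_assoc, ← mul_assoc _ _ (Tbar (b 0))]
    simp only [Fin.rev_castSucc]
    rw [ih (fun i => a i.succ) (fun i => b i.succ)]
    have h1 := Subalgebra.mem_center_iff.1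
      (∏ i : Fin k, centralProd h (a i.succ) (b i.succ)).2 (Tbar (b 0))
    rw [← h1, ← mul_assoc]
    rfl

/-- Undoing the reversal of the T̄'s costs ε(rev)^D, which cancels the same sign left by the fields.
-/
lemma couplingProd_eq (h : IsCoupling T Tbar) {k : ℕ} (a b : Fin k → Fin D → Fin N) :
    couplingProd T Tbar a b = ((∏ i, centralProd h (a i) (b i) : Subalgebra.center ℂ R) : R) := by
  have h1 := ofFn_prod_mul_ofFn_prod_rev h a fun i => b i.rev
  simp only [Fin.rev_rev] at h1
  have h2 := prod_apply_perm (centralProd h) (centralProd_mul h) a b Fin.revPerm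
  simp only [Fin.revPerm_apply] at h2
  rw [couplingProd, h1, h2]
  rw [intCast_pow_mul_eq_smul]
  change _ • (_ • ((∏ i, centralProd h (a i) (b i) : Subalgebra.center ℂ R) : R)) = _
  rw [smul_smul, sign_pow_mul_self, one_smul]

lemma couplingSum_eq (h : IsCoupling T Tbar) (β : ℝ) {k : ℕ} (s : Fin D → Equiv.Perm (Fin k)) :
    couplingSum β T Tbar s =
      ((quenchedWeight β (centralProd h) (Fin k) s : Subalgebra.center ℂ R) : R) := by
  have h0 : ∀ x : Subalgebra.center ℂ R, (x : R) = (Subalgebra.center ℂ R).val x := fun _ => rfl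
  rw [quenchedWeight, indexSum, h0, map_smul, map_sum, Finset.smul_sum, couplingSum]
  refine Finset.sum_congr rfl fun a _ => ?_
  rw [map_sum, Finset.smul_sum]
  refine Finset.sum_congr rfl fun b _ => ?_
  split_ifs with hab
  · rw [couplingProd_eq h]
    rfl
  · simp

/-- Allows the logarithm to be computed with coefficients in the commutative centre, where the
exponential formula holds, although the Grassmann algebra itself is not commutative. -/
lemma formalLog_map {S : Type} [Ring S] [Algebra ℂ S] (φ : S →ₐ[ℂ] R)
    (f : MvPowerSeries (Fin 2) S) :
    formalLog (MvPowerSeries.map φ.toRingHom f) = MvPowerSeries.map φ.toRingHom (formalLog f) := by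
  ext d
  rw [MvPowerSeries.coeff_map]
  change ∑ j ∈ Finset.Icc 1 (d 0 + d 1), _ = φ (∑ j ∈ Finset.Icc 1 (d 0 + d 1), _)
  rw [map_sum]
  refine Finset.sum_congr rfl fun j _ => ?_
  rw [map_smul]
  congr 1
  have : (MvPowerSeries.map φ.toRingHom f - 1) ^ j =
      MvPowerSeries.map φ.toRingHom ((f - 1) ^ j) := by simp
  rw [this]
  exact MvPowerSeries.coeff_map _ _ _

open scoped Classical in
theorem coeff_formalLog_partitionFunction (hD : 0 < D) (h : IsCoupling T Tbar) (β : ℝ)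
    (d : Fin 2 →₀ ℕ) :
    MvPowerSeries.coeff d (formalLog (partitionFunction D N β T Tbar)) = if d 0 = d 1 then
      (((d 0).factorial : ℂ) * ((d 0).factorial : ℂ))⁻¹ •
        ∑ s : Fin D → Equiv.Perm (Fin (d 0)),
          if (coloredGraph s).Connected then couplingSum β T Tbar s else 0 else 0 := by
  have : Nonempty (Fin D) := ⟨⟨0, hD⟩⟩
  let φ := (Subalgebra.center ℂ R).val
  have h1 : partitionFunction D N β T Tbar =
      MvPowerSeries.map φ.toRingHom (diagonalSeries (totalWeight (quenchedWeight β (centralProd h)))) := by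
    ext d
    rw [coeff_partitionFunction hD, MvPowerSeries.coeff_map, coeff_diagonalSeries]
    split_ifs
    · change _ = φ _
      rw [map_smul, totalWeight, map_sum]
      congr 1
      exact Finset.sum_congr rfl fun s _ => couplingSum_eq h β s
    · simp
  have h2 : formalLog (diagonalSeries (totalWeight (quenchedWeight β (centralProd h)))) =
      diagonalSeries (connectedWeight (quenchedWeight β (centralProd h))) :=
    formalLog_diagonalSeries (isMultiplicative_quenchedWeight β _ (centralProd_mul h))
  rw [h1, formalLog_map, MvPowerSeries.coeff_map, h2, coeff_diagonalSeries]
  split_ifs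
  · change φ _ = _
    rw [map_smul, connectedWeight, map_sum]
    congr 1
    refine Finset.sum_congr rfl fun s _ => ?_
    split_ifs
    · exact (couplingSum_eq h β s).symm
    · exact map_zero _
  · simp

end

end ColoredSYK
namespace ColoredSYK

/-! ### Moments of complex Gaussian variables -/

/-- The centred complex Gaussian distribution with density `(g / π) exp (- g |z|²)`. -/
def complexGaussian (g : ℝ) : Measure ℂ :=
  (volume : Measure ℂ).withDensity fun z =>
    ENNReal.ofReal (g / Real.pi * Real.exp (-(g * ‖z‖ ^ 2)))

lemma integral_norm_pow_mul_exp {g : ℝ} (hg : 0 < g) (n : ℕ) :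
    ∫ z : ℂ, ‖z‖ ^ n * Real.exp (-(g * ‖z‖ ^ 2)) =
      Real.pi * g ^ (-((n : ℝ) + 2) / 2) * Real.Gamma (((n : ℝ) + 2) / 2) := by
  have h := Complex.integral_rpow_mul_exp_neg_mul_rpow (p := 2) (q := n) (b := g) (by norm_num)
    (by have : (0 : ℝ) ≤ n := Nat.cast_nonneg n
        linarith) hg
  have h2 : ∀ x : ℂ, -g * ‖x‖ ^ (2 : ℝ) = -(g * ‖x‖ ^ 2) := fun x => by
    rw [Real.rpow_ofNat, neg_mul]
  simp only [Real.rpow_natCast, h2] at h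
  rw [h]
  ring

/-- An integral of a non-integrable function is 0 by convention, so the positive value just computed
already proves integrability. -/
lemma integrable_norm_pow_mul_exp {g : ℝ} (hg : 0 < g) (n : ℕ) :
    Integrable fun z : ℂ => ‖z‖ ^ n * Real.exp (-(g * ‖z‖ ^ 2)) := by
  refine not_imp_comm.1 integral_undef ?_
  rw [integral_norm_pow_mul_exp hg]
  have h1 : 0 < g ^ (-((n : ℝ) + 2) / 2) := Real.rpow_pos_of_pos hg _
  have h2 : 0 < Real.Gamma (((n : ℝ) + 2) / 2) := Real.Gamma_pos_of_pos (by positivity)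
  have h3 := Real.pi_pos
  positivity

lemma gaussDensity_nonneg {g : ℝ} (hg : 0 < g) (z : ℂ) :
    0 ≤ g / Real.pi * Real.exp (-(g * ‖z‖ ^ 2)) := by
  have := Real.pi_pos
  positivity

lemma measurable_gaussDensity (g : ℝ) : Measurable fun z : ℂ =>
    ENNReal.ofReal (g / Real.pi * Real.exp (-(g * ‖z‖ ^ 2))) := by
  fun_prop

lemma isFiniteMeasure_complexGaussian {g : ℝ} (hg : 0 < g) :
    IsFiniteMeasure (complexGaussian g) := by
  apply isFiniteMeasure_withDensity_ofReal
  have h := (integrable_norm_pow_mul_exp hg 0).const_mul (g / Real.pi)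
  simpa using h.hasFiniteIntegral

lemma integrable_complexGaussian {g : ℝ} (hg : 0 < g) (p q : ℕ) :
    Integrable (fun z : ℂ => z ^ p * (starRingEnd ℂ z) ^ q) (complexGaussian g) := by
  rw [complexGaussian, integrable_withDensity_iff_integrable_smul' (measurable_gaussDensity g)
    (Filter.Eventually.of_forall fun _ => ENNReal.ofReal_lt_top)]
  simp only [ENNReal.toReal_ofReal (gaussDensity_nonneg hg _)]
  refine ((integrable_norm_pow_mul_exp hg (p + q)).const_mul (g / Real.pi)).mono' ?_ ?_
  · exact (by fun_prop : Continuous fun z : ℂ => (g / Real.pi * Real.exp (-(g * ‖z‖ ^ 2))) •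
      (z ^ p * (starRingEnd ℂ z) ^ q)).aestronglyMeasurable
  · refine Filter.Eventually.of_forall fun z => le_of_eq ?_
    rw [norm_smul, Real.norm_of_nonneg (gaussDensity_nonneg hg z), norm_mul, norm_pow, norm_pow,
      RCLike.norm_conj, pow_add]
    ring

lemma integral_complexGaussian {g : ℝ} (hg : 0 < g) (p q : ℕ) :
    ∫ z, z ^ p * (starRingEnd ℂ z) ^ q ∂complexGaussian g =
      if p = q then (p.factorial : ℂ) * ((g : ℂ)⁻¹) ^ p else 0 := by
  rw [complexGaussian, integral_withDensity_eq_integral_toReal_smul (measurable_gaussDensity g)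
    (Filter.Eventually.of_forall fun _ => ENNReal.ofReal_lt_top)]
  simp only [ENNReal.toReal_ofReal (gaussDensity_nonneg hg _)]
  split_ifs with h
  · subst h
    have h1 : ∀ z : ℂ, (g / Real.pi * Real.exp (-(g * ‖z‖ ^ 2))) •
        (z ^ p * (starRingEnd ℂ z) ^ p) =
        (((g / Real.pi) * (‖z‖ ^ (2 * p) * Real.exp (-(g * ‖z‖ ^ 2))) : ℝ) : ℂ) := by
      intro z
      rw [← mul_pow, Complex.mul_conj, Complex.normSq_eq_norm_sq, Complex.real_smul,
        pow_mul]
      push_cast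
      ring
    simp only [h1]
    rw [integral_complex_ofReal, integral_const_mul, integral_norm_pow_mul_exp hg]
    have h2 : -(((2 * p : ℕ) : ℝ) + 2) / 2 = -((p + 1 : ℕ) : ℝ) := by
      push_cast
      ring
    have h3 : (((2 * p : ℕ) : ℝ) + 2) / 2 = (p : ℝ) + 1 := by
      push_cast
      ring
    rw [h2, h3, Real.Gamma_nat_eq_factorial, Real.rpow_neg hg.le, Real.rpow_natCast]
    have h4 := Real.pi_ne_zero
    have h5 : g / Real.pi * (Real.pi * (g ^ (p + 1))⁻¹ * (p.factorial : ℝ)) =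
        p.factorial * g⁻¹ ^ p := by
      rw [inv_pow]
      field_simp
      ring
    rw [h5]
    push_cast
    rfl
  · set I := ∫ z : ℂ, (g / Real.pi * Real.exp (-(g * ‖z‖ ^ 2))) • (z ^ p * (starRingEnd ℂ z) ^ q)
      with hI
    -- Rotation by θ multiplies z^p z̄^q by exp(iθ(p - q)); this angle makes the factor -1, so the
    -- integral equals its own negative.
    let u : Circle := Circle.exp (Real.pi / ((p : ℝ) - q))
    have hu : (u : ℂ) ^ p * (starRingEnd ℂ (u : ℂ)) ^ q = -1 := by
      have hpq : ((p : ℂ) - q) ≠ 0 := by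
        rw [sub_ne_zero]
        exact_mod_cast h
      rw [← Circle.coe_inv_eq_conj, ← Circle.exp_neg, Circle.coe_exp, Circle.coe_exp,
        ← Complex.exp_nat_mul, ← Complex.exp_nat_mul, ← Complex.exp_add, ← Complex.exp_pi_mul_I]
      congr 1
      push_cast
      field_simp
      ring
    have h1 := ((rotation u).measurePreserving).integral_comp
      (rotation u).toHomeomorph.measurableEmbedding (fun z : ℂ =>
        (g / Real.pi * Real.exp (-(g * ‖z‖ ^ 2))) • (z ^ p * (starRingEnd ℂ z) ^ q))
    have h2 : ∀ z : ℂ, (g / Real.pi * Real.exp (-(g * ‖rotation u z‖ ^ 2))) •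
        ((rotation u z) ^ p * (starRingEnd ℂ (rotation u z)) ^ q) =
        -((g / Real.pi * Real.exp (-(g * ‖z‖ ^ 2))) • (z ^ p * (starRingEnd ℂ z) ^ q)) := by
      intro z
      rw [LinearIsometryEquiv.norm_map, rotation_apply, map_mul, mul_pow, mul_pow,
        mul_mul_mul_comm, hu, neg_one_mul, smul_neg]
    simp only [h2, integral_neg] at h1
    rw [← hI] at h1
    exact self_eq_neg.1 h1.symm

/-! ### The Wick theorem for the bosonic couplings -/

/-- Such permutations match the fibres of `a` with those of `b`. If one exists, the others differ
from it by a permutation that stabilises `a`, that is, by a permutation of each fibre. -/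
lemma card_perm_comp_eq {X : Type} [Fintype X] [DecidableEq X] {k : ℕ} (a b : Fin k → X) :
    (Finset.univ.filter fun σ : Equiv.Perm (Fin k) => ∀ i, a i = b (σ i)).card =
      ∏ x, if Fintype.card {i // a i = x} = Fintype.card {i // b i = x} then
        (Fintype.card {i // a i = x}).factorial else 0 := by
  by_cases h : ∀ x, Fintype.card {i // a i = x} = Fintype.card {i // b i = x}
  · let ε : ∀ x, {i // a i = x} ≃ {i // b i = x} := fun x => Fintype.equivOfCardEq (h x)
    let σ₀ : Equiv.Perm (Fin k) := ((Equiv.sigmaFiberEquiv a).symm.trans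
      (Equiv.sigmaCongrRight ε)).trans (Equiv.sigmaFiberEquiv b)
    have hσ₀ : ∀ i, b (σ₀ i) = a i := fun i => (ε (a i) ⟨i, rfl⟩).2
    simp only [h, if_true]
    simp only [← h]
    rw [← DomMulAct.stabilizer_card, ← Fintype.card_subtype]
    refine Fintype.card_congr
      ((Equiv.mulLeft σ₀⁻¹).subtypeEquiv fun σ => ?_)
    rw [funext_iff]
    refine forall_congr' fun i => ?_
    have e : b (σ i) = a (σ₀⁻¹ (σ i)) := by rw [← hσ₀ (σ₀⁻¹ (σ i)), perm_apply_inv]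
    rw [Function.comp_apply, Equiv.coe_mulLeft, Equiv.Perm.mul_apply, e, eq_comm]
  · push Not at h
    obtain ⟨x, hx⟩ := h
    rw [Finset.prod_eq_zero (Finset.mem_univ x) (if_neg hx), Finset.card_eq_zero,
      Finset.filter_eq_empty_iff]
    intro σ _ hσ
    exact hx (Fintype.card_congr (σ.subtypeEquiv fun i => by rw [hσ i]))

lemma prod_mul_prod_conj {X : Type} [Fintype X] [DecidableEq X] {k : ℕ} (a b : Fin k → X)
    (T : X → ℂ) : (∏ i, T (a i)) * ∏ i, starRingEnd ℂ (T (b i)) =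
      ∏ x, (T x ^ Fintype.card {i // a i = x} *
        (starRingEnd ℂ (T x)) ^ Fintype.card {i // b i = x}) := by
  rw [Finset.prod_mul_distrib, ← Fintype.prod_fiberwise' a T,
    ← Fintype.prod_fiberwise' b fun x => starRingEnd ℂ (T x)]
  simp

section

variable {X : Type} [Fintype X] [DecidableEq X] {k : ℕ} {g : ℝ}

lemma integrable_prod_complexGaussian (hg : 0 < g) (a b : Fin k → X) :
    Integrable (fun T : X → ℂ => (∏ i, T (a i)) * ∏ i, starRingEnd ℂ (T (b i)))
      (Measure.pi fun _ => complexGaussian g) := by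
  have := isFiniteMeasure_complexGaussian hg
  simp only [prod_mul_prod_conj]
  exact Integrable.fintype_prod (f := fun x (z : ℂ) => z ^ Fintype.card {i // a i = x} *
    (starRingEnd ℂ z) ^ Fintype.card {i // b i = x}) fun x => integrable_complexGaussian hg _ _

/-- Group the factors by component and use independence. The factorials of the one-variable moments,
with their vanishing for unequal exponents, are exactly the number of Wick pairings. -/
theorem integral_prod_complexGaussian (hg : 0 < g) (a b : Fin k → X) :
    ∫ T : X → ℂ, (∏ i, T (a i)) * ∏ i, starRingEnd ℂ (T (b i))
      ∂(Measure.pi fun _ => complexGaussian g) =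
      ((g : ℂ)⁻¹) ^ k * ∑ σ : Equiv.Perm (Fin k), if ∀ i, a i = b (σ i) then 1 else 0 := by
  have := isFiniteMeasure_complexGaussian hg
  simp only [prod_mul_prod_conj]
  rw [integral_fintype_prod_eq_prod (fun x (z : ℂ) => z ^ Fintype.card {i // a i = x} *
    (starRingEnd ℂ z) ^ Fintype.card {i // b i = x})]
  simp only [integral_complexGaussian hg]
  rw [Finset.sum_boole, card_perm_comp_eq]
  have h : ((g : ℂ)⁻¹) ^ k = ∏ x, ((g : ℂ)⁻¹) ^ Fintype.card {i // a i = x} := by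
    have := Fintype.prod_fiberwise' a fun _ => (g : ℂ)⁻¹
    simpa using this.symm
  rw [h]
  push_cast
  rw [← Finset.prod_mul_distrib]
  refine Finset.prod_congr rfl fun x _ => ?_
  split_ifs
  · rw [mul_comm]
  · simp

end

end ColoredSYK
namespace ColoredSYK

/-! ### The Berezin integral -/

section

variable {D N : ℕ}

/-- A generator of the Grassmann algebra. -/
def grassGen (x : (Fin D → Fin N) ⊕ (Fin D → Fin N)) : TensorGrassmann D N :=
  ExteriorAlgebra.ι ℂ (Pi.single x 1)

lemma grassGen_mul_self (x : (Fin D → Fin N) ⊕ (Fin D → Fin N)) :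
    grassGen x * grassGen x = 0 := ExteriorAlgebra.ι_sq_zero _

lemma grassGen_mul_comm (x y : (Fin D → Fin N) ⊕ (Fin D → Fin N)) :
    grassGen x * grassGen y = -(grassGen y * grassGen x) :=
  eq_neg_of_add_eq_zero_left (ExteriorAlgebra.ι_add_mul_swap _ _)

lemma grassGen_mul_grassGen_mem_center (x y : (Fin D → Fin N) ⊕ (Fin D → Fin N)) :
    grassGen x * grassGen y ∈ Subalgebra.center ℂ (TensorGrassmann D N) := by
  rw [Subalgebra.mem_center_iff]
  intro f
  induction f using ExteriorAlgebra.induction with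
  | algebraMap r => exact Algebra.commutes r _
  | ι v =>
    have h1 := fun z => eq_neg_of_add_eq_zero_left
      (ExteriorAlgebra.ι_add_mul_swap (R := ℂ) v (Pi.single z 1))
    change ExteriorAlgebra.ι ℂ v * (ExteriorAlgebra.ι ℂ _ * ExteriorAlgebra.ι ℂ _) =
      ExteriorAlgebra.ι ℂ _ * ExteriorAlgebra.ι ℂ _ * ExteriorAlgebra.ι ℂ v
    rw [← mul_assoc, h1, neg_mul, mul_assoc, h1, mul_neg, neg_neg, mul_assoc]
  | mul f f' h h' => rw [mul_assoc, h', ← mul_assoc, h, mul_assoc]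
  | add f f' h h' => rw [add_mul, h, h', mul_add]

lemma isCoupling_grass (hD : Odd D) : IsCoupling (grassT (D := D) (N := N)) grassTbar where
  anticomm a b := by
    rw [hD.neg_one_pow, neg_one_mul]
    exact grassGen_mul_comm _ _
  central a b := grassGen_mul_grassGen_mem_center _ _

lemma grassDeriv_grassGen_mul (x y : (Fin D → Fin N) ⊕ (Fin D → Fin N))
    (f : TensorGrassmann D N) :
    grassDeriv x (grassGen y * f) = (if x = y then f else 0) - grassGen y * grassDeriv x f := by
  refine (CliffordAlgebra.contractLeft_ι_mul _ _ _).trans ?_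
  congr 1
  simp [Pi.single_apply]

lemma grassDeriv_one (x : (Fin D → Fin N) ⊕ (Fin D → Fin N)) :
    grassDeriv x 1 = 0 := CliffordAlgebra.contractLeft_one _ _

lemma grassDeriv_self (x : (Fin D → Fin N) ⊕ (Fin D → Fin N)) (f : TensorGrassmann D N) :
    grassDeriv x (grassDeriv x f) = 0 := CliffordAlgebra.contractLeft_contractLeft _ _

lemma grassDeriv_comm (x y : (Fin D → Fin N) ⊕ (Fin D → Fin N)) (f : TensorGrassmann D N) :
    grassDeriv x (grassDeriv y f) = -grassDeriv y (grassDeriv x f) :=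
  CliffordAlgebra.contractLeft_comm _ _ _

/-- The iterated Grassmann derivative in the Berezin integral over the variables of a list. -/
def iteratedGrassDeriv : List (Fin D → Fin N) → TensorGrassmann D N →ₗ[ℂ] TensorGrassmann D N
  | [] => LinearMap.id
  | a :: l => grassDeriv (Sum.inr a) ∘ₗ grassDeriv (Sum.inl a) ∘ₗ iteratedGrassDeriv l

lemma berezin_eq (f : TensorGrassmann D N) :
    berezin f = ExteriorAlgebra.algebraMapInv (iteratedGrassDeriv Finset.univ.toList f) := by
  rw [berezin]
  congr 1
  induction (Finset.univ : Finset (Fin D → Fin N)).toList with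
  | nil => rfl
  | cons a l ih => rw [List.foldr_cons, ih]; rfl

lemma berezin_add (f f' : TensorGrassmann D N) : berezin (f + f') = berezin f + berezin f' := by
  simp only [berezin_eq, map_add]

lemma berezin_smul (r : ℂ) (f : TensorGrassmann D N) : berezin (r • f) = r * berezin f := by
  simp only [berezin_eq, map_smul, smul_eq_mul]

lemma iteratedGrassDeriv_grassDeriv (l : List (Fin D → Fin N))
    (x : (Fin D → Fin N) ⊕ (Fin D → Fin N)) (f : TensorGrassmann D N) :
    iteratedGrassDeriv l (grassDeriv x f) = grassDeriv x (iteratedGrassDeriv l f) := by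
  induction l with
  | nil => rfl
  | cons a l ih =>
    change grassDeriv _ (grassDeriv _ (iteratedGrassDeriv l _)) =
      grassDeriv x (grassDeriv _ (grassDeriv _ (iteratedGrassDeriv l f)))
    rw [ih, grassDeriv_comm _ x, map_neg, grassDeriv_comm _ x, neg_neg]

lemma iteratedGrassDeriv_grassDeriv_eq_zero (l : List (Fin D → Fin N)) (a : Fin D → Fin N)
    (ha : a ∈ l) (f : TensorGrassmann D N) :
    iteratedGrassDeriv l (grassDeriv (Sum.inr a) f) = 0 := by
  induction l with
  | nil => simp at ha
  | cons b l ih =>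
    change grassDeriv _ (grassDeriv _ (iteratedGrassDeriv l _)) = 0
    rcases List.mem_cons.1 ha with rfl | ha
    · rw [iteratedGrassDeriv_grassDeriv, grassDeriv_comm (Sum.inl a), map_neg, grassDeriv_self,
        neg_zero]
    · rw [ih ha, map_zero, map_zero]

/-- The Berezin integral already differentiates once in every variable; derivatives anticommute and
square to zero. -/
lemma berezin_grassDeriv (a : Fin D → Fin N) (f : TensorGrassmann D N) :
    berezin (grassDeriv (Sum.inr a) f) = 0 := by
  rw [berezin_eq, iteratedGrassDeriv_grassDeriv_eq_zero _ _ (by simp), map_zero]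

/-- The exponent of the Gaussian weight. -/
def grassExponent (D N : ℕ) : TensorGrassmann D N :=
  -((gaussParam D N : ℂ) • ∑ a : Fin D → Fin N, grassTbar a * grassT a)

lemma grassExponent_mem_center :
    grassExponent D N ∈ Subalgebra.center ℂ (TensorGrassmann D N) :=
  neg_mem (Subalgebra.smul_mem _ (sum_mem fun _ _ => grassGen_mul_grassGen_mem_center _ _) _)

lemma commute_grassExponent (f : TensorGrassmann D N) : Commute f (grassExponent D N) :=
  Subalgebra.mem_center_iff.1 grassExponent_mem_center f

lemma grassDeriv_grassExponent_mul (a : Fin D → Fin N) (f : TensorGrassmann D N) :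
    grassDeriv (Sum.inr a) (grassExponent D N * f) =
      -((gaussParam D N : ℂ) • (grassT a * f)) +
        grassExponent D N * grassDeriv (Sum.inr a) f := by
  have h1 : ∀ b : Fin D → Fin N, grassDeriv (Sum.inr a) (grassTbar b * grassT b * f) =
      (if a = b then grassT b * f else 0) + grassTbar b * grassT b * grassDeriv (Sum.inr a) f := by
    intro b
    change grassDeriv (Sum.inr a) (grassGen (Sum.inr b) * grassGen (Sum.inl b) * f) =
      (if a = b then grassGen (Sum.inl b) * f else 0) +
        grassGen (Sum.inr b) * grassGen (Sum.inl b) * grassDeriv (Sum.inr a) f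
    rw [mul_assoc, grassDeriv_grassGen_mul, grassDeriv_grassGen_mul]
    simp [mul_assoc]
  simp only [grassExponent, neg_mul, smul_mul_assoc, Finset.sum_mul, map_neg, map_smul, map_sum, h1,
    Finset.sum_add_distrib, Finset.sum_ite_eq, Finset.mem_univ, if_true, smul_add, neg_add]

lemma grassDeriv_grassExponent_pow_mul (a : Fin D → Fin N) (n : ℕ) (f : TensorGrassmann D N) :
    grassDeriv (Sum.inr a) (grassExponent D N ^ (n + 1) * f) =
      -(((n + 1 : ℕ) : ℂ) • (gaussParam D N : ℂ) • (grassT a * grassExponent D N ^ n * f)) +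
        grassExponent D N ^ (n + 1) * grassDeriv (Sum.inr a) f := by
  induction n with
  | zero => simpa using grassDeriv_grassExponent_mul a f
  | succ n ih =>
    have h1 := ((commute_grassExponent (grassT a)).symm.eq)
    rw [pow_succ', mul_assoc, grassDeriv_grassExponent_mul, ih, mul_add, mul_neg, mul_smul_comm,
      mul_smul_comm, ← mul_assoc (grassExponent D N), ← mul_assoc (grassExponent D N), h1,
      mul_assoc (grassT a), ← pow_succ', ← mul_assoc (grassT a),
      ← mul_assoc (grassExponent D N) (grassExponent D N ^ (n + 1)), ← pow_succ' _ (n + 1),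
      ← add_assoc, ← neg_add, Nat.cast_succ (n + 1), add_smul, one_smul,
      add_comm ((gaussParam D N : ℂ) • _)]

lemma sum_pow_eq_zero {R I : Type*} [Ring R] (s : Finset I) (f : I → R)
    (hc : ∀ i j, Commute (f i) (f j)) (h : ∀ i, f i * f i = 0) :
    (∑ i ∈ s, f i) ^ (s.card + 1) = 0 := by
  classical
  induction s using Finset.induction_on with
  | empty => simp
  | insert i s hi ih =>
    rw [Finset.sum_insert hi, Finset.card_insert_of_notMem hi]
    refine Commute.add_pow_eq_zero_of_add_le_succ_of_pow_eq_zero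
      (Commute.sum_right _ _ _ fun j _ => hc i j) ((pow_two _).trans (h i)) ih (by omega)

/-- T_a kills the a-th term of the exponent. The other N^D - 1 terms commute and square to zero, so
the power N^D of their sum vanishes. -/
lemma grassT_mul_grassExponent_pow (a : Fin D → Fin N) :
    grassT a * grassExponent D N ^ (N ^ D) = 0 := by
  let s : Finset (Fin D → Fin N) := Finset.univ.erase a
  have hs : s.card + 1 = N ^ D := by
    rw [Finset.card_erase_add_one (Finset.mem_univ a)]
    simp
  let r : TensorGrassmann D N := ∑ b ∈ s, -((gaussParam D N : ℂ) • (grassTbar b * grassT b))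
  have hr : r ^ (N ^ D) = 0 := by
    rw [← hs]
    refine sum_pow_eq_zero s _ (fun b c => ?_) fun b => ?_
    · exact Subalgebra.mem_center_iff.1 (neg_mem (Subalgebra.smul_mem _
        (grassGen_mul_grassGen_mem_center (Sum.inr c) (Sum.inl c)) _)) _
    · rw [neg_mul_neg, smul_mul_smul_comm]
      have h1 : grassT b * (grassTbar b * grassT b) = 0 := by
        change grassGen (Sum.inl b) * (grassGen (Sum.inr b) * grassGen (Sum.inl b)) = 0
        rw [grassGen_mul_comm (Sum.inr b), mul_neg, ← mul_assoc, grassGen_mul_self, zero_mul,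
          neg_zero]
      rw [mul_assoc, h1, mul_zero, smul_zero]
  have h2 : grassExponent D N = -((gaussParam D N : ℂ) • (grassTbar a * grassT a)) + r := by
    rw [grassExponent, Finset.smul_sum, ← Finset.sum_neg_distrib]
    exact (Finset.add_sum_erase _ _ (Finset.mem_univ a)).symm
  have h3 : grassT a * grassExponent D N = grassT a * r := by
    rw [h2, mul_add, mul_neg, mul_smul_comm]
    have h1 : grassT a * (grassTbar a * grassT a) = 0 := by
      change grassGen (Sum.inl a) * (grassGen (Sum.inr a) * grassGen (Sum.inl a)) = 0
      rw [grassGen_mul_comm (Sum.inr a), mul_neg, ← mul_assoc, grassGen_mul_self, zero_mul,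
        neg_zero]
    rw [h1, smul_zero, neg_zero, zero_add]
  have h4 : ∀ n, grassT a * grassExponent D N ^ n = grassT a * r ^ n := by
    intro n
    induction n with
    | zero => simp
    | succ n ih =>
      rw [pow_succ, ← mul_assoc, ih, mul_assoc, (commute_grassExponent (r ^ n)).eq, ← mul_assoc,
        h3, mul_assoc, ← pow_succ']
  rw [h4, hr, mul_zero]

lemma grassWeight_eq : grassWeight D N =
    ∑ n ∈ Finset.range (N ^ D + 1), ((n.factorial : ℂ)⁻¹) • grassExponent D N ^ n := rfl

lemma commute_grassWeight (f : TensorGrassmann D N) : Commute f (grassWeight D N) := by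
  rw [grassWeight_eq]
  exact Commute.sum_right _ _ _ fun n _ => ((commute_grassExponent f).pow_right n).smul_right _

/-- Differentiating the truncated exponential loses its top term; the missing term is T_a times the
N^D-th power of the exponent, which is zero. -/
lemma grassDeriv_grassWeight_mul (a : Fin D → Fin N) (f : TensorGrassmann D N) :
    grassDeriv (Sum.inr a) (grassWeight D N * f) =
      -((gaussParam D N : ℂ) • (grassWeight D N * (grassT a * f))) +
        grassWeight D N * grassDeriv (Sum.inr a) f := by
  have h0 : grassWeight D N * (grassT a * f) =
      ∑ n ∈ Finset.range (N ^ D), ((n.factorial : ℂ)⁻¹) • (grassT a * grassExponent D N ^ n * f) := by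
    rw [← mul_assoc, ← (commute_grassWeight (grassT a)).eq, grassWeight_eq,
      Finset.sum_range_succ, mul_add, mul_smul_comm, grassT_mul_grassExponent_pow, smul_zero,
      add_zero, Finset.mul_sum, Finset.sum_mul]
    simp only [mul_smul_comm, smul_mul_assoc]
  rw [h0, grassWeight_eq, Finset.sum_range_succ', add_mul, map_add, Finset.sum_mul, map_sum,
    add_mul, Finset.sum_mul, Finset.smul_sum, ← Finset.sum_neg_distrib, ← add_assoc,
    ← Finset.sum_add_distrib]
  congr 1
  · refine Finset.sum_congr rfl fun n _ => ?_
    rw [smul_mul_assoc, smul_mul_assoc, map_smul, grassDeriv_grassExponent_pow_mul, smul_add,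
      smul_neg, smul_comm (gaussParam D N : ℂ), ← smul_assoc, smul_eq_mul]
    congr 3
    rw [Nat.factorial_succ, Nat.cast_mul, mul_inv, mul_right_comm, inv_mul_cancel₀, one_mul]
    exact_mod_cast Nat.succ_ne_zero n
  · simp

/-- Integration by parts. -/
lemma berezin_grassWeight_mul_grassT (a : Fin D → Fin N) (f : TensorGrassmann D N) :
    (gaussParam D N : ℂ) * berezin (grassWeight D N * (grassT a * f)) =
      berezin (grassWeight D N * grassDeriv (Sum.inr a) f) := by
  have h1 := berezin_grassDeriv a (grassWeight D N * f)
  rw [grassDeriv_grassWeight_mul, berezin_add, ← neg_one_smul ℂ, berezin_smul, berezin_smul] at h1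
  linear_combination -h1

/-- The product of the pairs `T_a T̄_a` for `a` in a list. -/
def grassPairs (l : List (Fin D → Fin N)) : TensorGrassmann D N :=
  (l.map fun a => grassGen (Sum.inl a) * grassGen (Sum.inr a)).prod

lemma grassPairs_cons (a : Fin D → Fin N) (l : List (Fin D → Fin N)) :
    grassPairs (a :: l) = grassGen (Sum.inl a) * (grassGen (Sum.inr a) * grassPairs l) := by
  simp [grassPairs, mul_assoc]

lemma grassDeriv_grassPairs (a : Fin D → Fin N) (l : List (Fin D → Fin N)) (ha : a ∉ l) :
    grassDeriv (Sum.inr a) (grassPairs l) = 0 := by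
  induction l with
  | nil => exact grassDeriv_one _
  | cons b l ih =>
    rw [List.mem_cons, not_or] at ha
    rw [grassPairs_cons, grassDeriv_grassGen_mul, grassDeriv_grassGen_mul, ih ha.2]
    simp [ha.1]

lemma grassT_mul_grassPairs (a : Fin D → Fin N) (l : List (Fin D → Fin N)) (ha : a ∈ l) :
    grassT a * grassPairs l = 0 := by
  induction l with
  | nil => simp at ha
  | cons b l ih =>
    rcases List.mem_cons.1 ha with rfl | ha
    · rw [grassPairs_cons]
      change grassGen _ * _ = 0
      rw [← mul_assoc, grassGen_mul_self, zero_mul]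
    · rw [grassPairs_cons, ← mul_assoc (grassGen (Sum.inl b)), ← mul_assoc,
        Subalgebra.mem_center_iff.1 (grassGen_mul_grassGen_mem_center _ _), mul_assoc, ih ha,
        mul_zero]

/-- Integration by parts strips one pair T_a T̄_a at a time; by distinctness no other pair contains
T̄_a. -/
lemma berezin_grassWeight_mul_grassPairs (l : List (Fin D → Fin N)) (hl : l.Nodup) :
    (gaussParam D N : ℂ) ^ l.length * berezin (grassWeight D N * grassPairs l) =
      berezin (grassWeight D N) := by
  induction l with
  | nil => simp [grassPairs]
  | cons a l ih =>
    rw [List.nodup_cons] at hl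
    rw [grassPairs_cons, List.length_cons, pow_succ, mul_assoc]
    have h1 := berezin_grassWeight_mul_grassT a (grassGen (Sum.inr a) * grassPairs l)
    rw [grassDeriv_grassGen_mul, if_pos rfl, grassDeriv_grassPairs a l hl.1, mul_zero, sub_zero] at h1
    rw [← ih hl.2, ← h1]
    rfl

lemma iteratedGrassDeriv_center_mul (l : List (Fin D → Fin N)) (b : Fin D → Fin N) (hb : b ∉ l)
    (f : TensorGrassmann D N) :
    iteratedGrassDeriv l (grassGen (Sum.inl b) * (grassGen (Sum.inr b) * f)) =
      grassGen (Sum.inl b) * (grassGen (Sum.inr b) * iteratedGrassDeriv l f) := by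
  induction l with
  | nil => rfl
  | cons a l ih =>
    rw [List.mem_cons, not_or] at hb
    change grassDeriv _ (grassDeriv _ (iteratedGrassDeriv l _)) =
      grassGen (Sum.inl b) * (grassGen (Sum.inr b) *
        grassDeriv _ (grassDeriv _ (iteratedGrassDeriv l f)))
    rw [ih hb.2]
    have hab : a ≠ b := Ne.symm hb.1
    simp [grassDeriv_grassGen_mul, hab]

lemma iteratedGrassDeriv_grassPairs (l : List (Fin D → Fin N)) (hl : l.Nodup) :
    iteratedGrassDeriv l (grassPairs l) = 1 := by
  induction l with
  | nil => rfl
  | cons a l ih =>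
    rw [List.nodup_cons] at hl
    change grassDeriv _ (grassDeriv _ (iteratedGrassDeriv l _)) = 1
    rw [grassPairs_cons, iteratedGrassDeriv_center_mul l a hl.1, ih hl.2, grassDeriv_grassGen_mul,
      grassDeriv_grassGen_mul, grassDeriv_one]
    simpa [grassDeriv_one] using grassDeriv_grassGen_mul (Sum.inr a) (Sum.inr a) 1

/-- Insert all pairs T_a T̄_a. They annihilate the exponent, so the weight acts on them as 1, and
their integral is 1; the normalisation is therefore the power N^D of the Gaussian parameter. -/
lemma berezin_grassWeight_ne_zero : berezin (grassWeight D N) ≠ 0 := by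
  have h1 := berezin_grassWeight_mul_grassPairs (D := D) (N := N) Finset.univ.toList
    (Finset.nodup_toList _)
  have h2 : grassExponent D N * grassPairs Finset.univ.toList = 0 := by
    rw [grassExponent, neg_mul, smul_mul_assoc, Finset.sum_mul, Finset.sum_eq_zero, smul_zero,
      neg_zero]
    intro a _
    rw [mul_assoc, grassT_mul_grassPairs _ _ (by simp), mul_zero]
  have h3 : grassWeight D N * grassPairs Finset.univ.toList = grassPairs Finset.univ.toList := by
    rw [grassWeight_eq, Finset.sum_mul, Finset.sum_eq_single 0]
    · simp
    · intro n _ hn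
      obtain ⟨m, rfl⟩ := Nat.exists_eq_succ_of_ne_zero hn
      rw [smul_mul_assoc, pow_succ, mul_assoc, h2, mul_zero, smul_zero]
    · simp
  rw [h3, berezin_eq, iteratedGrassDeriv_grassPairs _ (Finset.nodup_toList _), map_one,
    mul_one, Finset.length_toList] at h1
  rw [← h1]
  rcases isEmpty_or_nonempty (Fin D → Fin N) with h | ⟨⟨a⟩⟩
  · simp
  · refine pow_ne_zero _ ?_
    rcases Nat.eq_zero_or_pos D with rfl | hD
    · simp [gaussParam]
    · have : N ≠ 0 := fun h => (h ▸ a ⟨0, hD⟩).elim0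
      simp [gaussParam, this]

/-! ### The Wick theorem for a fermionic coupling -/

lemma grassDeriv_ofFn_inl_mul {p : ℕ} (a : Fin D → Fin N) (b : Fin p → Fin D → Fin N)
    (f : TensorGrassmann D N) :
    grassDeriv (Sum.inr a) ((List.ofFn fun i => grassT (b i)).prod * f) =
      (-1 : ℂ) ^ p • ((List.ofFn fun i => grassT (b i)).prod * grassDeriv (Sum.inr a) f) := by
  induction p with
  | zero => simp
  | succ p ih =>
    rw [List.ofFn_succ, List.prod_cons, mul_assoc, mul_assoc]
    refine (grassDeriv_grassGen_mul _ _ _).trans ?_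
    rw [ih, pow_succ, mul_neg_one, neg_smul, mul_smul_comm]
    simp
    rfl

lemma grassDeriv_ofFn_inr {p : ℕ} (a : Fin D → Fin N) (b : Fin (p + 1) → Fin D → Fin N) :
    grassDeriv (Sum.inr a) (List.ofFn fun i => grassTbar (b i)).prod =
      ∑ j : Fin (p + 1), ((-1 : ℂ) ^ (j : ℕ) * if a = b j then 1 else 0) •
        (List.ofFn fun i => grassTbar (b (j.succAbove i))).prod := by
  induction p with
  | zero =>
    have h := grassDeriv_grassGen_mul (Sum.inr a) (Sum.inr (b 0)) 1
    rw [grassDeriv_one, mul_zero, sub_zero, mul_one] at h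
    simp only [List.ofFn_succ, List.ofFn_zero, List.prod_cons, List.prod_nil, mul_one,
      Fin.sum_univ_succ]
    refine h.trans ?_
    simp [ite_smul]
  | succ p ih =>
    rw [List.ofFn_succ, List.prod_cons, Fin.sum_univ_succ]
    refine (grassDeriv_grassGen_mul _ _ _).trans ?_
    rw [ih, Finset.mul_sum, sub_eq_add_neg, ← Finset.sum_neg_distrib]
    congr 1
    · simp [ite_smul]
    · refine Finset.sum_congr rfl fun j _ => ?_
      rw [List.ofFn_succ (f := fun i => grassTbar (b (j.succ.succAbove i)))]
      simp only [Fin.succ_succAbove_succ, Fin.succ_succAbove_zero, List.prod_cons, Fin.val_succ,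
        pow_succ, mul_neg_one, neg_mul, neg_smul, mul_smul_comm]
      rfl

lemma berezin_sum {I : Type*} (s : Finset I) (f : I → TensorGrassmann D N) :
    berezin (∑ i ∈ s, f i) = ∑ i ∈ s, berezin (f i) := by
  simp only [berezin_eq, map_sum]

/-- Integration by parts turns the first T into a derivative, which passes the other p T's and then
contracts with some T̄. The signs combine to a Laplace expansion along the first row, as for the
fields. -/
theorem berezin_ofFn {p : ℕ} (a b : Fin p → Fin D → Fin N) :
    (gaussParam D N : ℂ) ^ p * berezin (grassWeight D N * ((List.ofFn fun i => grassT (a i)).prod *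
      (List.ofFn fun j => grassTbar (b j)).prod)) =
      (Matrix.of fun i j => if a i = b j.rev then (1 : ℂ) else 0).det *
        berezin (grassWeight D N) := by
  induction p with
  | zero => simp
  | succ p ih =>
    rw [List.ofFn_succ, List.prod_cons, mul_assoc (grassT _), pow_succ, mul_assoc,
      berezin_grassWeight_mul_grassT, grassDeriv_ofFn_inl_mul, grassDeriv_ofFn_inr,
      Matrix.det_succ_row_zero, ← Equiv.sum_comp Fin.revPerm]
    simp only [Finset.mul_sum, mul_smul_comm, Finset.smul_sum, Finset.sum_mul, berezin_sum,
      berezin_smul]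
    refine Finset.sum_congr rfl fun j _ => ?_
    rw [Fin.revPerm_apply, Matrix.of_apply]
    have h1 : (-1 : ℂ) ^ p * ((-1) ^ (j.rev : ℕ)) = (-1) ^ (j : ℕ) := by
      have hj : p = (j.rev : ℕ) + j := by
        rw [Fin.val_rev]
        omega
      have h3 : (-1 : ℂ) ^ p = (-1) ^ (j.rev : ℕ) * (-1) ^ (j : ℕ) := by
        rw [← pow_add, ← hj]
      rw [h3, mul_right_comm, ← mul_pow]
      simp
    rw [← h1]
    have h2 := ih (fun i => a i.succ) fun i => b (j.rev.succAbove i)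
    have h4 : (Matrix.of fun i j : Fin (p + 1) => if a i = b j.rev then (1 : ℂ) else 0).submatrix
        Fin.succ j.succAbove =
        Matrix.of fun i l : Fin p => if a i.succ = b (j.rev.succAbove l.rev) then (1 : ℂ) else 0 := by
      ext i l
      simp [Fin.rev_succAbove]
    rw [h4]
    linear_combination (-1 : ℂ) ^ p * (-1) ^ (j.rev : ℕ) * (if a 0 = b j.rev then 1 else 0) * h2

/-- The reversed columns give the signature of the reversal, which the prefactor of `couplingProd`
cancels. For odd D a signature equals its D-th power, so the result has the same form as in the
bosonic case. -/
theorem fermionAverage_couplingProd (hD : Odd D) (hN : N ≠ 0) {k : ℕ}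
    (a b : Fin k → Fin D → Fin N) :
    fermionAverage (couplingProd grassT grassTbar a b) = ((gaussParam D N : ℂ)⁻¹) ^ k *
      ∑ σ : Equiv.Perm (Fin k), ((Equiv.Perm.sign σ : ℤ) : ℂ) ^ D *
        if ∀ i, a i = b (σ i) then 1 else 0 := by
  have hg : (gaussParam D N : ℂ) ≠ 0 := by simp [gaussParam, hN]
  have hs : ∀ π : Equiv.Perm (Fin k), ((Equiv.Perm.sign π : ℤ) : ℂ) ^ D =
      ((Equiv.Perm.sign π : ℤ) : ℂ) := by
    intro π
    rcases Int.units_eq_one_or (Equiv.Perm.sign π) with h | h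
    · simp [h]
    · simp [h, hD.neg_one_pow]
  have h1 : (Matrix.of fun i j : Fin k => if a i = b j.rev then (1 : ℂ) else 0).det =
      ((Equiv.Perm.sign (Fin.revPerm (n := k)) : ℤ) : ℂ) *
        (Matrix.of fun i j : Fin k => if a i = b j then (1 : ℂ) else 0).det :=
    Matrix.det_permute' Fin.revPerm (Matrix.of fun i j : Fin k => if a i = b j then (1 : ℂ) else 0)
  have h2 : ((Equiv.Perm.sign (Fin.revPerm (n := k)) : ℤ) : ℂ) *
      ((Equiv.Perm.sign (Fin.revPerm (n := k)) : ℤ) : ℂ) = 1 := by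
    rw [← Int.cast_mul, ← Units.val_mul, Int.units_mul_self]
    simp
  have h3 : (Matrix.of fun i j : Fin k => if a i = b j then (1 : ℂ) else 0).det =
      ∑ σ : Equiv.Perm (Fin k), ((Equiv.Perm.sign σ : ℤ) : ℂ) *
        if ∀ i, a i = b (σ i) then 1 else 0 := by
    rw [← Matrix.det_transpose, Matrix.det_apply']
    refine Finset.sum_congr rfl fun σ _ => ?_
    simp [Finset.prod_ite_zero]
  simp only [hs]
  rw [fermionAverage, couplingProd, hs, mul_smul_comm, berezin_smul,
    div_eq_iff berezin_grassWeight_ne_zero, ← h3, inv_pow, mul_assoc,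
    eq_inv_mul_iff_mul_eq₀ (pow_ne_zero _ hg), mul_left_comm, berezin_ofFn, h1, ← mul_assoc,
    ← mul_assoc, h2, one_mul]

end

end ColoredSYK
namespace ColoredSYK

/-! ### The number of assignments of indices to the faces -/

section

variable {D N k : ℕ}

/-- The functions counted are those that are constant on the cycles of σ τ⁻¹, one free index per
cycle. -/
lemma sum_ite_apply_perm_eq (σ τ : Equiv.Perm (Fin k)) :
    (∑ f : Fin k → Fin N, if ∀ i, f (σ i) = f (τ i) then (1 : ℂ) else 0) =
      (N : ℂ) ^ Nat.card (Quotient (Equiv.Perm.SameCycle.setoid (σ * τ⁻¹))) := by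
  classical
  have h : ∀ f : Fin k → Fin N, (∀ i, f (σ i) = f (τ i)) ↔
      Equiv.Perm.SameCycle.setoid (σ * τ⁻¹) ≤ Setoid.ker f := by
    intro f
    constructor
    · intro hf x y hxy
      refine apply_eq_of_sameCycle (fun j => ?_) hxy
      rw [Equiv.Perm.mul_apply, hf, perm_apply_inv]
    · intro hf i
      have h1 : (σ * τ⁻¹).SameCycle (τ i) ((σ * τ⁻¹) (τ i)) := Equiv.Perm.sameCycle_apply_right.2
        (Equiv.Perm.SameCycle.refl _ _)
      have h2 : f (τ i) = f ((σ * τ⁻¹) (τ i)) := hf h1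
      rw [h2]
      simp
  rw [Finset.sum_boole, ← Fintype.card_subtype,
    Fintype.card_congr (Equiv.subtypeEquivRight h), Fintype.card_congr (Setoid.liftEquiv _)]
  simp [Nat.card_eq_fintype_card]

/-- The edges of colour 0 determine `a` from `b`. The remaining conditions separate into one for
each colour c, with a free index for each face of colours 0 and c. -/
lemma indexSum_eq_pow (s : Fin (D + 1) → Equiv.Perm (Fin k)) :
    indexSum (fun c : Fin D => s c.succ)
      (fun (a b : Fin k → Fin D → Fin N) => ∏ i, if a i = b (s 0 i) then (1 : ℂ) else 0) =
      (N : ℂ) ^ numZeroFaces s := by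
  have h1 : ∀ b : Fin k → Fin D → Fin N,
      (∑ a : Fin k → Fin D → Fin N, if ∀ (c : Fin D) i, a i c = b (s c.succ i) c then
        ∏ i, if a i = b (s 0 i) then (1 : ℂ) else 0 else 0) =
      ∏ c : Fin D, if ∀ i, b (s 0 i) c = b (s c.succ i) c then (1 : ℂ) else 0 := by
    intro b
    rw [Finset.sum_eq_single fun i => b (s 0 i)]
    · simp [Finset.prod_ite_zero]
    · intro a _ ha
      obtain ⟨i, hi⟩ := Function.ne_iff.1 ha
      rw [Finset.prod_eq_zero (Finset.mem_univ i) (if_neg hi), ite_self]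
    · simp
  rw [indexSum, Finset.sum_comm]
  refine (Finset.sum_congr rfl fun b _ => by convert h1 b).trans ?_
  rw [← Equiv.sum_comp (Equiv.piComm fun (_ : Fin D) (_ : Fin k) => Fin N)]
  change ∑ f : Fin D → Fin k → Fin N, ∏ c : Fin D,
    (if ∀ i, f c (s 0 i) = f c (s c.succ i) then (1 : ℂ) else 0) = _
  rw [← Fintype.piFinset_univ, ← Finset.prod_univ_sum (fun _ => Finset.univ)
    fun (c : Fin D) (f : Fin k → Fin N) =>
      if ∀ i, f (s 0 i) = f (s c.succ i) then (1 : ℂ) else 0]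
  rw [numZeroFaces, ← Finset.prod_pow_eq_pow_sum]
  refine Finset.prod_congr rfl fun c _ => ?_
  rw [numFacesOfColors, ← sum_ite_apply_perm_eq]

/-! ### The averages over the couplings -/

lemma gaussParam_pos (hN : N ≠ 0) : 0 < gaussParam D N := by
  have : (0 : ℝ) < N := by exact_mod_cast Nat.pos_of_ne_zero hN
  exact pow_pos this _

lemma couplingProd_complex (hD : Even D) (T : (Fin D → Fin N) → ℂ)
    (a b : Fin k → Fin D → Fin N) :
    couplingProd T (fun a => starRingEnd ℂ (T a)) a b =
      (∏ i, T (a i)) * ∏ i, starRingEnd ℂ (T (b i)) := by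
  have h : ((Equiv.Perm.sign (Fin.revPerm (n := k)) : ℤ) : ℂ) ^ D = 1 := by
    obtain ⟨m, rfl⟩ := hD
    rw [pow_add, sign_pow_mul_self]
  rw [couplingProd, h, one_smul, List.prod_ofFn, List.prod_ofFn]

lemma isCoupling_complex (hD : Even D) (T : (Fin D → Fin N) → ℂ) :
    IsCoupling T fun a => starRingEnd ℂ (T a) where
  anticomm a b := by rw [hD.neg_one_pow, one_mul, mul_comm]
  central a b := Subalgebra.mem_center_iff.2 fun _ => mul_comm _ _

lemma bosonMeasure_eq :
    bosonMeasure D N = Measure.pi fun _ => complexGaussian (gaussParam D N) := rfl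

lemma integral_couplingProd (hD : Even D) (hN : N ≠ 0) (a b : Fin k → Fin D → Fin N) :
    ∫ T, couplingProd T (fun a => starRingEnd ℂ (T a)) a b ∂bosonMeasure D N =
      ((gaussParam D N : ℂ)⁻¹) ^ k *
      ∑ σ : Equiv.Perm (Fin k), ((Equiv.Perm.sign σ : ℤ) : ℂ) ^ D *
        if ∀ i, a i = b (σ i) then 1 else 0 := by
  have h : ∀ σ : Equiv.Perm (Fin k), ((Equiv.Perm.sign σ : ℤ) : ℂ) ^ D = 1 := by
    obtain ⟨m, rfl⟩ := hD
    intro σ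
    rw [pow_add, sign_pow_mul_self]
  simp only [couplingProd_complex hD, h, one_mul, bosonMeasure_eq]
  exact integral_prod_complexGaussian (gaussParam_pos hN) a b

lemma integrable_couplingProd (hD : Even D) (hN : N ≠ 0) (a b : Fin k → Fin D → Fin N) :
    Integrable (fun T => couplingProd T (fun a => starRingEnd ℂ (T a)) a b)
      (bosonMeasure D N) := by
  simp only [couplingProd_complex hD, bosonMeasure_eq]
  exact integrable_prod_complexGaussian (gaussParam_pos hN) a b

/-- The average of the contribution of a `D`-coloured graph to the partition function. -/
def averagedWeight (β : ℝ) (D N : ℕ) (s : Fin D → Equiv.Perm (Fin k)) : ℂ :=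
  ∑ σ : Equiv.Perm (Fin k),
    annealedWeight β D N (gaussParam D N : ℂ)⁻¹ (Fin k)
      (Fin.cons σ s : Fin (D + 1) → Equiv.Perm (Fin k))

lemma sum_couplingProd_average (β : ℝ) (s : Fin D → Equiv.Perm (Fin k)) :
    (∑ a : Fin k → Fin D → Fin N, ∑ b : Fin k → Fin D → Fin N,
      if ∀ c i, a i c = b (s c i) c then (amplitudeOn β (Fin k) s : ℂ) *
        (((gaussParam D N : ℂ)⁻¹) ^ k * ∑ σ : Equiv.Perm (Fin k),
          ((Equiv.Perm.sign σ : ℤ) : ℂ) ^ D * if ∀ i, a i = b (σ i) then 1 else 0) else 0) =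
      averagedWeight β D N s := by
  simp only [averagedWeight, annealedWeight, indexSum, Fin.cons_succ, Fin.cons_zero,
    Finset.mul_sum, Fintype.card_fin]
  rw [Finset.sum_comm]
  symm
  rw [Finset.sum_comm]
  simp only [Finset.sum_comm (s := (Finset.univ : Finset (Equiv.Perm (Fin k))))]
  rw [Finset.sum_comm]
  refine Finset.sum_congr rfl fun b _ => Finset.sum_congr rfl fun a _ => ?_
  split_ifs
  · refine Finset.sum_congr rfl fun σ _ => ?_
    rw [Finset.prod_ite_zero]
    simp only [Finset.mem_univ, forall_const, Finset.prod_const_one]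
    ring
  · simp

lemma integrable_couplingSum (hD : Even D) (hN : N ≠ 0) (β : ℝ)
    (s : Fin D → Equiv.Perm (Fin k)) :
    Integrable (fun T => couplingSum β T (fun a => starRingEnd ℂ (T a)) s)
      (bosonMeasure D N) := by
  refine integrable_finsetSum _ fun a _ => integrable_finsetSum _ fun b _ => ?_
  split_ifs
  · exact (integrable_couplingProd hD hN a b).smul (amplitudeOn β (Fin k) s : ℂ)
  · exact integrable_zero _ _ _

lemma integral_couplingSum (hD : Even D) (hN : N ≠ 0) (β : ℝ)
    (s : Fin D → Equiv.Perm (Fin k)) :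
    ∫ T, couplingSum β T (fun a => starRingEnd ℂ (T a)) s ∂bosonMeasure D N =
      averagedWeight β D N s := by
  have h : ∀ a b : Fin k → Fin D → Fin N, Integrable (fun T => if ∀ c i, a i c = b (s c i) c then
      (amplitudeOn β (Fin k) s : ℂ) • couplingProd T (fun a => starRingEnd ℂ (T a)) a b else 0)
      (bosonMeasure D N) := by
    intro a b
    split_ifs
    · exact (integrable_couplingProd hD hN a b).smul (amplitudeOn β (Fin k) s : ℂ)
    · exact integrable_zero _ _ _
  rw [← sum_couplingProd_average]
  simp only [couplingSum]
  rw [integral_finsetSum _ fun a _ => integrable_finsetSum _ fun b _ => h a b]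
  refine Finset.sum_congr rfl fun a _ => ?_
  rw [integral_finsetSum _ fun b _ => h a b]
  refine Finset.sum_congr rfl fun b _ => ?_
  split_ifs
  · rw [integral_smul, integral_couplingProd hD hN, smul_eq_mul]
  · simp

/-- The average over a fermionic coupling as a linear map. -/
def fermionAverageHom (D N : ℕ) : TensorGrassmann D N →ₗ[ℂ] ℂ where
  toFun := fermionAverage
  map_add' f f' := by
    simp only [fermionAverage]
    rw [mul_add, berezin_add, add_div]
  map_smul' r f := by
    simp only [fermionAverage]
    rw [mul_smul_comm, berezin_smul, mul_div_assoc]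
    rfl

lemma fermionAverage_couplingSum (hD : Odd D) (hN : N ≠ 0) (β : ℝ)
    (s : Fin D → Equiv.Perm (Fin k)) :
    fermionAverage (couplingSum β (grassT (D := D) (N := N)) grassTbar s) =
      averagedWeight β D N s := by
  change fermionAverageHom D N _ = _
  rw [← sum_couplingProd_average, couplingSum, map_sum]
  refine Finset.sum_congr rfl fun a _ => ?_
  rw [map_sum]
  refine Finset.sum_congr rfl fun b _ => ?_
  split_ifs
  · rw [map_smul, smul_eq_mul]
    congr 1
    exact fermionAverage_couplingProd hD hN a b
  · simp

/-- A sum over the permutations of the colours `1, …, D` of averaged weights is a sum over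
`(D+1)`-coloured graphs. -/
lemma sum_averagedWeight (β : ℝ) (p : (Fin D → Equiv.Perm (Fin k)) → Prop) [DecidablePred p] :
    (∑ s : Fin D → Equiv.Perm (Fin k), if p s then averagedWeight β D N s else 0) =
      ∑ s : Fin (D + 1) → Equiv.Perm (Fin k), if p (fun c : Fin D => s c.succ) then
        annealedWeight β D N (gaussParam D N : ℂ)⁻¹ (Fin k) s else 0 := by
  rw [← Equiv.sum_comp (Fin.consEquiv fun _ : Fin (D + 1) => Equiv.Perm (Fin k)),
    Fintype.sum_prod_type, Finset.sum_comm]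
  refine Finset.sum_congr rfl fun s _ => ?_
  have h : ∀ σ, (Fin.consEquiv fun _ : Fin (D + 1) => Equiv.Perm (Fin k)) (σ, s) =
      Fin.cons σ s := fun _ => rfl
  simp only [h, Fin.cons_succ]
  split_ifs
  · rfl
  · simp

theorem averagedPartitionFunction_eq (hD : 0 < D) (hN : N ≠ 0) (β : ℝ) :
    averagedPartitionFunction D N β =
      diagonalSeries (totalWeight (annealedWeight β D N (gaussParam D N : ℂ)⁻¹)) := by
  ext d
  rw [coeff_diagonalSeries, totalWeight]
  have h := sum_averagedWeight (N := N) (k := d 0) β fun _ : Fin D → Equiv.Perm (Fin (d 0)) => True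
  simp only [if_true] at h
  rw [← h]
  by_cases he : Even D
  · have h1 : MvPowerSeries.coeff d (averagedPartitionFunction D N β) =
        ∫ T, MvPowerSeries.coeff d
          (partitionFunction D N β T fun a => starRingEnd ℂ (T a)) ∂bosonMeasure D N := if_pos he
    rw [h1]
    simp only [coeff_partitionFunction hD]
    split_ifs
    · rw [integral_smul, integral_finsetSum _ fun s _ => integrable_couplingSum he hN β s]
      simp only [integral_couplingSum he hN]
    · simp
  · have h1 : MvPowerSeries.coeff d (averagedPartitionFunction D N β) =
        fermionAverageHom D N (MvPowerSeries.coeff d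
          (partitionFunction D N β (grassT (D := D) (N := N)) grassTbar)) := if_neg he
    rw [h1, coeff_partitionFunction hD]
    split_ifs
    · rw [map_smul, map_sum]
      congr 1
      exact Finset.sum_congr rfl fun s _ =>
        fermionAverage_couplingSum (Nat.not_even_iff_odd.1 he) hN β s
    · simp

theorem annealedFreeEnergy_eq (hD : 0 < D) (hN : N ≠ 0) (β : ℝ) :
    annealedFreeEnergy D N β =
      diagonalSeries (connectedWeight (annealedWeight β D N (gaussParam D N : ℂ)⁻¹)) := by
  rw [annealedFreeEnergy, averagedPartitionFunction_eq hD hN]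
  exact formalLog_diagonalSeries (isMultiplicative_annealedWeight β D N _)

-- The logarithm is taken before σ^(0) exists, so connectedness is demanded of the graph without the
-- colour 0.
open scoped Classical in
theorem coeff_quenchedFreeEnergy (hD : 0 < D) (hN : N ≠ 0) (β : ℝ) (d : Fin 2 →₀ ℕ) :
    MvPowerSeries.coeff d (quenchedFreeEnergy D N β) = if d 0 = d 1 then
      (((d 0).factorial : ℂ) * ((d 0).factorial : ℂ))⁻¹ •
        ∑ s : Fin (D + 1) → Equiv.Perm (Fin (d 0)),
          if (coloredGraph fun c : Fin D => s c.succ).Connected then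
            annealedWeight β D N (gaussParam D N : ℂ)⁻¹ (Fin (d 0)) s else 0 else 0 := by
  rw [← sum_averagedWeight (N := N) β fun s : Fin D → Equiv.Perm (Fin (d 0)) =>
    (coloredGraph s).Connected]
  by_cases he : Even D
  · have h1 : MvPowerSeries.coeff d (quenchedFreeEnergy D N β) =
        ∫ T, MvPowerSeries.coeff d (formalLog
          (partitionFunction D N β T fun a => starRingEnd ℂ (T a))) ∂bosonMeasure D N := if_pos he
    rw [h1]
    simp only [coeff_formalLog_partitionFunction hD (isCoupling_complex he _)]
    split_ifs
    · rw [integral_smul, integral_finsetSum]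
      · congr 1
        refine Finset.sum_congr rfl fun s _ => ?_
        split_ifs
        · exact integral_couplingSum he hN β s
        · simp
      · intro s _
        split_ifs
        · exact integrable_couplingSum he hN β s
        · exact integrable_zero _ _ _
    · simp
  · have h0 := Nat.not_even_iff_odd.1 he
    have h1 : MvPowerSeries.coeff d (quenchedFreeEnergy D N β) =
        fermionAverageHom D N (MvPowerSeries.coeff d (formalLog
          (partitionFunction D N β (grassT (D := D) (N := N)) grassTbar))) := if_neg he
    rw [h1, coeff_formalLog_partitionFunction hD (isCoupling_grass h0)]
    split_ifs
    · rw [map_smul, map_sum]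
      congr 1
      refine Finset.sum_congr rfl fun s _ => ?_
      split_ifs
      · exact fermionAverage_couplingSum h0 hN β s
      · exact map_zero _
    · simp

end

/-! ### The limit of a large number of components -/

section

variable {n k : ℕ}

/-- With D = n + 1, each of the k covariances supplies N^(-n), and the division by N one more
factor. -/
lemma annealedWeight_div (hN : N ≠ 0) (β : ℝ) (s : Fin (n + 2) → Equiv.Perm (Fin k)) :
    annealedWeight β (n + 1) N (gaussParam (n + 1) N : ℂ)⁻¹ (Fin k) s / (N : ℂ) =
      (amplitude β (fun c : Fin (n + 1) => s c.succ) : ℂ) *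
        ((Equiv.Perm.sign (s 0) : ℤ) : ℂ) ^ (n + 1) *
        ((N : ℂ) ^ numZeroFaces s / (N : ℂ) ^ (n * k + 1)) := by
  have hN' : (N : ℂ) ≠ 0 := by exact_mod_cast hN
  rw [annealedWeight, indexSum_eq_pow, amplitudeOn_fin, Fintype.card_fin, gaussParam,
    Nat.add_sub_cancel]
  push_cast
  rw [inv_pow, ← pow_mul]
  field_simp
  ring

lemma tendsto_pow_div_pow {p q : ℕ} (h : p ≤ q) :
    Tendsto (fun N : ℕ => (N : ℂ) ^ p / (N : ℂ) ^ q) atTop (𝓝 (if p = q then 1 else 0)) := by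
  obtain ⟨r, rfl⟩ := Nat.exists_eq_add_of_le h
  have h1 : (fun N : ℕ => ((N : ℂ)⁻¹) ^ r) =ᶠ[atTop]
      fun N : ℕ => (N : ℂ) ^ p / (N : ℂ) ^ (p + r) := by
    filter_upwards [eventually_ne_atTop 0] with N hN
    have hN' : (N : ℂ) ≠ 0 := by exact_mod_cast hN
    rw [pow_add, inv_pow]
    field_simp
  refine Tendsto.congr' h1 ?_
  have h2 := (tendsto_inv_atTop_nhds_zero_nat (𝕜 := ℂ)).pow r
  rcases Nat.eq_zero_or_pos r with rfl | hr
  · simp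
  · rwa [if_neg (by omega), ← zero_pow (M₀ := ℂ) hr.ne']

-- The exponent of N is at most 0, and it is 0 exactly for the extremal graphs.
open scoped Classical in
lemma tendsto_annealedWeight_div (hn : 1 ≤ n) (β : ℝ) (s : Fin (n + 2) → Equiv.Perm (Fin k))
    (hs : (coloredGraph s).Connected) :
    Tendsto (fun N : ℕ => annealedWeight β (n + 1) N (gaussParam (n + 1) N : ℂ)⁻¹ (Fin k) s /
      (N : ℂ)) atTop
      (𝓝 (if (coloredGraph fun c : Fin (n + 1) => s c.succ).Connected ∧ degree (D := n + 1) s = 0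
        then (amplitude β (fun c : Fin (n + 1) => s c.succ) : ℂ) *
          ((Equiv.Perm.sign (s 0) : ℤ) : ℂ) ^ (n + 1) else 0)) := by
  have h1 := (tendsto_pow_div_pow (numZeroFaces_le s hs)).const_mul
    ((amplitude β (fun c : Fin (n + 1) => s c.succ) : ℂ) *
      ((Equiv.Perm.sign (s 0) : ℤ) : ℂ) ^ (n + 1))
  simp only [numZeroFaces_eq_iff hn s hs, mul_ite, mul_one, mul_zero] at h1
  refine Tendsto.congr' ?_ h1
  filter_upwards [eventually_ne_atTop 0] with N hN
  exact (annealedWeight_div hN β s).symm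

theorem tendsto_quenchedFreeEnergy {D : ℕ} (hD : 2 ≤ D) (β : ℝ) (d : Fin 2 →₀ ℕ) :
    Tendsto (fun N : ℕ => MvPowerSeries.coeff d (quenchedFreeEnergy D N β) / (N : ℂ)) atTop
      (𝓝 (MvPowerSeries.coeff d (leadingOrder D β))) := by
  classical
  obtain ⟨n, rfl⟩ : ∃ n, D = n + 1 := ⟨D - 1, by omega⟩
  have h1 : (fun N : ℕ => if d 0 = d 1 then
      (((d 0).factorial : ℂ) * ((d 0).factorial : ℂ))⁻¹ *
        ∑ s : Fin (n + 2) → Equiv.Perm (Fin (d 0)),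
          if (coloredGraph fun c : Fin (n + 1) => s c.succ).Connected then
            annealedWeight β (n + 1) N (gaussParam (n + 1) N : ℂ)⁻¹ (Fin (d 0)) s / (N : ℂ) else 0
        else 0) =ᶠ[atTop]
      fun N : ℕ => MvPowerSeries.coeff d (quenchedFreeEnergy (n + 1) N β) / (N : ℂ) := by
    filter_upwards [eventually_ne_atTop 0] with N hN
    rw [coeff_quenchedFreeEnergy (by omega) hN]
    split_ifs
    · rw [smul_eq_mul, mul_div_assoc, Finset.sum_div]
      congr 1
      refine Finset.sum_congr rfl fun s _ => ?_
      split_ifs <;> simp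
    · simp
  refine Tendsto.congr' h1 ?_
  change Tendsto _ _ (𝓝 (if d 0 = d 1 then _ else 0))
  split_ifs
  · refine Tendsto.const_mul _ ?_
    rw [Finset.sum_filter]
    refine tendsto_finsetSum _ fun s _ => ?_
    by_cases hs : (coloredGraph fun c : Fin (n + 1) => s c.succ).Connected
    · simp only [if_pos hs]
      exact tendsto_annealedWeight_div (by omega) β s (connected_of_connected_succ hs)
    · simp [hs]
  · exact tendsto_const_nhds

theorem tendsto_annealedFreeEnergy {D : ℕ} (hD : 2 ≤ D) (β : ℝ) (d : Fin 2 →₀ ℕ) :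
    Tendsto (fun N : ℕ => MvPowerSeries.coeff d (annealedFreeEnergy D N β) / (N : ℂ)) atTop
      (𝓝 (MvPowerSeries.coeff d (leadingOrder D β))) := by
  classical
  obtain ⟨n, rfl⟩ : ∃ n, D = n + 1 := ⟨D - 1, by omega⟩
  have h1 : (fun N : ℕ => if d 0 = d 1 then
      (((d 0).factorial : ℂ) * ((d 0).factorial : ℂ))⁻¹ *
        ∑ s : Fin (n + 2) → Equiv.Perm (Fin (d 0)),
          if (coloredGraph s).Connected then
            annealedWeight β (n + 1) N (gaussParam (n + 1) N : ℂ)⁻¹ (Fin (d 0)) s / (N : ℂ) else 0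
        else 0) =ᶠ[atTop]
      fun N : ℕ => MvPowerSeries.coeff d (annealedFreeEnergy (n + 1) N β) / (N : ℂ) := by
    filter_upwards [eventually_ne_atTop 0] with N hN
    rw [annealedFreeEnergy_eq (by omega) hN, coeff_diagonalSeries, connectedWeight]
    split_ifs
    · rw [smul_eq_mul, mul_div_assoc, Finset.sum_div]
      congr 1
      refine Finset.sum_congr rfl fun s _ => ?_
      split_ifs <;> simp
    · simp
  refine Tendsto.congr' h1 ?_
  change Tendsto _ _ (𝓝 (if d 0 = d 1 then _ else 0))
  split_ifs
  · refine Tendsto.const_mul _ ?_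
    rw [Finset.sum_filter]
    refine tendsto_finsetSum _ fun s _ => ?_
    by_cases hs : (coloredGraph s).Connected
    · simp only [if_pos hs]
      exact tendsto_annealedWeight_div (by omega) β s hs
    -- The limit asks for connectedness without colour 0, which is stronger than connectedness, so
    -- disconnected graphs are absent on both sides.
    · have h2 : ¬ (coloredGraph fun c : Fin (n + 1) => s c.succ).Connected :=
        fun h => hs (connected_of_connected_succ h)
      simp [hs, h2]
  · exact tendsto_const_nhds

lemma isBigO_of_tendsto_div {f : ℕ → ℂ} {l : ℂ}
    (h : Tendsto (fun N : ℕ => f N / (N : ℂ)) atTop (𝓝 l)) :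
    f =O[atTop] fun N : ℕ => (N : ℝ) := by
  have h1 : f =O[atTop] fun N : ℕ => (N : ℂ) := by
    refine isBigO_of_div_tendsto_nhds ?_ l h
    filter_upwards [eventually_ne_atTop 0] with N hN h0
    exact absurd (by exact_mod_cast h0) hN
  refine h1.trans (isBigO_of_le _ fun N => ?_)
  simp

end

end ColoredSYK
end

theorem mainTheorem1 (D : ℕ) (hD : 2 ≤ D) (β : ℝ) (hβ : 0 < β) (d : Fin 2 →₀ ℕ) :
    (fun N : ℕ => MvPowerSeries.coeff d (ColoredSYK.quenchedFreeEnergy D N β))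
        =O[Filter.atTop] (fun N : ℕ => (N : ℝ)) ∧
    (fun N : ℕ => MvPowerSeries.coeff d (ColoredSYK.annealedFreeEnergy D N β))
        =O[Filter.atTop] (fun N : ℕ => (N : ℝ)) ∧
    Filter.Tendsto
      (fun N : ℕ => MvPowerSeries.coeff d (ColoredSYK.quenchedFreeEnergy D N β) / (N : ℂ))
      Filter.atTop (nhds (MvPowerSeries.coeff d (ColoredSYK.leadingOrder D β))) ∧
    Filter.Tendsto
      (fun N : ℕ => MvPowerSeries.coeff d (ColoredSYK.annealedFreeEnergy D N β) / (N : ℂ))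
      Filter.atTop (nhds (MvPowerSeries.coeff d (ColoredSYK.leadingOrder D β))) :=
  ⟨ColoredSYK.isBigO_of_tendsto_div (ColoredSYK.tendsto_quenchedFreeEnergy hD β d),
    ColoredSYK.isBigO_of_tendsto_div (ColoredSYK.tendsto_annealedFreeEnergy hD β d),
    ColoredSYK.tendsto_quenchedFreeEnergy hD β d,
    ColoredSYK.tendsto_annealedFreeEnergy hD β d⟩
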